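/- **Definitions.** Let $\Sigma$ be an alphabet of $\sigma$ characters, numbered $0,\dots,\sigma-1$. A *ZL78 compressed string* of length $n$ is a sequence $Z=(r_1,\alpha_1)\cdots(r_n,\alpha_n)$ with $r_i\in\{0,\dots,i-1\}$ and $\alpha_i\in\Sigma$. With $\mathrm{phrase}_0=\epsilon$ and $\mathrm{phrase}_i=\mathrm{phrase}_{r_i}\cdot\alpha_i$, it represents $Q=\mathrm{phrase}_1\cdots\mathrm{phrase}_n$. A *ZLW compressed string* of length $n$ is a sequence of $n$ codes, representing the concatenation $Q$ of the phrases that the codes stand for. Each code either is a character (and stands for it) or names the $j$-th added dictionary entry, where the $i$-th code may name only entries $j<i$; the $j$-th entry is the $j$-th phrase followed by the first character of the $(j+1)$-st phrase. (The outputs of the greedy ZL78 and ZLW compressors are of these forms.) Regular expressions $R$ are built from single characters (and, optionally, the empty string and the empty language) by $(S)\cdot(T)$, $(S)|(T)$ and $(S)^*$; the length of $R$ is the number of symbols in this fully parenthesized form. A position $j\in\{1,\dots,|Q|\}$ is a *match* if $Q[i,j]\in L(R)$ for some $1\le i\le j$. The machine is a unit-cost RAM with words of $w$ bits, read-only random-access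 input and write-only output. Its instructions are assignment, addition, subtraction, multiplication, division, comparison and indirect addressing, with branching and loops. Space is the number of words of memory, not counting the input and the output. **Theorem 2.** There are a single program and a constant $c$ such that the following holds. Let $Q$ be a string given by a ZL78 or ZLW compressed string $Z$ of length $n\ge 1$, let $R$ be a regular expression of length $m$, let $\tau\ge 1$ be an integer, and let the word length satisfy $w\ge c\log_2(\sigma+n+m+\tau)$. Then, given $Z$, $R$, $\tau$ and $\sigma$, the program outputs every match of $R$ in $Q$ exactly once, and nothing else, in time at most $$c\,\bigl(nm(m+\tau)+\mathrm{occ}\cdot m\log_2(m+1)\bigr)$$ and space at most $$c\,\Bigl(\frac{nm^2}{\tau}+nm\Bigr),$$ where $\mathrm{occ}$ is the number of matches. -/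

import Mathlib

/-! ## The machine: a word RAM with uniform cost

A machine has words of `w` bits, finitely many registers (those named in the program), a
random-access memory of `s` words, a random-access read-only input, and a write-only output stream.
Programs are built from the usual RAM instructions with branching and loops; every instruction and
every evaluated test takes one unit of time. An instruction whose result does not fit into a word,
which addresses a cell outside the memory or outside the input, or which divides by zero has no
successor state, so that a program with such a step has no execution. -/

namespace WordRAM

/-- One RAM instruction; all arguments are register names except for the literal of `const`. -/
inductive Instr where
  | const (d k : ℕ)
  | move (d a : ℕ)
  | add (d a b : ℕ)
  | sub (d a b : ℕ)
  | mul (d a b : ℕ)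
  | div (d a b : ℕ)
  /-- `d := input[a]` -/
  | read (d a : ℕ)
  /-- `d := memory[a]` -/
  | load (d a : ℕ)
  /-- `memory[a] := b` -/
  | store (a b : ℕ)
  /-- append the content of `a` to the output -/
  | write (a : ℕ)

/-- A test comparing two registers. -/
inductive Test where
  | eq (a b : ℕ)
  | lt (a b : ℕ)

/-- Programs. -/
inductive Prog where
  | skip
  | instr (i : Instr)
  | seq (p q : Prog)
  | ite (b : Test) (p q : Prog)
  | loop (b : Test) (p : Prog)

/-- Contents of the registers and of the memory, and the output written so far. -/
structure State where
  reg : ℕ → ℕ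
  mem : ℕ → ℕ
  out : List ℕ

/-- At the start, registers and memory are zero and nothing has been written. -/
def State.init : State where
  reg := fun _ => 0
  mem := fun _ => 0
  out := []

/-- Put `v` into register `d`, provided that `v` is a `w`-bit number. -/
def State.setReg (w : ℕ) (x : State) (d v : ℕ) : Option State :=
  if v < 2 ^ w then some { x with reg := Function.update x.reg d v } else none

/-- The effect of one instruction on a machine with `w`-bit words and `s` words of memory. -/
def Instr.step (w s : ℕ) (input : List ℕ) (x : State) : Instr → Option State
  | const d k => x.setReg w d k
  | move d a => x.setReg w d (x.reg a)
  | add d a b => x.setReg w d (x.reg a + x.reg b)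
  | sub d a b => x.setReg w d (x.reg a - x.reg b)
  | mul d a b => x.setReg w d (x.reg a * x.reg b)
  | div d a b => if x.reg b = 0 then none else x.setReg w d (x.reg a / x.reg b)
  | read d a => (input[x.reg a]?).bind (x.setReg w d)
  | load d a => if x.reg a < s then x.setReg w d (x.mem (x.reg a)) else none
  | store a b =>
      if x.reg a < s then some { x with mem := Function.update x.mem (x.reg a) (x.reg b) } else none
  | write a => some { x with out := x.out ++ [x.reg a] }

/-- The test succeeds in state `x`. -/
def Test.Holds (x : State) : Test → Prop
  | eq a b => x.reg a = x.reg b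
  | lt a b => x.reg a < x.reg b

/-- `Exec w s input p x t y`: on a machine with `w`-bit words and `s` words of memory, program `p`
started in state `x` halts in state `y` after exactly `t` units of time. -/
inductive Exec (w s : ℕ) (input : List ℕ) : Prog → State → ℕ → State → Prop where
  | skip (x : State) : Exec w s input .skip x 1 x
  | instr {i : Instr} {x y : State} (h : i.step w s input x = some y) :
      Exec w s input (.instr i) x 1 y
  | seq {p q : Prog} {x y z : State} {t₁ t₂ : ℕ} (hp : Exec w s input p x t₁ y)
      (hq : Exec w s input q y t₂ z) : Exec w s input (.seq p q) x (t₁ + t₂) z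
  | ite_true {b : Test} {p q : Prog} {x y : State} {t : ℕ} (hb : b.Holds x)
      (hp : Exec w s input p x t y) : Exec w s input (.ite b p q) x (t + 1) y
  | ite_false {b : Test} {p q : Prog} {x y : State} {t : ℕ} (hb : ¬ b.Holds x)
      (hq : Exec w s input q x t y) : Exec w s input (.ite b p q) x (t + 1) y
  | loop_done {b : Test} {p : Prog} {x : State} (hb : ¬ b.Holds x) :
      Exec w s input (.loop b p) x 1 x
  | loop_next {b : Test} {p : Prog} {x y z : State} {t₁ t₂ : ℕ} (hb : b.Holds x)
      (hp : Exec w s input p x t₁ y) (hl : Exec w s input (.loop b p) y t₂ z) :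
      Exec w s input (.loop b p) x (t₁ + t₂ + 1) z

/-- With `w`-bit words, program `p` on the given input halts after `t` units of time, has used no
memory beyond `s` words, and has written the list `out`. -/
def Computes (p : Prog) (w : ℕ) (input : List ℕ) (t s : ℕ) (out : List ℕ) : Prop :=
  ∃ y : State, Exec w s input p State.init t y ∧ y.out = out

end WordRAM

/-! ## Ziv-Lempel compressed strings over the alphabet `Fin σ` -/

/-- The list `Z` of pairs (reference, label) is a ZL78 compressed string that represents `Q`.
Element number `i + 1` is `Z[i]`; its reference is the number of an earlier element, or `0`. -/
def ZL78Represents {σ : ℕ} (Z : List (ℕ × Fin σ)) (Q : List (Fin σ)) : Prop :=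
  ∃ phrase : ℕ → List (Fin σ),
    phrase 0 = [] ∧
    (∀ (i : ℕ) (hi : i < Z.length),
      Z[i].1 ≤ i ∧ phrase (i + 1) = phrase Z[i].1 ++ [Z[i].2]) ∧
    Q = ((List.range Z.length).map fun i => phrase (i + 1)).flatten

/-- A ZLW code names either a single character, which is in the dictionary from the start, or the
`j`-th entry (counted from `0`) added to the dictionary. -/
inductive ZLWCode (σ : ℕ) where
  | char (a : Fin σ)
  | entry (j : ℕ)

/-- The number written for a ZLW code: the characters come first, then the added entries. -/
def ZLWCode.word {σ : ℕ} : ZLWCode σ → ℕ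
  | char a => a
  | entry j => σ + j

/-- What it means that the `i`-th code stands for `phrase i`: the `j`-th dictionary entry is
`phrase j` followed by the first character of the next phrase `phrase (j + 1)`, and it may be used
as soon as `phrase j` has been read (so `j + 1 = i` is allowed). -/
def ZLWCode.StandsFor {σ : ℕ} (phrase : ℕ → List (Fin σ)) (i : ℕ) : ZLWCode σ → Prop
  | char a => phrase i = [a]
  | entry j => j < i ∧ phrase i = phrase j ++ (phrase (j + 1)).take 1

/-- The list `Z` of codes is a ZLW compressed string that represents `Q`. -/
def ZLWRepresents {σ : ℕ} (Z : List (ZLWCode σ)) (Q : List (Fin σ)) : Prop :=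
  ∃ phrase : ℕ → List (Fin σ),
    (∀ (i : ℕ) (hi : i < Z.length), Z[i].StandsFor phrase i) ∧
    Q = ((List.range Z.length).map phrase).flatten

/-- A compressed string in one of the two formats. -/
inductive ZLString (σ : ℕ) where
  | zl78 (Z : List (ℕ × Fin σ))
  | zlw (Z : List (ZLWCode σ))

/-- The number of compression elements. -/
def ZLString.length {σ : ℕ} : ZLString σ → ℕ
  | zl78 Z => Z.length
  | zlw Z => Z.length

/-- The compressed string is well-formed and represents `Q`. -/
def ZLString.Represents {σ : ℕ} : ZLString σ → List (Fin σ) → Prop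
  | zl78 Z, Q => ZL78Represents Z Q
  | zlw Z, Q => ZLWRepresents Z Q

/-- The format of a compressed string, as a number. -/
def ZLString.format {σ : ℕ} : ZLString σ → ℕ
  | zl78 _ => 0
  | zlw _ => 1

/-- A compressed string as an array: two words for a ZL78 element, one word for a ZLW code. -/
def ZLString.words {σ : ℕ} : ZLString σ → List ℕ
  | zl78 Z => Z.flatMap fun z => [z.1, (z.2 : ℕ)]
  | zlw Z => Z.map ZLWCode.word

/-! ## Regular expressions -/

/-- A regular expression, fully parenthesized and written out symbol by symbol:
`0` is the opening and `1` the closing parenthesis, `2` concatenation, `3` union, `4` star,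
`5` the empty language, `6` the empty string, and `7 + a` the character `a`. -/
def RegularExpression.written {σ : ℕ} : RegularExpression (Fin σ) → List ℕ
  | .zero => [5]
  | .epsilon => [6]
  | .char a => [7 + (a : ℕ)]
  | .comp S T => [0] ++ S.written ++ [1, 2, 0] ++ T.written ++ [1]
  | .plus S T => [0] ++ S.written ++ [1, 3, 0] ++ T.written ++ [1]
  | .star S => [0] ++ S.written ++ [1, 4]

/-- The substring `Q[i, j]`, with positions counted from `1`. -/
def substringAt {α : Type*} (Q : List α) (i j : ℕ) : List α := (Q.take j).drop (i - 1)

/-- The ending positions of (nonempty) substrings of `Q` that match `R`. -/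
def matchEnds {α : Type*} (R : RegularExpression α) (Q : List α) : Set ℕ :=
  {j | j ≤ Q.length ∧ ∃ i, 1 ≤ i ∧ i ≤ j ∧ substringAt Q i j ∈ R.matches'}

/-- The input array for the matching problem: a header followed by `Z` and `R`. -/
def matchInput {σ : ℕ} (Z : ZLString σ) (R : RegularExpression (Fin σ)) (τ : ℕ) : List ℕ :=
  [Z.format, σ, Z.length, R.written.length, τ] ++ Z.words ++ R.written

/-! # Matching a regular expression in a Ziv-Lempel compressed string

Both compressed formats describe a trie with the nodes `0, …, n` whose node `i + 1` stands for the
phrase number `i + 1` (`isTrie_of_zl78`, `isTrie_of_zlw`). For ZLW, the entry `j` extends phrase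
`j` by the first character of the next phrase, so that it is enough to know the first characters
of all phrases.

*The automaton.* The expression is turned into a position automaton with two slots for every
position of its written form, a beginning and an end of the subexpression written there. It has
`O(m)` `ε`-edges, and these can be listed in such an order that a single sweep computes the
`ε`-closure of a set of slots (`Path`): first the edges into ends, children before parents, then
those into beginnings, parents before children. Edges that cross a nullable operand are added
explicitly, and so no `ε`-path leads from the beginning to the end of the whole expression. With a
loop at the beginning slot `1` for restarts, a word leads from slot `1` to acceptance exactly if
it has a nonempty suffix in the language (`mem_acc_one_iff`). Soundness follows by labelling slots
with continuation languages (`exists_continuation`), completeness by induction on the expression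
(`spells_of_mem`). One character is read by a set of slots in time `O(m)`. The machine finds the
edges with a stack parser (`Parser.run_written`) and a right-to-left sweep for nullability.

*The sample.* Among the `τ` residue classes of depths, one contains at most `n / τ` nodes
(`exists_sampled_le`). For these nodes the transition relation of the node's word is stored as a
bit matrix with `4 * m ^ 2` entries, which explains the space `n * m ^ 2 / τ`. Every node has,
within `τ` steps towards the root, an ancestor that is in the sample or the root (`upwalk_spec`).
So the image of a set of slots under the word of any node is computed in time `O(m ^ 2 + τ * m)`,
by one product with a stored matrix and at most `τ` single steps. The matrices themselves are
computed row by row from those of smaller nodes: a row takes `O(τ * m)` steps, and so all of them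
together take `O(n * m ^ 2)` steps.

*The matches.* For every node `v` and slot `s`, a table of size `O(n * m)` keeps the nearest
ancestor of `v` (or `v` itself) whose word leads from `s` to acceptance; it is computed by running
the automaton backwards (`matchTable_spec`). In the final pass over the phrases, the matches that
end in a phrase are the ancestors of its node that accept from some slot in the current set. They
are enumerated by jumping from each one to the next in time `O(m)` (`reportPhrase_spec`). Every
position of the text lies in exactly one phrase, so every match is reported once
(`IsTrie.mem_reports_iff`, `IsTrie.nodup_reports`).

*The machine.* The program is written in a small structured language with variables and arrays,
which is compiled to the machine. The arrays are interleaved in the memory (`Sim`). A ghost field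
of the store counts machine steps, so that the specifications in terms of `Run` bound the running
time together with the functional behaviour (`Run.loop`, `Run.count`); `program_spec` combines
them. -/

/-! ### A structured language on top of the machine -/

namespace WordRAM

/-- Scalar variables of the structured language; each one is kept in a register of its own. The
parameters are `fmt` (the format of the compressed string), `sg` (the size of the alphabet), `n`,
`m`, `tau`, and `N`, which is `2 * m`; the others are counters and temporaries. -/
inductive Var where
  | fmt | sg | n | m | N | tau | ro | i | j | k | x | y | r | sp | ec | res | cnt
  | nd | up | s | t | lab | blk | tmp | off | go | best
deriving DecidableEq

/-- Arrays of the structured language: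
* `par`, `chr`, `dep`: parents, last symbols and depths of the nodes of the trie, and `fst`, the
  first characters of their words;
* `kind`, `sec`, `nul`: the tables of the parsed expression; `stk`: a stack;
* `fsrc`, `fdst`: the `ε`-edges of the automaton; `bsrc`, `bdst`: the same, reversed;
* `X`, `Y`: sets of slots, as characteristic vectors;
* `sel`, `rel`: the sample of the trie and the transition relations of its nodes;
* `mt`: for each node and slot, the nearest matching ancestor of the node. -/
inductive Arr where
  | par | chr | dep | sel | fst | stk | kind | sec | nul | fsrc | fdst | bsrc | bdst | X | Y | rel
  | mt
deriving DecidableEq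

/-- Expressions over variables, arrays and the input. -/
inductive Expr where
  | lit (k : ℕ)
  | var (v : Var)
  | add (a b : Expr)
  | sub (a b : Expr)
  | mul (a b : Expr)
  | div (a b : Expr)
  | arr (a : Arr) (e : Expr)
  | inp (e : Expr)

/-- Tests between expressions. -/
inductive Cond where
  | eq (a b : Expr)
  | lt (a b : Expr)

/-- Commands. A `block` behaves as its body; it marks a subroutine that symbolic execution leaves
alone. -/
inductive Cmd where
  | skip
  | assign (v : Var) (e : Expr)
  | aset (a : Arr) (i e : Expr)
  | out (e : Expr)
  | seq (c d : Cmd)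
  | ite (b : Cond) (c d : Cmd)
  | loop (b : Cond) (c : Cmd)
  | block (c : Cmd)

infixr:60 " ;; " => Cmd.seq
infix:62 " ::= " => Cmd.assign

/-- Stores of the structured language. The field `time` is a ghost that counts the machine steps
taken so far. -/
structure Store where
  var : Var → ℕ
  arr : Arr → ℕ → ℕ
  out : List ℕ
  time : ℕ

/-- A machine (word length `w`, input), the common length `M` of all arrays, and a bound `U` on
the contents of all variables and array cells. Expressions have at most `20` nodes, so all their
values are below `U ^ 24` and fit into a word. -/
structure Env where
  w : ℕ
  M : ℕ
  U : ℕ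
  input : List ℕ
  le_U : 64 ≤ U
  mem_le : 32 * M ≤ U
  pow_le : U ^ 24 ≤ 2 ^ w
  input_lt : ∀ v ∈ input, v < U

namespace Store

/-- Assign `a` to the variable `v`, taking `k` steps. -/
def set (σ : Store) (v : Var) (a k : ℕ) : Store :=
  { σ with var := Function.update σ.var v a, time := σ.time + k }

/-- Assign `x` to entry `i` of the array `a`, taking `k` steps. -/
def aset (σ : Store) (a : Arr) (i x k : ℕ) : Store :=
  { σ with arr := Function.update σ.arr a (Function.update (σ.arr a) i x), time := σ.time + k }

/-- Write `x` to the output, taking `k` steps. -/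
def push (σ : Store) (x k : ℕ) : Store :=
  { σ with out := σ.out ++ [x], time := σ.time + k }

/-- Let `k` steps pass. -/
def tick (σ : Store) (k : ℕ) : Store := { σ with time := σ.time + k }

variable (σ : Store) (v u : Var) (a b : Arr) (i x k : ℕ)

@[simp] theorem set_var : (σ.set v x k).var u = if u = v then x else σ.var u := by
  simp [set, Function.update_apply]
@[simp] theorem set_arr : (σ.set v x k).arr = σ.arr := rfl
@[simp] theorem set_out : (σ.set v x k).out = σ.out := rfl
@[simp] theorem set_time : (σ.set v x k).time = σ.time + k := rfl
@[simp] theorem aset_var : (σ.aset a i x k).var = σ.var := rfl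
@[simp] theorem aset_arr :
    (σ.aset a i x k).arr b = if b = a then Function.update (σ.arr a) i x else σ.arr b := by
  simp [aset, Function.update_apply]
@[simp] theorem aset_out : (σ.aset a i x k).out = σ.out := rfl
@[simp] theorem aset_time : (σ.aset a i x k).time = σ.time + k := rfl
@[simp] theorem push_var : (σ.push x k).var = σ.var := rfl
@[simp] theorem push_arr : (σ.push x k).arr = σ.arr := rfl
@[simp] theorem push_out : (σ.push x k).out = σ.out ++ [x] := rfl
@[simp] theorem push_time : (σ.push x k).time = σ.time + k := rfl
@[simp] theorem tick_var : (σ.tick k).var = σ.var := rfl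
@[simp] theorem tick_arr : (σ.tick k).arr = σ.arr := rfl
@[simp] theorem tick_out : (σ.tick k).out = σ.out := rfl
@[simp] theorem tick_time : (σ.tick k).time = σ.time + k := rfl

/-- All variables and array cells hold numbers below `U`. -/
def Bdd (E : Env) : Prop := (∀ v, σ.var v < E.U) ∧ ∀ a i, σ.arr a i < E.U

end Store

namespace Expr

/-- The number of nodes. -/
@[simp] def size : Expr → ℕ
  | lit _ | var _ => 1
  | add a b | sub a b | mul a b | div a b => a.size + b.size + 1
  | arr _ e | inp e => e.size + 1

/-- All literals are below `64`. -/
@[simp] def litsOK : Expr → Bool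
  | lit k => k < 64
  | var _ => true
  | add a b | sub a b | mul a b | div a b => a.litsOK && b.litsOK
  | arr _ e | inp e => e.litsOK

/-- The number of machine steps of an evaluation. -/
@[simp] def cost : Expr → ℕ
  | lit _ | var _ => 1
  | add a b | sub a b | mul a b | div a b => a.cost + b.cost + 1
  | arr _ e => e.cost + 5
  | inp e => e.cost + 1

/-- The value of an expression. -/
@[simp] def eval (E : Env) (σ : Store) : Expr → ℕ
  | lit k => k
  | var v => σ.var v
  | add a b => a.eval E σ + b.eval E σ
  | sub a b => a.eval E σ - b.eval E σ
  | mul a b => a.eval E σ * b.eval E σ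
  | div a b => a.eval E σ / b.eval E σ
  | arr a e => σ.arr a (e.eval E σ)
  | inp e => E.input.getD (e.eval E σ) 0

/-- Evaluation addresses only existing cells and does not divide by zero. -/
@[simp] def Safe (E : Env) (σ : Store) : Expr → Prop
  | lit _ | var _ => True
  | add a b | sub a b | mul a b => a.Safe E σ ∧ b.Safe E σ
  | div a b => a.Safe E σ ∧ b.Safe E σ ∧ b.eval E σ ≠ 0
  | arr _ e => e.Safe E σ ∧ e.eval E σ < E.M
  | inp e => e.Safe E σ ∧ e.eval E σ < E.input.length

/-- Code that puts the value of an expression into register `d`, using only registers from `d` on as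
scratch space. Entry `i` of the array number `a` is kept in the memory cell `32 * i + a`. -/
def code : Expr → ℕ → Prog
  | lit k, d => .instr (.const d k)
  | var v, d => .instr (.move d v.ctorIdx)
  | add a b, d => .seq (.seq (a.code d) (b.code (d + 1))) (.instr (.add d d (d + 1)))
  | sub a b, d => .seq (.seq (a.code d) (b.code (d + 1))) (.instr (.sub d d (d + 1)))
  | mul a b, d => .seq (.seq (a.code d) (b.code (d + 1))) (.instr (.mul d d (d + 1)))
  | div a b, d => .seq (.seq (a.code d) (b.code (d + 1))) (.instr (.div d d (d + 1)))
  | arr a e, d => .seq (e.code d) (.seq (.instr (.const (d + 1) 32))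
      (.seq (.instr (.mul d d (d + 1))) (.seq (.instr (.const (d + 1) a.ctorIdx))
      (.seq (.instr (.add d d (d + 1))) (.instr (.load d d))))))
  | inp e, d => .seq (e.code d) (.instr (.read d d))

end Expr

namespace Cond

/-- The truth value of a test. -/
@[simp] def Holds (E : Env) (σ : Store) : Cond → Prop
  | eq a b => a.eval E σ = b.eval E σ
  | lt a b => a.eval E σ < b.eval E σ

/-- Both sides of the test are safe. -/
@[simp] def Safe (E : Env) (σ : Store) : Cond → Prop
  | eq a b | lt a b => a.Safe E σ ∧ b.Safe E σ

/-- The number of machine steps that prepare a test. -/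
@[simp] def cost : Cond → ℕ
  | eq a b | lt a b => a.cost + b.cost

/-- Both sides of the test are short enough and have small literals. -/
@[simp] def ok : Cond → Bool
  | eq a b | lt a b => a.litsOK && b.litsOK && a.size ≤ 20 && b.size ≤ 20

/-- Put the sides of a test into the registers `64` and `65`. -/
def code : Cond → Prog
  | eq a b | lt a b => .seq (a.code 64) (b.code 65)

/-- The test of the registers `64` and `65`. -/
def test : Cond → Test
  | eq _ _ => .eq 64 65
  | lt _ _ => .lt 64 65

end Cond

namespace Cmd

/-- The compiler. Values are computed in the registers from `64` on, above those of the variables.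
-/
def code : Cmd → Prog
  | skip => .skip
  | assign v e => .seq (e.code 64) (.instr (.move v.ctorIdx 64))
  | aset a i e => .seq (e.code 64) (.seq (i.code 65) (.seq (.instr (.const 66 32))
      (.seq (.instr (.mul 65 65 66)) (.seq (.instr (.const 66 a.ctorIdx))
      (.seq (.instr (.add 65 65 66)) (.instr (.store 65 64)))))))
  | out e => .seq (e.code 64) (.instr (.write 64))
  | seq c d => .seq c.code d.code
  | ite b c d => .seq b.code (.ite b.test c.code d.code)
  | .loop b c => .seq b.code (.loop b.test (.seq c.code b.code))
  | block c => c.code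

/-- All expressions are short enough and have small literals. -/
def ok : Cmd → Bool
  | skip => true
  | assign _ e | out e => e.litsOK && e.size ≤ 20
  | aset _ i e => i.litsOK && i.size ≤ 20 && e.litsOK && e.size ≤ 20
  | seq c d => c.ok && d.ok
  | ite b c d => b.ok && c.ok && d.ok
  | .loop b c => b.ok && c.ok
  | block c => c.ok

/-- The command may assign to the variable `v`. -/
def setsVar (v : Var) : Cmd → Bool
  | assign u _ => v = u
  | seq c d | ite _ c d => c.setsVar v || d.setsVar v
  | .loop _ c | block c => c.setsVar v
  | skip | aset _ _ _ | out _ => false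

/-- The command may assign to the array `a`. -/
def setsArr (a : Arr) : Cmd → Bool
  | aset b _ _ => a = b
  | seq c d | ite _ c d => c.setsArr a || d.setsArr a
  | .loop _ c | block c => c.setsArr a
  | skip | assign _ _ | out _ => false

/-- The command may write to the output. -/
def writes : Cmd → Bool
  | out _ => true
  | seq c d | ite _ c d => c.writes || d.writes
  | .loop _ c | block c => c.writes
  | skip | assign _ _ | aset _ _ _ => false

/-- What the command cannot assign to is the same in both stores. -/
structure Frame (c : Cmd) (σ σ' : Store) : Prop where
  var : ∀ v, c.setsVar v = false → σ'.var v = σ.var v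
  arr : ∀ a, c.setsArr a = false → σ'.arr a = σ.arr a
  out : c.writes = false → σ'.out = σ.out

theorem Frame.trans {c : Cmd} {σ σ' σ'' : Store} (h : Frame c σ σ') (h' : Frame c σ' σ'') :
    Frame c σ σ'' :=
  ⟨fun v hv => (h'.var v hv).trans (h.var v hv), fun a ha => (h'.arr a ha).trans (h.arr a ha),
    fun ho => (h'.out ho).trans (h.out ho)⟩

theorem Frame.mono {c d : Cmd} {σ σ' : Store} (h : Frame c σ σ')
    (hv : ∀ v, d.setsVar v = false → c.setsVar v = false)
    (ha : ∀ a, d.setsArr a = false → c.setsArr a = false)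
    (ho : d.writes = false → c.writes = false) : Frame d σ σ' :=
  ⟨fun v hv' => h.var v (hv v hv'), fun a ha' => h.arr a (ha a ha'), fun ho' => h.out (ho ho')⟩

end Cmd

/-- The machine state `x` represents the store `σ`. -/
structure Sim (E : Env) (σ : Store) (x : State) : Prop where
  reg : ∀ v : Var, x.reg v.ctorIdx = σ.var v
  mem : ∀ (a : Arr) (i : ℕ), i < E.M → x.mem (32 * i + a.ctorIdx) = σ.arr a i
  out : x.out = σ.out

theorem Var.ctorIdx_lt (v : Var) : v.ctorIdx < 64 := by cases v <;> decide
theorem Arr.ctorIdx_lt (a : Arr) : a.ctorIdx < 32 := by cases a <;> decide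
theorem Var.ctorIdx_inj {v u : Var} : v.ctorIdx = u.ctorIdx ↔ v = u :=
  (Function.LeftInverse.injective Var.ofNat_ctorIdx).eq_iff
theorem Arr.ctorIdx_inj {v u : Arr} : v.ctorIdx = u.ctorIdx ↔ v = u :=
  (Function.LeftInverse.injective Arr.ofNat_ctorIdx).eq_iff

variable {E : Env}

@[simp] theorem Expr.eval_tick (σ : Store) (k : ℕ) (e : Expr) :
    e.eval E (σ.tick k) = e.eval E σ := by
  induction e <;> simp_all

@[simp] theorem Expr.safe_tick (σ : Store) (k : ℕ) (e : Expr) :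
    e.Safe E (σ.tick k) ↔ e.Safe E σ := by
  induction e <;> simp_all

@[simp] theorem Cond.holds_tick (σ : Store) (k : ℕ) (b : Cond) :
    b.Holds E (σ.tick k) ↔ b.Holds E σ := by
  cases b <;> simp

@[simp] theorem Cond.safe_tick (σ : Store) (k : ℕ) (b : Cond) :
    b.Safe E (σ.tick k) ↔ b.Safe E σ := by
  cases b <;> simp

theorem Env.one_lt (E : Env) : 1 < E.U := lt_of_lt_of_le (by norm_num) E.le_U

theorem Env.lt_of_lt_pow (E : Env) {v k : ℕ} (h : v < E.U ^ k) (hk : k ≤ 24) : v < 2 ^ E.w :=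
  lt_of_lt_of_le h ((Nat.pow_le_pow_right (by have := E.one_lt; omega) hk).trans E.pow_le)

theorem Env.lt_word (E : Env) {v : ℕ} (h : v < E.U) : v < 2 ^ E.w :=
  E.lt_of_lt_pow (k := 1) (by simpa using h) (by norm_num)

theorem Expr.eval_lt {σ : Store} (hσ : σ.Bdd E) (e : Expr) (h : e.litsOK = true) :
    e.eval E σ < E.U ^ e.size := by
  have h1 := E.one_lt
  have two : ∀ p q x y : ℕ, x < E.U ^ p → y < E.U ^ q →
      x + y < E.U ^ (p + q + 1) ∧ x * y < E.U ^ (p + q + 1) ∧ x < E.U ^ (p + q + 1) := by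
    intro p q x y hx hy
    have hp : 1 ≤ E.U ^ p := Nat.one_le_pow _ _ (by omega)
    have hq : 1 ≤ E.U ^ q := Nat.one_le_pow _ _ (by omega)
    have hxy : x * y < E.U ^ p * E.U ^ q := Nat.mul_lt_mul'' hx hy
    have h2 : E.U ^ (p + q + 1) = E.U ^ p * E.U ^ q * E.U := by rw [pow_succ, pow_add]
    rw [h2]
    generalize E.U ^ p = A at *
    generalize E.U ^ q = B at *
    have h3 : A * B * 2 ≤ A * B * E.U := Nat.mul_le_mul_left _ h1
    have h4 : A ≤ A * B := Nat.le_mul_of_pos_right _ hq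
    have h5 : B ≤ A * B := Nat.le_mul_of_pos_left _ hp
    omega
  induction e with
  | lit k => simp at h ⊢; exact lt_of_lt_of_le h E.le_U
  | var v => simpa using hσ.1 v
  | add a b iha ihb =>
    simp at h; exact (two _ _ _ _ (iha h.1) (ihb h.2)).1
  | sub a b iha ihb =>
    simp at h; exact lt_of_le_of_lt (Nat.sub_le _ _) (two _ _ _ _ (iha h.1) (ihb h.2)).2.2
  | mul a b iha ihb =>
    simp at h; exact (two _ _ _ _ (iha h.1) (ihb h.2)).2.1
  | div a b iha ihb =>
    simp at h; exact lt_of_le_of_lt (Nat.div_le_self _ _) (two _ _ _ _ (iha h.1) (ihb h.2)).2.2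
  | arr a e ih => exact lt_of_lt_of_le (hσ.2 _ _) (Nat.le_self_pow (by simp) _)
  | inp e ih =>
    refine lt_of_lt_of_le ?_ (Nat.le_self_pow (by simp) _)
    simp only [eval]
    rw [List.getD_eq_getElem?_getD]
    cases hv : E.input[e.eval E σ]? with
    | none => simp; omega
    | some v => simpa using E.input_lt v (List.mem_of_getElem? hv)

/-- The code of a safe expression runs, and disturbs nothing but scratch registers. -/
theorem Expr.exec {σ : Store} (hσ : σ.Bdd E) (e : Expr) :
    ∀ (d : ℕ) (x : State), 64 ≤ d → Sim E σ x → e.litsOK = true → e.size ≤ 20 → e.Safe E σ →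
    ∃ y : State, Exec E.w (32 * E.M) E.input (e.code d) x e.cost y ∧ y.reg d = e.eval E σ ∧
      (∀ r < d, y.reg r = x.reg r) ∧ y.mem = x.mem ∧ y.out = x.out := by
  have fits : ∀ e : Expr, e.litsOK = true → e.size ≤ 20 → e.eval E σ < 2 ^ E.w :=
    fun e h hs => E.lt_of_lt_pow (e.eval_lt hσ h) (hs.trans (by norm_num))
  have keep : ∀ (x y : State) (d : ℕ), 64 ≤ d → Sim E σ x → (∀ r < d, y.reg r = x.reg r) →
      y.mem = x.mem → y.out = x.out → Sim E σ y := by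
    intro x y d hd hx h1 h2 h3
    exact ⟨fun v => by rw [h1 _ (v.ctorIdx_lt.trans_le hd), hx.reg],
      fun a i hi => by rw [h2, hx.mem a i hi], by rw [h3, hx.out]⟩
  have bin : ∀ (a b : Expr) (d : ℕ) (x : State) (ins : Instr) (val : ℕ), 64 ≤ d → Sim E σ x →
      (∃ y : State, Exec E.w (32 * E.M) E.input (a.code d) x a.cost y ∧ y.reg d = a.eval E σ ∧
        (∀ r < d, y.reg r = x.reg r) ∧ y.mem = x.mem ∧ y.out = x.out) →
      (∀ y : State, Sim E σ y →
        ∃ z : State, Exec E.w (32 * E.M) E.input (b.code (d + 1)) y b.cost z ∧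
        z.reg (d + 1) = b.eval E σ ∧
        (∀ r < d + 1, z.reg r = y.reg r) ∧ z.mem = y.mem ∧ z.out = y.out) →
      (∀ z : State, z.reg d = a.eval E σ → z.reg (d + 1) = b.eval E σ →
        ins.step E.w (32 * E.M) E.input z = some { z with reg := Function.update z.reg d val }) →
      ∃ y : State, Exec E.w (32 * E.M) E.input
        (.seq (.seq (a.code d) (b.code (d + 1))) (.instr ins)) x (a.cost + b.cost + 1) y ∧
        y.reg d = val ∧ (∀ r < d, y.reg r = x.reg r) ∧ y.mem = x.mem ∧ y.out = x.out := by
    rintro a b d x ins val hd hx ⟨y, hy, hyd, hyr, hym, hyo⟩ hb hins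
    obtain ⟨z, hz, hzd, hzr, hzm, hzo⟩ := hb y (keep x y d hd hx hyr hym hyo)
    refine ⟨_, .seq (.seq hy hz) (.instr (hins z (by rw [hzr d (by omega), hyd]) hzd)), by simp,
      fun r hr => ?_, by simp [hzm, hym], by simp [hzo, hyo]⟩
    simp only [Function.update_of_ne (show r ≠ d by omega)]
    rw [hzr r (by omega), hyr r hr]
  induction e with
  | lit k =>
    intro d x hd hx hl hs _
    refine ⟨{ x with reg := Function.update x.reg d k }, .instr ?_, by simp, fun r hr => ?_, rfl,
      rfl⟩
    · simpa [Instr.step, State.setReg] using fits _ hl hs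
    · simp [Function.update_of_ne (show r ≠ d by omega)]
  | var v =>
    intro d x hd hx hl hs _
    refine ⟨{ x with reg := Function.update x.reg d (σ.var v) }, .instr ?_, by simp,
      fun r hr => ?_, rfl, rfl⟩
    · simpa [Instr.step, State.setReg, hx.reg] using fits _ hl hs
    · simp [Function.update_of_ne (show r ≠ d by omega)]
  | add a b iha ihb =>
    intro d x hd hx hl hs hsafe
    have hf := fits _ hl hs
    simp only [litsOK, size, Safe, eval, Bool.and_eq_true] at hl hs hsafe hf ⊢
    refine bin a b d x _ _ hd hx (iha d x hd hx hl.1 (by omega) hsafe.1)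
      (fun y hy => ihb (d + 1) y (by omega) hy hl.2 (by omega) hsafe.2) fun z h1 h2 => ?_
    simp [Instr.step, State.setReg, h1, h2, hf]
  | sub a b iha ihb =>
    intro d x hd hx hl hs hsafe
    have hf := fits _ hl hs
    simp only [litsOK, size, Safe, eval, Bool.and_eq_true] at hl hs hsafe hf ⊢
    refine bin a b d x _ _ hd hx (iha d x hd hx hl.1 (by omega) hsafe.1)
      (fun y hy => ihb (d + 1) y (by omega) hy hl.2 (by omega) hsafe.2) fun z h1 h2 => ?_
    simp [Instr.step, State.setReg, h1, h2, hf]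
  | mul a b iha ihb =>
    intro d x hd hx hl hs hsafe
    have hf := fits _ hl hs
    simp only [litsOK, size, Safe, eval, Bool.and_eq_true] at hl hs hsafe hf ⊢
    refine bin a b d x _ _ hd hx (iha d x hd hx hl.1 (by omega) hsafe.1)
      (fun y hy => ihb (d + 1) y (by omega) hy hl.2 (by omega) hsafe.2) fun z h1 h2 => ?_
    simp [Instr.step, State.setReg, h1, h2, hf]
  | div a b iha ihb =>
    intro d x hd hx hl hs hsafe
    have hf := fits _ hl hs
    simp only [litsOK, size, Safe, eval, Bool.and_eq_true] at hl hs hsafe hf ⊢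
    refine bin a b d x _ _ hd hx (iha d x hd hx hl.1 (by omega) hsafe.1)
      (fun y hy => ihb (d + 1) y (by omega) hy hl.2 (by omega) hsafe.2.1) fun z h1 h2 => ?_
    simp [Instr.step, State.setReg, h1, h2, hf, hsafe.2.2]
  | arr a e ih =>
    intro d x hd hx hl hs hsafe
    have hf := fits _ hl hs
    simp only [litsOK, size, Safe, eval] at hl hs hsafe hf ⊢
    obtain ⟨y, hy, hyd, hyr, hym, hyo⟩ := ih d x hd hx hl (by omega) hsafe.1
    have ha := a.ctorIdx_lt
    have hU := E.le_U
    have hM := E.mem_le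
    have hlt : 32 * e.eval E σ + a.ctorIdx < E.U := by omega
    have hlt1 : e.eval E σ * 32 < 2 ^ E.w := E.lt_word (by omega)
    have hlt2 : e.eval E σ * 32 + a.ctorIdx < 2 ^ E.w := E.lt_word (by omega)
    have hlt3 : 32 < 2 ^ E.w := E.lt_word (by omega)
    have hlt4 : a.ctorIdx < 2 ^ E.w := E.lt_word (by omega)
    have hval : y.mem (e.eval E σ * 32 + a.ctorIdx) = σ.arr a (e.eval E σ) := by
      rw [hym, mul_comm, hx.mem a _ hsafe.2]
    refine ⟨_, .seq hy (.seq (.instr (y := { y with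
      reg := Function.update y.reg (d + 1) 32 }) ?_) (.seq (.instr (y := { y with
      reg := Function.update (Function.update y.reg (d + 1) 32) d (e.eval E σ * 32) }) ?_)
      (.seq (.instr (y := { y with
      reg := Function.update (Function.update (Function.update y.reg (d + 1) 32) d
        (e.eval E σ * 32)) (d + 1) a.ctorIdx }) ?_) (.seq (.instr (y := { y with
      reg := Function.update (Function.update (Function.update (Function.update y.reg (d + 1) 32) d
        (e.eval E σ * 32)) (d + 1) a.ctorIdx) d (e.eval E σ * 32 + a.ctorIdx) }) ?_)
      (.instr (y := { y with
      reg := Function.update (Function.update (Function.update (Function.update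
        (Function.update y.reg (d + 1) 32) d
        (e.eval E σ * 32)) (d + 1) a.ctorIdx) d (e.eval E σ * 32 + a.ctorIdx)) d
          (σ.arr a (e.eval E σ)) }) ?_))))), ?_, ?_, ?_, ?_⟩
    · simp [Instr.step, State.setReg, hlt3]
    · simp [Instr.step, State.setReg, hyd, hlt1]
    · simp [Instr.step, State.setReg, hlt4]
    · simp [Instr.step, State.setReg, hlt2]
    · have : e.eval E σ * 32 + a.ctorIdx < 32 * E.M := by omega
      simp [Instr.step, State.setReg, this, hval, hf]
    · simp
    · intro r hr
      simp [Function.update_of_ne (show r ≠ d by omega),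
        Function.update_of_ne (show r ≠ d + 1 by omega), hyr r hr]
    · exact hym
    · exact hyo
  | inp e ih =>
    intro d x hd hx hl hs hsafe
    have hf := fits _ hl hs
    simp only [litsOK, size, Safe, eval] at hl hs hsafe hf ⊢
    obtain ⟨y, hy, hyd, hyr, hym, hyo⟩ := ih d x hd hx hl (by omega) hsafe.1
    refine ⟨{ y with reg := Function.update y.reg d (E.input.getD (e.eval E σ) 0) },
      .seq hy (.instr ?_), by simp, ?_, hym, hyo⟩
    · have h3 := hsafe.2
      simp only [List.getD_eq_getElem?_getD, List.getElem?_eq_getElem h3, Option.getD_some] at hf ⊢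
      simp [Instr.step, State.setReg, hyd, List.getElem?_eq_getElem h3, hf]
    · intro r hr
      simp [Function.update_of_ne (show r ≠ d by omega), hyr r hr]

/-- `Run E c σ Q`: from every machine state that represents `σ`, the code of `c` runs to a state
that represents a store in which `Q` holds, and the ghost `time` counts the steps. -/
def Run (E : Env) (c : Cmd) (σ : Store) (Q : Store → Prop) : Prop :=
  c.ok = true → σ.Bdd E → ∀ x, Sim E σ x → ∃ t y σ', Exec E.w (32 * E.M) E.input c.code x t y ∧
    Sim E σ' y ∧ σ'.Bdd E ∧ Cmd.Frame c σ σ' ∧ σ'.time = σ.time + t ∧ Q σ'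

namespace Run

theorem conseq {c : Cmd} {σ : Store} {Q Q' : Store → Prop} (h : Run E c σ Q)
    (hQ : ∀ σ', σ'.Bdd E → c.Frame σ σ' → Q σ' → Q' σ') : Run E c σ Q' := by
  intro ok hb x hx
  obtain ⟨t, y, σ', h1, h2, h3, h4, h5, h6⟩ := h ok hb x hx
  exact ⟨t, y, σ', h1, h2, h3, h4, h5, hQ σ' h3 h4 h6⟩

theorem skip {σ : Store} {Q : Store → Prop} (h : Q (σ.tick 1)) : Run E .skip σ Q := by
  intro _ hb x hx
  exact ⟨1, x, σ.tick 1, .skip x, ⟨hx.reg, hx.mem, hx.out⟩, hb, ⟨by simp, by simp, by simp⟩,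
    by simp, h⟩

theorem assign {v : Var} {e : Expr} {σ : Store} {Q : Store → Prop} (hs : e.Safe E σ)
    (hv : e.eval E σ < E.U) (h : Q (σ.set v (e.eval E σ) (e.cost + 1))) :
    Run E (.assign v e) σ Q := by
  intro ok hb x hx
  simp [Cmd.ok] at ok
  obtain ⟨y, hy, hyd, hyr, hym, hyo⟩ := e.exec hb 64 x le_rfl hx ok.1 ok.2 hs
  refine ⟨e.cost + 1, { y with reg := Function.update y.reg v.ctorIdx (e.eval E σ) },
    σ.set v (e.eval E σ) (e.cost + 1),
    .seq hy (.instr ?_), ⟨fun u => ?_, fun a i hi => ?_, ?_⟩, ⟨fun u => ?_, hb.2⟩,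
    ⟨fun u hu => ?_, by simp, by simp⟩, by simp, h⟩
  · simp [Instr.step, State.setReg, hyd, E.lt_word hv]
  · simp only [Function.update_apply, Var.ctorIdx_inj, Store.set_var]
    split_ifs
    · rfl
    · rw [hyr _ u.ctorIdx_lt, hx.reg]
  · simp [hym, hx.mem a i hi]
  · simp [hyo, hx.out]
  · simp only [Store.set_var]
    split_ifs
    · exact hv
    · exact hb.1 u
  · simp [Cmd.setsVar] at hu
    simp [hu]

theorem aset {a : Arr} {i e : Expr} {σ : Store} {Q : Store → Prop} (hs : e.Safe E σ)
    (hsi : i.Safe E σ) (hi : i.eval E σ < E.M) (hv : e.eval E σ < E.U)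
    (h : Q (σ.aset a (i.eval E σ) (e.eval E σ) (e.cost + i.cost + 5))) :
    Run E (.aset a i e) σ Q := by
  intro ok hb x hx
  simp [Cmd.ok] at ok
  obtain ⟨⟨⟨ok1, ok2⟩, ok3⟩, ok4⟩ := ok
  obtain ⟨y, hy, hyd, hyr, hym, hyo⟩ := e.exec hb 64 x le_rfl hx ok3 ok4 hs
  have hsy : Sim E σ y := ⟨fun v => by rw [hyr _ v.ctorIdx_lt, hx.reg],
    fun a i hi => by rw [hym, hx.mem a i hi], by rw [hyo, hx.out]⟩
  obtain ⟨z, hz, hzd, hzr, hzm, hzo⟩ := i.exec hb 65 y (by norm_num) hsy ok1 ok2 hsi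
  have hz64 : z.reg 64 = e.eval E σ := by rw [hzr 64 (by norm_num), hyd]
  have ha := a.ctorIdx_lt
  have hU := E.le_U
  have hM := E.mem_le
  have hlt1 : i.eval E σ * 32 < 2 ^ E.w := E.lt_word (by omega)
  have hlt2 : i.eval E σ * 32 + a.ctorIdx < 2 ^ E.w := E.lt_word (by omega)
  have hlt3 : 32 < 2 ^ E.w := E.lt_word (by omega)
  have hlt4 : a.ctorIdx < 2 ^ E.w := E.lt_word (by omega)
  have hexec : ∃ z' : State, Exec E.w (32 * E.M) E.input (.seq (.instr (.const 66 32))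
      (.seq (.instr (.mul 65 65 66)) (.seq (.instr (.const 66 a.ctorIdx))
      (.seq (.instr (.add 65 65 66)) (.instr (.store 65 64)))))) z 5 z' ∧
      (∀ r < 64, z'.reg r = z.reg r) ∧
      z'.mem = Function.update z.mem (i.eval E σ * 32 + a.ctorIdx) (e.eval E σ) ∧
      z'.out = z.out := by
    refine ⟨_, .seq (.instr (y := { z with
      reg := Function.update z.reg 66 32 }) ?_) (.seq (.instr (y := { z with
      reg := Function.update (Function.update z.reg 66 32) 65 (i.eval E σ * 32) }) ?_)
      (.seq (.instr (y := { z with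
      reg := Function.update (Function.update (Function.update z.reg 66 32) 65
        (i.eval E σ * 32)) 66 a.ctorIdx }) ?_) (.seq (.instr (y := { z with
      reg := Function.update (Function.update (Function.update (Function.update z.reg 66 32) 65
        (i.eval E σ * 32)) 66 a.ctorIdx) 65 (i.eval E σ * 32 + a.ctorIdx) }) ?_)
      (.instr (y := { z with
      reg := Function.update (Function.update (Function.update (Function.update z.reg 66 32) 65
        (i.eval E σ * 32)) 66 a.ctorIdx) 65 (i.eval E σ * 32 + a.ctorIdx)
      mem := Function.update z.mem (i.eval E σ * 32 + a.ctorIdx) (e.eval E σ) }) ?_)))),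
      ?_, ?_, ?_⟩
    · simp [Instr.step, State.setReg, hlt3]
    · simp [Instr.step, State.setReg, hzd, hlt1]
    · simp [Instr.step, State.setReg, hlt4]
    · simp [Instr.step, State.setReg, hlt2]
    · have : i.eval E σ * 32 + a.ctorIdx < 32 * E.M := by omega
      simp [Instr.step, this, hz64]
    · intro r hr
      simp [Function.update_of_ne (show r ≠ 65 by omega),
        Function.update_of_ne (show r ≠ 66 by omega)]
    · rfl
    · rfl
  obtain ⟨z', hz', hzr', hzm', hzo'⟩ := hexec
  refine ⟨_, z', σ.aset a (i.eval E σ) (e.eval E σ) (e.cost + i.cost + 5), .seq hy (.seq hz hz'),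
    ⟨fun u => ?_, fun b j hj => ?_, ?_⟩,
    ⟨hb.1, fun b j => ?_⟩, ⟨by simp, fun b hb' => ?_, by simp⟩, ?_, h⟩
  · have := u.ctorIdx_lt
    rw [hzr' _ this, hzr _ (by omega), hsy.reg]; rfl
  · have hb' := b.ctorIdx_lt
    rw [hzm', hzm, hym, Store.aset_arr]
    by_cases hba : b = a
    · subst hba
      rw [if_pos rfl]
      by_cases hij : j = i.eval E σ
      · subst hij
        rw [mul_comm]; simp
      · rw [Function.update_of_ne (by omega), Function.update_of_ne hij, hx.mem b j hj]
    · have hne : b.ctorIdx ≠ a.ctorIdx := fun h => hba (Arr.ctorIdx_inj.1 h)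
      rw [Function.update_of_ne (by omega), if_neg hba, hx.mem b j hj]
  · rw [hzo', hzo, hyo, hx.out]; rfl
  · simp only [Store.aset_arr]
    split_ifs
    · rw [Function.update_apply]
      split_ifs
      · exact hv
      · exact hb.2 _ _
    · exact hb.2 _ _
  · simp [Cmd.setsArr] at hb'
    simp [hb']
  · simp; ring

theorem out {e : Expr} {σ : Store} {Q : Store → Prop} (hs : e.Safe E σ)
    (h : Q (σ.push (e.eval E σ) (e.cost + 1))) : Run E (.out e) σ Q := by
  intro ok hb x hx
  simp [Cmd.ok] at ok
  obtain ⟨y, hy, hyd, hyr, hym, hyo⟩ := e.exec hb 64 x le_rfl hx ok.1 ok.2 hs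
  refine ⟨e.cost + 1, { y with out := y.out ++ [y.reg 64] },
    σ.push (e.eval E σ) (e.cost + 1),
    .seq hy (.instr rfl), ⟨fun u => ?_, fun a i hi => ?_, ?_⟩, hb,
    ⟨by simp, by simp, by simp [Cmd.writes]⟩, by simp, h⟩
  · simp [hyr _ u.ctorIdx_lt, hx.reg]
  · simp [hym, hx.mem a i hi]
  · simp [hyo, hx.out, hyd]

theorem seq {c d : Cmd} {σ : Store} {Q : Store → Prop}
    (h : Run E c σ fun σ' => Run E d σ' Q) : Run E (.seq c d) σ Q := by
  intro ok hb x hx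
  simp [Cmd.ok] at ok
  obtain ⟨t, y, σ', h1, h2, h3, h4, h5, h6⟩ := h ok.1 hb x hx
  obtain ⟨t', y', σ'', h1', h2', h3', h4', h5', h6'⟩ := h6 ok.2 h3 y h2
  refine ⟨t + t', y', σ'', .seq h1 h1', h2', h3', (h4.mono ?_ ?_ ?_).trans (h4'.mono ?_ ?_ ?_),
    by rw [h5', h5, add_assoc], h6'⟩ <;> simp +contextual [Cmd.setsVar, Cmd.setsArr, Cmd.writes]

theorem block {c : Cmd} {σ : Store} {Q : Store → Prop}
    (h : Run E c σ Q) : Run E (.block c) σ Q := by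
  intro ok hb x hx
  obtain ⟨t, y, σ', h1, h2, h3, h4, h5, h6⟩ := h ok hb x hx
  exact ⟨t, y, σ', h1, h2, h3, ⟨h4.var, h4.arr, h4.out⟩, h5, h6⟩

theorem cond_exec {b : Cond} {σ : Store} (hok : b.ok = true) (hs : b.Safe E σ) (hb : σ.Bdd E)
    {x : State} (hx : Sim E σ x) : ∃ y, Exec E.w (32 * E.M) E.input b.code x b.cost y ∧
      Sim E σ y ∧ (b.test.Holds y ↔ b.Holds E σ) := by
  have key : ∀ e f : Expr, e.litsOK = true → e.size ≤ 20 → f.litsOK = true → f.size ≤ 20 →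
      e.Safe E σ → f.Safe E σ →
      ∃ y, Exec E.w (32 * E.M) E.input (.seq (e.code 64) (f.code 65)) x (e.cost + f.cost) y ∧
      Sim E σ y ∧ y.reg 64 = e.eval E σ ∧ y.reg 65 = f.eval E σ := by
    intro e f he1 he2 hf1 hf2 hse hsf
    obtain ⟨y, hy, hyd, hyr, hym, hyo⟩ := e.exec hb 64 x le_rfl hx he1 he2 hse
    have hsy : Sim E σ y := ⟨fun v => by rw [hyr _ v.ctorIdx_lt, hx.reg],
      fun a i hi => by rw [hym, hx.mem a i hi], by rw [hyo, hx.out]⟩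
    obtain ⟨z, hz, hzd, hzr, hzm, hzo⟩ := f.exec hb 65 y (by norm_num) hsy hf1 hf2 hsf
    exact ⟨z, .seq hy hz, ⟨fun v => by
        rw [hzr _ (v.ctorIdx_lt.trans (by norm_num)), hsy.reg],
      fun a i hi => by rw [hzm, hsy.mem a i hi], by rw [hzo, hsy.out]⟩,
      by rw [hzr 64 (by norm_num), hyd], hzd⟩
  cases b with
  | eq e f =>
    simp at hok hs
    obtain ⟨⟨⟨h1, h2⟩, h3⟩, h4⟩ := hok
    obtain ⟨y, hy, hsy, h64, h65⟩ := key e f h1 h3 h2 h4 hs.1 hs.2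
    exact ⟨y, hy, hsy, by simp [Cond.test, Test.Holds, h64, h65]⟩
  | lt e f =>
    simp at hok hs
    obtain ⟨⟨⟨h1, h2⟩, h3⟩, h4⟩ := hok
    obtain ⟨y, hy, hsy, h64, h65⟩ := key e f h1 h3 h2 h4 hs.1 hs.2
    exact ⟨y, hy, hsy, by simp [Cond.test, Test.Holds, h64, h65]⟩

theorem ite {b : Cond} {c d : Cmd} {σ : Store} {Q : Store → Prop} (hs : b.Safe E σ)
    (hc : b.Holds E σ → Run E c (σ.tick (b.cost + 1)) Q)
    (hd : ¬ b.Holds E σ → Run E d (σ.tick (b.cost + 1)) Q) : Run E (.ite b c d) σ Q := by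
  intro ok hb x hx
  simp [Cmd.ok] at ok
  obtain ⟨⟨ok1, ok2⟩, ok3⟩ := ok
  obtain ⟨y, hy, hsy, htest⟩ := cond_exec ok1 hs hb hx
  have hsy' : Sim E (σ.tick (b.cost + 1)) y := ⟨hsy.reg, hsy.mem, hsy.out⟩
  have hf : ∀ (c' : Cmd) σ', Cmd.Frame c' (σ.tick (b.cost + 1)) σ' → Cmd.Frame c' σ σ' :=
    fun c' σ' h => ⟨h.var, h.arr, h.out⟩
  by_cases hh : b.Holds E σ
  · obtain ⟨t, z, σ', h1, h2, h3, h4, h5, h6⟩ := hc hh ok2 hb y hsy'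
    refine ⟨_, z, σ', .seq hy (.ite_true (htest.2 hh) h1), h2, h3, (hf _ _ h4).mono ?_ ?_ ?_,
      by rw [h5]; simp; ring, h6⟩ <;>
      simp +contextual [Cmd.setsVar, Cmd.setsArr, Cmd.writes]
  · obtain ⟨t, z, σ', h1, h2, h3, h4, h5, h6⟩ := hd hh ok3 hb y hsy'
    refine ⟨_, z, σ', .seq hy (.ite_false (fun h => hh (htest.1 h)) h1), h2, h3,
      (hf _ _ h4).mono ?_ ?_ ?_, by rw [h5]; simp; ring, h6⟩ <;>
      simp +contextual [Cmd.setsVar, Cmd.setsArr, Cmd.writes]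

/-- The rule for loops: `I k σ` says that `σ` may be met at the head of the loop, and that at most
`k` more rounds are needed. -/
theorem loop {b : Cond} {c : Cmd} {σ : Store} {Q : Store → Prop} (I : ℕ → Store → Prop) (k : ℕ)
    (h0 : I k (σ.tick b.cost))
    (hs : ∀ k σ', I k σ' → b.Safe E σ')
    (hstep : ∀ k σ', Cmd.Frame c σ σ' → σ'.Bdd E → I k σ' → b.Holds E σ' →
      ∃ k', k = k' + 1 ∧ Run E c (σ'.tick 1) fun σ'' => I k' (σ''.tick b.cost) ∧ b.Safe E σ'')
    (hend : ∀ k σ', Cmd.Frame c σ σ' → σ'.Bdd E → I k σ' → ¬ b.Holds E σ' → Q (σ'.tick 1)) :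
    Run E (.loop b c) σ Q := by
  intro ok hb x hx
  simp [Cmd.ok] at ok
  have hloop : ∀ k σ' x', I k σ' → Cmd.Frame c σ σ' → σ'.Bdd E → Sim E σ' x' →
      (b.test.Holds x' ↔ b.Holds E σ') →
      ∃ t y σ'', Exec E.w (32 * E.M) E.input (.loop b.test (.seq c.code b.code)) x' t y ∧
        Sim E σ'' y ∧ σ''.Bdd E ∧ Cmd.Frame c σ σ'' ∧ σ''.time = σ'.time + t ∧ Q σ'' := by
    intro k
    induction k with
    | zero =>
      intro σ' x' hI hF hB hS ht
      by_cases hh : b.Holds E σ'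
      · obtain ⟨k', hk', -⟩ := hstep 0 σ' hF hB hI hh
        omega
      · exact ⟨1, x', σ'.tick 1, .loop_done fun h => hh (ht.1 h), ⟨hS.reg, hS.mem, hS.out⟩, hB,
          ⟨hF.var, hF.arr, hF.out⟩, rfl, hend _ _ hF hB hI hh⟩
    | succ k ih =>
      intro σ' x' hI hF hB hS ht
      by_cases hh : b.Holds E σ'
      · obtain ⟨k', hk', hr⟩ := hstep (k + 1) σ' hF hB hI hh
        obtain rfl : k = k' := by omega
        obtain ⟨t, y, σ₁, h1, h2, h3, h4, h5, h6, h7⟩ :=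
          hr ok.2 hB x' ⟨hS.reg, hS.mem, hS.out⟩
        obtain ⟨z, hz, hzS, hzt⟩ := cond_exec ok.1 h7 h3 h2
        have hF' : Cmd.Frame c σ (σ₁.tick b.cost) :=
          hF.trans ⟨h4.var, h4.arr, h4.out⟩
        obtain ⟨t', y', σ'', g1, g2, g3, g4, g5, g6⟩ :=
          ih (σ₁.tick b.cost) z h6 hF' h3 ⟨hzS.reg, hzS.mem, hzS.out⟩
            (hzt.trans (Cond.holds_tick ..).symm)
        refine ⟨_, y', σ'', .loop_next (ht.2 hh) (.seq h1 hz) g1, g2, g3, g4, ?_, g6⟩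
        rw [g5]; simp [h5]; ring
      · exact ⟨1, x', σ'.tick 1, .loop_done fun h => hh (ht.1 h), ⟨hS.reg, hS.mem, hS.out⟩, hB,
          ⟨hF.var, hF.arr, hF.out⟩, rfl, hend _ _ hF hB hI hh⟩
  have hsafe : b.Safe E σ := (Cond.safe_tick ..).1 (hs _ _ h0)
  obtain ⟨y, hy, hsy, htest⟩ := cond_exec ok.1 hsafe hb hx
  obtain ⟨t, z, σ', h1, h2, h3, h4, h5, h6⟩ := hloop k (σ.tick b.cost) y h0
    ⟨by simp, by simp, by simp⟩ hb ⟨hsy.reg, hsy.mem, hsy.out⟩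
    (htest.trans (Cond.holds_tick ..).symm)
  exact ⟨_, z, σ', .seq hy h1, h2, h3, ⟨h4.var, h4.arr, h4.out⟩, by rw [h5]; simp; ring, h6⟩

end Run

/-- Symbolic execution; loops and blocks are left to their own specifications. -/
@[simp] def Cmd.wp (E : Env) : Cmd → (Store → Prop) → Store → Prop
  | .skip, Q, σ => Q (σ.tick 1)
  | .assign v e, Q, σ => e.Safe E σ ∧ e.eval E σ < E.U ∧ Q (σ.set v (e.eval E σ) (e.cost + 1))
  | .aset a i e, Q, σ => e.Safe E σ ∧ i.Safe E σ ∧ i.eval E σ < E.M ∧ e.eval E σ < E.U ∧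
      Q (σ.aset a (i.eval E σ) (e.eval E σ) (e.cost + i.cost + 5))
  | .out e, Q, σ => e.Safe E σ ∧ Q (σ.push (e.eval E σ) (e.cost + 1))
  | .seq c d, Q, σ => c.wp E (d.wp E Q) σ
  | .ite b c d, Q, σ => b.Safe E σ ∧ (b.Holds E σ → c.wp E Q (σ.tick (b.cost + 1))) ∧
      (¬ b.Holds E σ → d.wp E Q (σ.tick (b.cost + 1)))
  | .loop b c, Q, σ => Run E (.loop b c) σ Q
  | .block c, Q, σ => Run E (.block c) σ Q

theorem Run.of_wp {c : Cmd} : ∀ {σ : Store} {Q : Store → Prop}, c.wp E Q σ → Run E c σ Q := by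
  induction c with
  | skip => exact fun h => Run.skip h
  | assign v e => exact fun h => Run.assign h.1 h.2.1 h.2.2
  | aset a i e => exact fun h => Run.aset h.1 h.2.1 h.2.2.1 h.2.2.2.1 h.2.2.2.2
  | out e => exact fun h => Run.out h.1 h.2
  | seq c d ihc ihd => exact fun h => Run.seq ((ihc h).conseq fun _ _ _ h' => ihd h')
  | ite b c d ihc ihd =>
    exact fun h => Run.ite h.1 (fun hb => ihc (h.2.1 hb)) fun hb => ihd (h.2.2 hb)
  | loop b c => exact fun h => h
  | block c => exact fun h => h

/-- Symbolic execution may use that the store is bounded. -/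
theorem Run.intro {c : Cmd} {σ : Store} {Q : Store → Prop} (h : σ.Bdd E → c.wp E Q σ) :
    Run E c σ Q := fun ok hb => Run.of_wp (h hb) ok hb

/-- `for v < hi do c` -/
def Cmd.count (v hi : Var) (c : Cmd) : Cmd :=
  .block (.assign v (.lit 0) ;;
    .loop (.lt (.var v) (.var hi)) (.block c ;; .assign v (.add (.var v) (.lit 1))))

@[simp] theorem Cmd.wp_count (v hi : Var) (c : Cmd) (Q : Store → Prop) (σ : Store) :
    (Cmd.count v hi c).wp E Q σ = Run E (Cmd.count v hi c) σ Q := rfl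

/-- The rule for counting loops. The invariant is not allowed to speak about the counter, the round
number `i` takes its place; round `i` takes `T i` steps. -/
theorem Run.count {v hi : Var} {c : Cmd} {σ : Store} {H : ℕ} (I : ℕ → Store → Prop) (T : ℕ → ℕ)
    (hH : σ.var hi = H) (hvh : v ≠ hi) (hv : c.setsVar v = false) (hhi : c.setsVar hi = false)
    (hI : ∀ i σ' a k, I i σ' → I i (σ'.set v a k))
    (hIt : ∀ i σ' k, I i σ' → I i (σ'.tick k))
    (h0 : I 0 σ)
    (hstep : ∀ i < H, ∀ σ', Cmd.Frame (Cmd.count v hi c) σ σ' → σ'.var v = i → σ'.var hi = H →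
      I i σ' → Run E c σ' fun σ'' => I (i + 1) σ'' ∧ σ''.time ≤ σ'.time + T i) :
    Run E (Cmd.count v hi c) σ fun σ' => I H σ' ∧
      σ'.time ≤ σ.time + ((∑ i ∈ Finset.range H, T i) + 7 * H + 5) := by
  refine Run.block (Run.intro fun hb => ?_)
  simp only [Cmd.wp, Expr.eval, Expr.Safe, Expr.cost]
  refine ⟨trivial, lt_trans zero_lt_one E.one_lt, ?_⟩
  have hfor : ∀ (c' : Cmd) (σ₁ σ₂ : Store), Cmd.Frame (.seq (.block c)
      (.assign v (.add (.var v) (.lit 1)))) σ₁ σ₂ → Cmd.Frame (Cmd.count v hi c) σ₁ σ₂ := by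
    intro c' σ₁ σ₂ h
    refine h.mono ?_ ?_ ?_ <;> simp [Cmd.count, Cmd.setsVar, Cmd.setsArr, Cmd.writes]
  refine Run.loop (fun k σ' => k ≤ H ∧ σ'.var v = H - k ∧ σ'.var hi = H ∧ I (H - k) σ' ∧
      σ'.time ≤ σ.time + ((∑ i ∈ Finset.range (H - k), T i) + 7 * (H - k) + 4)) H ?_ ?_ ?_ ?_
  · simp [hH, hvh.symm]
    exact hIt _ _ _ (hI _ _ _ _ h0)
  · simp
  · rintro k σ' hF hB ⟨hk, h1, h2, h3, h4⟩ hh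
    simp only [Cond.Holds, Expr.eval, h1, h2] at hh
    refine ⟨k - 1, by omega, Run.seq (Run.block ?_)⟩
    have hF' : Cmd.Frame (Cmd.count v hi c) σ σ' := by
      have := hfor c _ _ hF
      refine ⟨fun u hu => (this.var u hu).trans ?_, this.arr, this.out⟩
      have : u ≠ v := by
        rintro rfl; simp [Cmd.count, Cmd.setsVar] at hu
      simp [this]
    have hr := hstep (H - k) (by omega) (σ'.tick 1) ⟨hF'.var, hF'.arr, hF'.out⟩ h1 h2
      (hIt _ _ _ h3)
    refine hr.conseq fun σ'' hB' hF'' ⟨g1, g2⟩ => Run.of_wp ?_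
    have e1 : σ''.var v = H - k := by rw [hF''.var v hv]; exact h1
    have e2 : σ''.var hi = H := by rw [hF''.var hi hhi]; exact h2
    have e3 : H - k + 1 = H - (k - 1) := by omega
    have e4 : H < E.U := by have := hB.1 hi; rwa [h2] at this
    simp only [Cmd.wp, Expr.Safe, Expr.eval, e1]
    refine ⟨⟨trivial, trivial⟩, by omega, ⟨by omega, ?_, ?_, ?_, ?_⟩, by simp⟩
    · simp [e3]
    · simp [hvh.symm, e2]
    · rw [← e3]; exact hIt _ _ _ (hI _ _ _ _ g1)
    · rw [← e3, Finset.sum_range_succ]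
      simp at g2 ⊢
      omega
  · rintro k σ' hF hB ⟨hk, h1, h2, h3, h4⟩ hh
    simp only [Cond.Holds, Expr.eval, h1, h2] at hh
    have : k = 0 := by omega
    subst this
    simp at h3 h4 ⊢
    exact ⟨hIt _ _ _ h3, by omega⟩

/-- The rule for counting loops in which every round takes at most `T` steps. -/
theorem Run.countConst {v hi : Var} {c : Cmd} {σ : Store} {H : ℕ} (I : ℕ → Store → Prop) (T : ℕ)
    (hH : σ.var hi = H) (hvh : v ≠ hi) (hv : c.setsVar v = false) (hhi : c.setsVar hi = false)
    (hI : ∀ i σ' a k, I i σ' → I i (σ'.set v a k))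
    (hIt : ∀ i σ' k, I i σ' → I i (σ'.tick k))
    (h0 : I 0 σ)
    (hstep : ∀ i < H, ∀ σ', Cmd.Frame (Cmd.count v hi c) σ σ' → σ'.var v = i → σ'.var hi = H →
      I i σ' → Run E c σ' fun σ'' => I (i + 1) σ'' ∧ σ''.time ≤ σ'.time + T) :
    Run E (Cmd.count v hi c) σ fun σ' => I H σ' ∧ σ'.time ≤ σ.time + (H * (T + 7) + 5) := by
  refine (Run.count I (fun _ => T) hH hvh hv hhi hI hIt h0 hstep).conseq fun σ' _ _ h => ⟨h.1, ?_⟩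
  have := h.2
  simp at this
  rw [mul_add]; omega

end WordRAM

/-! ### Relaxing edges in a fixed order -/

namespace RegexMatch

/-- `Path E i j`: a subsequence of the list `E` of edges forms a path from `i` to `j`. These are the
pairs that one sweep over `E` in list order connects. -/
def Path : List (ℕ × ℕ) → ℕ → ℕ → Prop
  | [], i, j => i = j
  | e :: E, i, j => Path E i j ∨ (i = e.1 ∧ Path E e.2 j)

theorem Path.refl : ∀ (E : List (ℕ × ℕ)) (i : ℕ), Path E i i
  | [], _ => rfl
  | _ :: E, i => .inl (Path.refl E i)

theorem path_append {E F : List (ℕ × ℕ)} {i j : ℕ} :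
    Path (E ++ F) i j ↔ ∃ k, Path E i k ∧ Path F k j := by
  induction E generalizing i with
  | nil => simp [Path]
  | cons e E ih =>
    simp only [List.cons_append, Path, ih]
    grind

theorem Path.append {E F : List (ℕ × ℕ)} {i j k : ℕ} (h : Path E i k) (h' : Path F k j) :
    Path (E ++ F) i j := path_append.2 ⟨k, h, h'⟩

theorem Path.edge (i j : ℕ) : Path [(i, j)] i j := .inr ⟨rfl, rfl⟩

theorem Path.sublist {E F : List (ℕ × ℕ)} {i j : ℕ} (hp : Path E i j) (h : List.Sublist E F) :
    Path F i j := by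
  induction h generalizing i with
  | slnil => exact hp
  | cons e _ ih => exact .inl (ih hp)
  | cons_cons e _ ih =>
    rcases hp with hp | ⟨rfl, hp⟩
    · exact .inl (ih hp)
    · exact .inr ⟨rfl, ih hp⟩

theorem path_swap {E : List (ℕ × ℕ)} {i j : ℕ} :
    Path (E.map Prod.swap).reverse j i ↔ Path E i j := by
  induction E generalizing i j with
  | nil => simp [Path, eq_comm]
  | cons e E ih =>
    simp only [List.map_cons, List.reverse_cons, path_append, ih, Path, Prod.fst_swap,
      Prod.snd_swap]
    grind

theorem Path.lt {E : List (ℕ × ℕ)} {N i j : ℕ} (hE : ∀ e ∈ E, e.2 < N) (hi : i < N)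
    (h : Path E i j) : j < N := by
  induction E generalizing i with
  | nil => cases h; exact hi
  | cons e E ih =>
    rcases h with h | ⟨rfl, h⟩
    · exact ih (fun e he => hE e (by simp [he])) hi h
    · exact ih (fun e he => hE e (by simp [he])) (hE e (by simp)) h

/-- A labelling of the nodes by languages that shrinks along every edge shrinks along paths. -/
theorem Path.le {β : Type*} [Preorder β] {C : ℕ → β} {E : List (ℕ × ℕ)}
    (hE : ∀ e ∈ E, C e.2 ≤ C e.1) {i j : ℕ} (h : Path E i j) : C j ≤ C i := by
  induction E generalizing i with
  | nil => cases h; exact le_rfl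
  | cons e E ih =>
    rcases h with h | ⟨rfl, h⟩
    · exact ih (fun e he => hE e (by simp [he])) h
    · exact (ih (fun e he => hE e (by simp [he])) h).trans (hE e (by simp))

/-! ### The position automaton of a regular expression -/

open RegularExpression

variable {σ : ℕ}

/-- The `ε`-edges that lead upwards, children before parents. The subexpression that is written from
position `p` on has two slots: `2 * p + 1` stands for its beginning and `2 * p` for its end. -/
def finE : RegularExpression (Fin σ) → ℕ → List (ℕ × ℕ)
  | .zero, _ | .epsilon, _ | .char _, _ => []
  | .comp S T, p => finE T (p + S.written.length + 4) ++ (finE S (p + 1) ++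
      ((2 * (p + S.written.length + 4), 2 * p) ::
        if T.matchEpsilon then [(2 * (p + 1), 2 * p)] else []))
  | .plus S T, p => finE T (p + S.written.length + 4) ++ (finE S (p + 1) ++
      [(2 * (p + 1), 2 * p), (2 * (p + S.written.length + 4), 2 * p)])
  | .star S, p => finE S (p + 1) ++ [(2 * (p + 1), 2 * p)]

/-- The `ε`-edges that lead to beginnings, parents before children. -/
def inE : RegularExpression (Fin σ) → ℕ → List (ℕ × ℕ)
  | .zero, _ | .epsilon, _ | .char _, _ => []
  | .comp S T, p => ((2 * p + 1, 2 * (p + 1) + 1) ::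
      (2 * (p + 1), 2 * (p + S.written.length + 4) + 1) ::
      if S.matchEpsilon then [(2 * p + 1, 2 * (p + S.written.length + 4) + 1)] else []) ++
      (inE S (p + 1) ++ inE T (p + S.written.length + 4))
  | .plus S T, p => [(2 * p + 1, 2 * (p + 1) + 1),
      (2 * p + 1, 2 * (p + S.written.length + 4) + 1)] ++
      (inE S (p + 1) ++ inE T (p + S.written.length + 4))
  | .star S, p => [(2 * p + 1, 2 * (p + 1) + 1), (2 * (p + 1), 2 * (p + 1) + 1)] ++ inE S (p + 1)

/-- The positions of the characters. -/
def letters : RegularExpression (Fin σ) → ℕ → List (ℕ × Fin σ)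
  | .zero, _ | .epsilon, _ => []
  | .char a, p => [(p, a)]
  | .comp S T, p | .plus S T, p => letters S (p + 1) ++ letters T (p + S.written.length + 4)
  | .star S, p => letters S (p + 1)

section length
variable (S T : RegularExpression (Fin σ))

@[simp] theorem length_zero : (0 : RegularExpression (Fin σ)).written.length = 1 := rfl

@[simp] theorem length_epsilon : (1 : RegularExpression (Fin σ)).written.length = 1 := rfl

@[simp] theorem length_char (a : Fin σ) : (RegularExpression.char a).written.length = 1 := rfl

@[simp] theorem length_comp :
    (S * T).written.length = S.written.length + T.written.length + 5 := by
  rw [← comp_def]; simp only [written, List.length_append, List.length_cons, List.length_nil]; ring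

@[simp] theorem length_plus :
    (S + T).written.length = S.written.length + T.written.length + 5 := by
  rw [← plus_def]; simp only [written, List.length_append, List.length_cons, List.length_nil]; ring

@[simp] theorem length_star :
    (RegularExpression.star S).written.length = S.written.length + 3 := by
  simp only [written, List.length_append, List.length_cons, List.length_nil]; ring

end length

theorem length_pos (R : RegularExpression (Fin σ)) : 0 < R.written.length := by
  cases R <;> simp

theorem matchEpsilon_iff (R : RegularExpression (Fin σ)) :
    R.matchEpsilon = true ↔ [] ∈ R.matches' := by
  rw [← rmatch_iff_matches', rmatch]

theorem finE_range (R : RegularExpression (Fin σ)) (p : ℕ) : ∀ e ∈ finE R p,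
    2 * p ≤ e.1 ∧ e.1 < 2 * (p + R.written.length) ∧
    2 * p ≤ e.2 ∧ e.2 < 2 * (p + R.written.length) ∧ e.1 % 2 = 0 := by
  induction R generalizing p with
  | zero | epsilon | char => simp [finE]
  | comp S T ihS ihT =>
    have := length_pos T
    intro e he
    simp only [finE, List.mem_append, List.mem_cons] at he
    rcases he with he | he | rfl | he
    · have := ihT _ e he; simp; omega
    · have := ihS _ e he; simp; omega
    · simp; omega
    · split_ifs at he <;> simp at he
      subst he; simp
  | plus S T ihS ihT =>
    have := length_pos T
    intro e he
    simp only [finE, List.mem_append, List.mem_cons] at he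
    rcases he with he | he | rfl | rfl | he
    · have := ihT _ e he; simp; omega
    · have := ihS _ e he; simp; omega
    · simp
    · simp; omega
    · simp at he
  | star S ihS =>
    intro e he
    simp only [finE, List.mem_append, List.mem_cons] at he
    rcases he with he | rfl | he
    · have := ihS _ e he; simp; omega
    · simp
    · simp at he

theorem inE_range (R : RegularExpression (Fin σ)) (p : ℕ) : ∀ e ∈ inE R p,
    2 * p ≤ e.1 ∧ e.1 < 2 * (p + R.written.length) ∧
    2 * p ≤ e.2 ∧ e.2 < 2 * (p + R.written.length) ∧ e.2 % 2 = 1 := by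
  induction R generalizing p with
  | zero | epsilon | char => simp [inE]
  | comp S T ihS ihT =>
    have := length_pos T
    intro e he
    simp only [inE, List.mem_append, List.mem_cons, List.cons_append] at he
    rcases he with rfl | rfl | he | he | he
    · simp; omega
    · simp; omega
    · split_ifs at he <;> simp at he
      subst he; simp; omega
    · have := ihS _ e he; simp; omega
    · have := ihT _ e he; simp; omega
  | plus S T ihS ihT =>
    have := length_pos T
    intro e he
    simp only [inE, List.mem_append, List.mem_cons, List.cons_append, List.nil_append] at he
    rcases he with rfl | rfl | he | he
    · simp; omega
    · simp; omega
    · have := ihS _ e he; simp; omega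
    · have := ihT _ e he; simp; omega
  | star S ihS =>
    intro e he
    simp only [inE, List.mem_cons, List.cons_append, List.nil_append] at he
    rcases he with rfl | rfl | he
    · simp; omega
    · simp; omega
    · have := ihS _ e he; simp; omega

theorem letters_range (R : RegularExpression (Fin σ)) (p : ℕ) : ∀ x ∈ letters R p,
    p ≤ x.1 ∧ x.1 < p + R.written.length := by
  induction R generalizing p with
  | zero | epsilon => simp [letters]
  | char => simp [letters]
  | comp S T ihS ihT | plus S T ihS ihT =>
    intro x hx
    simp only [letters, List.mem_append] at hx
    rcases hx with hx | hx
    · have := ihS _ x hx; simp; omega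
    · have := ihT _ x hx; simp; omega
  | star S ihS =>
    intro x hx
    have := ihS _ x hx; simp; omega

/-- All `ε`-edges, in the order in which they are relaxed. -/
def edges (R : RegularExpression (Fin σ)) : List (ℕ × ℕ) := finE R 0 ++ inE R 0

/-- The transitions that read the character `a`; slot `1` has a loop, which restarts the automaton
at every position of the text. -/
def Lett (R : RegularExpression (Fin σ)) (a : Fin σ) (i j : ℕ) : Prop :=
  (∃ x, (x, a) ∈ letters R 0 ∧ i = 2 * x + 1 ∧ j = 2 * x) ∨ (i = 1 ∧ j = 1)

/-- `ε`-closure followed by reading one character. -/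
def Step (R : RegularExpression (Fin σ)) (a : Fin σ) (i j : ℕ) : Prop :=
  ∃ k, Path (edges R) i k ∧ Lett R a k j

/-- The transition relation of a word. -/
def Rel (R : RegularExpression (Fin σ)) : List (Fin σ) → ℕ → ℕ → Prop
  | [], i, j => i = j
  | a :: u, i, j => ∃ k, Step R a i k ∧ Rel R u k j

/-- The slots from which a word leads to acceptance. -/
def Acc (R : RegularExpression (Fin σ)) (u : List (Fin σ)) : Set ℕ :=
  {i | ∃ j, Rel R u i j ∧ Path (edges R) j 0}

theorem rel_append {R : RegularExpression (Fin σ)} {u v : List (Fin σ)} {i j : ℕ} :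
    Rel R (u ++ v) i j ↔ ∃ k, Rel R u i k ∧ Rel R v k j := by
  induction u generalizing i with
  | nil => simp [Rel]
  | cons a u ih => simp only [List.cons_append, Rel, ih]; grind

theorem mem_acc_append {R : RegularExpression (Fin σ)} {u v : List (Fin σ)} {i : ℕ} :
    i ∈ Acc R (u ++ v) ↔ ∃ k, Rel R u i k ∧ k ∈ Acc R v := by
  simp only [Acc, Set.mem_ofPred_eq, rel_append]; grind

theorem mem_acc_cons {R : RegularExpression (Fin σ)} {a : Fin σ} {v : List (Fin σ)} {i : ℕ} :
    i ∈ Acc R (a :: v) ↔ ∃ k, Step R a i k ∧ k ∈ Acc R v := by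
  simp only [Acc, Set.mem_ofPred_eq, Rel]; grind

theorem edges_range (R : RegularExpression (Fin σ)) : ∀ e ∈ edges R,
    e.1 < 2 * R.written.length ∧ e.2 < 2 * R.written.length := by
  intro e he
  rcases List.mem_append.1 he with he | he
  · have := finE_range R 0 e he; simp at this; omega
  · have := inE_range R 0 e he; simp at this; omega

theorem lett_lt {R : RegularExpression (Fin σ)} {a : Fin σ} {i j : ℕ} (h : Lett R a i j) :
    i < 2 * R.written.length ∧ j < 2 * R.written.length := by
  have := length_pos R
  rcases h with ⟨x, hx, rfl, rfl⟩ | ⟨rfl, rfl⟩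
  · have := letters_range R 0 _ hx; simp at this; omega
  · omega

theorem rel_lt {R : RegularExpression (Fin σ)} {u : List (Fin σ)} {i j : ℕ}
    (hi : i < 2 * R.written.length) (h : Rel R u i j) : j < 2 * R.written.length := by
  induction u generalizing i with
  | nil => cases h; exact hi
  | cons a u ih =>
    obtain ⟨k, ⟨_, _, hk⟩, h⟩ := h
    exact ih (lett_lt hk).2 h

theorem path_lt_left {R : RegularExpression (Fin σ)} {i j : ℕ} (hj : j < 2 * R.written.length)
    (h : Path (edges R) i j) : i < 2 * R.written.length := by
  refine Path.lt ?_ hj (path_swap.2 h)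
  intro e he
  simp only [List.mem_reverse, List.mem_map] at he
  obtain ⟨f, hf, rfl⟩ := he
  exact (edges_range R f hf).1

/-- No `ε`-path leads from the beginning to the end: the nullable subexpressions are short-cut
instead. Hence the empty word, which is no match, is not accepted. -/
theorem not_path_one_zero (R : RegularExpression (Fin σ)) : ¬ Path (edges R) 1 0 := by
  intro h
  obtain ⟨k, h1, h2⟩ := path_append.1 h
  have h3 : ∀ E : List (ℕ × ℕ), (∀ e ∈ E, e.1 % 2 = 0) → ∀ k, Path E 1 k → k = 1 := by
    intro E
    induction E with
    | nil => exact fun _ k hk => hk.symm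
    | cons e E ih =>
      rintro hE k (hk | ⟨h1, -⟩)
      · exact ih (fun e he => hE e (by simp [he])) k hk
      · have := hE e (by simp); omega
  obtain rfl := h3 _ (fun e he => (finE_range R 0 e he).2.2.2.2) k h1
  have h4 : ∀ E : List (ℕ × ℕ), (∀ e ∈ E, e.2 % 2 = 1) → ∀ k, k % 2 = 1 → ¬ Path E k 0 := by
    intro E
    induction E with
    | nil => rintro _ k hk rfl; omega
    | cons e E ih =>
      rintro hE k hk (h | ⟨-, h⟩)
      · exact ih (fun e he => hE e (by simp [he])) k hk h
      · exact ih (fun e he => hE e (by simp [he])) _ (hE e (by simp)) h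
  exact h4 _ (fun e he => (inE_range R 0 e he).2.2.2.2) 1 (by norm_num) h2

/-! ### Soundness and completeness of the position automaton -/

/-- Slots can be labelled by continuation languages: the words that lead from the slot out of the
expression and on through a given language `K`. Every transition respects these labels. -/
theorem exists_continuation (R : RegularExpression (Fin σ)) (p : ℕ) (K : Language (Fin σ)) :
    ∃ C : ℕ → Language (Fin σ), C (2 * p) = K ∧ C (2 * p + 1) = R.matches' * K ∧
      (∀ e ∈ finE R p, C e.2 ≤ C e.1) ∧ (∀ e ∈ inE R p, C e.2 ≤ C e.1) ∧
      ∀ x ∈ letters R p, ∀ w ∈ C (2 * x.1), x.2 :: w ∈ C (2 * x.1 + 1) := by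
  have leaf : ∀ (p : ℕ) (K L : Language (Fin σ)), ∃ C : ℕ → Language (Fin σ), C (2 * p) = K ∧
      C (2 * p + 1) = L * K := fun p K L =>
    ⟨fun s => if s = 2 * p then K else L * K, by simp, by simp⟩
  -- Gluing of the labels of the two operands, which occupy disjoint ranges of slots.
  have glue : ∀ (p : ℕ) (K : Language (Fin σ)) (S T : RegularExpression (Fin σ))
      (L : Language (Fin σ)) (q : ℕ) (C₁ C₂ : ℕ → Language (Fin σ)), p + 1 + S.written.length ≤ q →
      ∃ C : ℕ → Language (Fin σ), C (2 * p) = K ∧ C (2 * p + 1) = L ∧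
        C (2 * (p + 1)) = C₁ (2 * (p + 1)) ∧ C (2 * (p + 1) + 1) = C₁ (2 * (p + 1) + 1) ∧
        C (2 * q) = C₂ (2 * q) ∧ C (2 * q + 1) = C₂ (2 * q + 1) ∧
        ((∀ e ∈ finE S (p + 1), C₁ e.2 ≤ C₁ e.1) → ∀ e ∈ finE S (p + 1), C e.2 ≤ C e.1) ∧
        ((∀ e ∈ inE S (p + 1), C₁ e.2 ≤ C₁ e.1) → ∀ e ∈ inE S (p + 1), C e.2 ≤ C e.1) ∧
        ((∀ x ∈ letters S (p + 1), ∀ w ∈ C₁ (2 * x.1), x.2 :: w ∈ C₁ (2 * x.1 + 1)) →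
          ∀ x ∈ letters S (p + 1), ∀ w ∈ C (2 * x.1), x.2 :: w ∈ C (2 * x.1 + 1)) ∧
        ((∀ e ∈ finE T q, C₂ e.2 ≤ C₂ e.1) → ∀ e ∈ finE T q, C e.2 ≤ C e.1) ∧
        ((∀ e ∈ inE T q, C₂ e.2 ≤ C₂ e.1) → ∀ e ∈ inE T q, C e.2 ≤ C e.1) ∧
        ((∀ x ∈ letters T q, ∀ w ∈ C₂ (2 * x.1), x.2 :: w ∈ C₂ (2 * x.1 + 1)) →
          ∀ x ∈ letters T q, ∀ w ∈ C (2 * x.1), x.2 :: w ∈ C (2 * x.1 + 1)) := by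
    intro p K S T L q C₁ C₂ hq
    have hS := length_pos S
    obtain ⟨C, hC⟩ : ∃ C : ℕ → Language (Fin σ), ∀ s, C s =
      if s = 2 * p then K else if s = 2 * p + 1 then L else if s < 2 * q then C₁ s else C₂ s :=
      ⟨_, fun _ => rfl⟩
    have c1 : ∀ s, 2 * (p + 1) ≤ s → s < 2 * (p + 1 + S.written.length) → C s = C₁ s := by
      intro s h1 h2
      rw [hC, if_neg (by omega), if_neg (by omega), if_pos (by omega)]
    have c2 : ∀ s, 2 * q ≤ s → C s = C₂ s := by
      intro s h1
      rw [hC, if_neg (by omega), if_neg (by omega), if_neg (by omega)]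
    refine ⟨C, by simp [hC], by simp [hC], c1 _ (by omega) (by omega), c1 _ (by omega) (by omega),
      c2 _ (by omega), c2 _ (by omega), fun h e he => ?_, fun h e he => ?_, fun h x hx => ?_,
      fun h e he => ?_, fun h e he => ?_, fun h x hx => ?_⟩
    · obtain ⟨h1, h2, h3, h4, -⟩ := finE_range _ _ e he
      rw [c1 _ h1 h2, c1 _ h3 h4]; exact h e he
    · obtain ⟨h1, h2, h3, h4, -⟩ := inE_range _ _ e he
      rw [c1 _ h1 h2, c1 _ h3 h4]; exact h e he
    · obtain ⟨h1, h2⟩ := letters_range _ _ x hx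
      rw [c1 _ (by omega) (by omega), c1 _ (by omega) (by omega)]; exact h x hx
    · obtain ⟨h1, h2, h3, h4, -⟩ := finE_range _ _ e he
      rw [c2 _ h1, c2 _ h3]; exact h e he
    · obtain ⟨h1, h2, h3, h4, -⟩ := inE_range _ _ e he
      rw [c2 _ h1, c2 _ h3]; exact h e he
    · obtain ⟨h1, h2⟩ := letters_range _ _ x hx
      rw [c2 _ (by omega), c2 _ (by omega)]; exact h x hx
  have nul_le : ∀ (S : RegularExpression (Fin σ)) (L : Language (Fin σ)), S.matchEpsilon = true →
      L ≤ S.matches' * L := fun S L hS w hw =>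
    Language.mem_mul.2 ⟨[], (matchEpsilon_iff S).1 hS, w, hw, by simp⟩
  induction R generalizing p K with
  | zero =>
    obtain ⟨C, h1, h2⟩ := leaf p K 0
    exact ⟨C, h1, h2, by simp [finE], by simp [inE], by simp [letters]⟩
  | epsilon =>
    obtain ⟨C, h1, h2⟩ := leaf p K 1
    exact ⟨C, h1, h2, by simp [finE], by simp [inE], by simp [letters]⟩
  | char a =>
    obtain ⟨C, h1, h2⟩ := leaf p K {[a]}
    refine ⟨C, h1, h2, by simp [finE], by simp [inE], ?_⟩
    simp only [letters, List.mem_singleton, forall_eq, h1, h2]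
    exact fun w hw => Language.mem_mul.2 ⟨[a], rfl, w, hw, rfl⟩
  | comp S T ihS ihT =>
    obtain ⟨C₁, a1, a2, a3, a4, a5⟩ := ihS (p + 1) (T.matches' * K)
    obtain ⟨C₂, b1, b2, b3, b4, b5⟩ := ihT (p + S.written.length + 4) K
    obtain ⟨C, c1, c2, c3, c4, c5, c6, d1, d2, d3, d4, d5, d6⟩ :=
      glue p K S T (S.matches' * (T.matches' * K)) (p + S.written.length + 4) C₁ C₂ (by omega)
    refine ⟨C, c1, by rw [c2]; exact (mul_assoc _ _ _).symm, fun e he => ?_, fun e he => ?_,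
      fun x hx => ?_⟩
    · simp only [finE, List.mem_append, List.mem_cons] at he
      rcases he with he | he | rfl | he
      · exact d4 b3 e he
      · exact d1 a3 e he
      · exact (c1.trans (b1.symm.trans c5.symm)).le
      · split_ifs at he with hT <;> simp at he
        subst he
        simp only
        rw [c1, c3, a1]
        exact nul_le _ _ hT
    · simp only [inE, List.mem_append, List.mem_cons, List.cons_append] at he
      rcases he with rfl | rfl | he | he | he
      · simp only
        rw [c2, c4, a2]
      · simp only
        rw [c6, c3, a1, b2]
      · split_ifs at he with hS <;> simp at he
        subst he
        simp only
        rw [c6, c2, b2]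
        exact nul_le _ _ hS
      · exact d2 a4 e he
      · exact d5 b4 e he
    · rcases List.mem_append.1 hx with hx | hx
      · exact d3 a5 x hx
      · exact d6 b5 x hx
  | plus S T ihS ihT =>
    obtain ⟨C₁, a1, a2, a3, a4, a5⟩ := ihS (p + 1) K
    obtain ⟨C₂, b1, b2, b3, b4, b5⟩ := ihT (p + S.written.length + 4) K
    obtain ⟨C, c1, c2, c3, c4, c5, c6, d1, d2, d3, d4, d5, d6⟩ :=
      glue p K S T ((S.matches' + T.matches') * K) (p + S.written.length + 4) C₁ C₂ (by omega)
    have hST : (S.matches' + T.matches') * K = S.matches' * K + T.matches' * K := add_mul _ _ _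
    refine ⟨C, c1, c2, fun e he => ?_, fun e he => ?_, fun x hx => ?_⟩
    · simp only [finE, List.mem_append, List.mem_cons] at he
      rcases he with he | he | rfl | rfl | he
      · exact d4 b3 e he
      · exact d1 a3 e he
      · exact (c1.trans (a1.symm.trans c3.symm)).le
      · exact (c1.trans (b1.symm.trans c5.symm)).le
      · simp at he
    · simp only [inE, List.mem_append, List.mem_cons, List.cons_append, List.nil_append] at he
      rcases he with rfl | rfl | he | he
      · simp only
        rw [c2, c4, a2, hST]
        exact fun w hw => Or.inl hw
      · simp only
        rw [c2, c6, b2, hST]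
        exact fun w hw => Or.inr hw
      · exact d2 a4 e he
      · exact d5 b4 e he
    · rcases List.mem_append.1 hx with hx | hx
      · exact d3 a5 x hx
      · exact d6 b5 x hx
  | star S ihS =>
    obtain ⟨C₁, a1, a2, a3, a4, a5⟩ := ihS (p + 1) (KStar.kstar S.matches' * K)
    obtain ⟨C, c1, c2, c3, c4, -, -, d1, d2, d3, -⟩ :=
      glue p K S 0 (KStar.kstar S.matches' * K) (p + S.written.length + 4) C₁ C₁ (by omega)
    have h1 : K ≤ KStar.kstar S.matches' * K := fun w hw =>
      Language.mem_mul.2 ⟨[], Language.nil_mem_kstar _, w, hw, by simp⟩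
    have h2 : S.matches' * (KStar.kstar S.matches' * K) ≤ KStar.kstar S.matches' * K := by
      rw [← mul_assoc]
      exact mul_le_mul_left mul_kstar_le_kstar _
    refine ⟨C, c1, c2, fun e he => ?_, fun e he => ?_, d3 a5⟩
    · simp only [finE, List.mem_append, List.mem_cons] at he
      rcases he with he | rfl | he
      · exact d1 a3 e he
      · simp only
        rw [c1, c3, a1]
        exact h1
      · simp at he
    · simp only [inE, List.mem_cons, List.cons_append, List.nil_append] at he
      rcases he with rfl | rfl | he
      · simp only
        rw [c2, c4, a2]
        exact h2
      · simp only
        rw [c3, c4, a1, a2]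
        exact h2
      · exact d2 a4 e he

/-- Soundness of acceptance from the restart slot. With `K = {ε}` the label of slot `0` contains
only the empty word and that of slot `1` is the language of `R`. So the word is in the language if
the run does not use the loop at slot `1`; otherwise the suffix that is left after the last use of
the loop is. -/
theorem exists_suffix_of_acc {R : RegularExpression (Fin σ)} {u : List (Fin σ)}
    (h : 1 ∈ Acc R u) : ∃ v, v ≠ [] ∧ v <:+ u ∧ v ∈ R.matches' := by
  obtain ⟨C, h0, h1, hf, hi, hl⟩ := exists_continuation R 0 1
  have hE : ∀ e ∈ edges R, C e.2 ≤ C e.1 := by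
    intro e he
    rcases List.mem_append.1 he with he | he
    · exact hf e he
    · exact hi e he
  have hne : (1 : ℕ) ∉ Acc R [] := by
    rintro ⟨j, rfl, hj⟩
    exact not_path_one_zero R hj
  have hC1 : C 1 = R.matches' := by simpa using h1
  have key : ∀ (u : List (Fin σ)) (i : ℕ), i ∈ Acc R u →
      u ∈ C i ∨ ∃ v, v ≠ [] ∧ v <:+ u ∧ v ∈ R.matches' := by
    intro u
    induction u with
    | nil =>
      rintro i ⟨j, rfl, hj⟩
      refine .inl (Path.le hE hj (?_ : [] ∈ C 0))
      have : C 0 = 1 := h0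
      rw [this]
      exact Language.nil_mem_one
    | cons a u ih =>
      intro i hi
      obtain ⟨k, ⟨l, hp, hlett⟩, hk⟩ := mem_acc_cons.1 hi
      rcases ih k hk with hu | ⟨v, hv, hvu, hvR⟩
      · rcases hlett with ⟨x, hx, rfl, rfl⟩ | ⟨rfl, rfl⟩
        · exact .inl (Path.le hE hp (hl _ hx u hu))
        · refine .inr ⟨u, ?_, List.suffix_cons a u, hC1 ▸ hu⟩
          rintro rfl
          exact hne hk
      · exact .inr ⟨v, hv, hvu.trans (List.suffix_cons a u), hvR⟩
  rcases key u 1 h with hu | hu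
  · refine ⟨u, ?_, List.suffix_rfl, hC1 ▸ hu⟩
    rintro rfl
    exact hne h
  · exact hu

/-- The character at `x` can begin a word of the expression. -/
def First (R : RegularExpression (Fin σ)) (p x : ℕ) : Prop :=
  Path (inE R p) (2 * p + 1) (2 * x + 1)

/-- The character at `x` can end a word of the expression. -/
def Last (R : RegularExpression (Fin σ)) (p x : ℕ) : Prop := Path (finE R p) (2 * x) (2 * p)

/-- The character at `y` can follow the character at `x` in a word of the expression. -/
def Follow (R : RegularExpression (Fin σ)) (p x y : ℕ) : Prop :=
  Path (finE R p ++ inE R p) (2 * x) (2 * y + 1)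

/-- A run of the position automaton that is about to read the given word after position `x`. -/
def Chain (R : RegularExpression (Fin σ)) (p : ℕ) : List (Fin σ) → ℕ → Prop
  | [], x => Last R p x
  | a :: u, x => ∃ y, Follow R p x y ∧ (y, a) ∈ letters R p ∧ Chain R p u y

/-- A run of the position automaton on a nonempty word. -/
def Spells (R : RegularExpression (Fin σ)) (p : ℕ) : List (Fin σ) → Prop
  | [] => False
  | a :: u => ∃ x, First R p x ∧ (x, a) ∈ letters R p ∧ Chain R p u x

/-- A run in a subexpression `R` of `R'` is continued by a run in `R'`. -/
theorem Chain.append {R R' : RegularExpression (Fin σ)} {p p' : ℕ} {u v : List (Fin σ)} {x : ℕ}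
    (h : Chain R p u x) (hf : ∀ x y, Follow R p x y → Follow R' p' x y)
    (hl : ∀ x ∈ letters R p, x ∈ letters R' p') (hv : ∀ x, Last R p x → Chain R' p' v x) :
    Chain R' p' (u ++ v) x := by
  induction u generalizing x with
  | nil => exact hv x h
  | cons a u ih =>
    obtain ⟨y, h1, h2, h3⟩ := h
    exact ⟨y, hf _ _ h1, hl _ h2, ih h3⟩

theorem Spells.append {R R' : RegularExpression (Fin σ)} {p p' : ℕ} {u v : List (Fin σ)}
    (h : Spells R p u) (hs : ∀ x, First R p x → First R' p' x)
    (hf : ∀ x y, Follow R p x y → Follow R' p' x y)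
    (hl : ∀ x ∈ letters R p, x ∈ letters R' p') (hv : ∀ x, Last R p x → Chain R' p' v x) :
    Spells R' p' (u ++ v) := by
  cases u with
  | nil => exact h.elim
  | cons a u =>
    obtain ⟨x, h1, h2, h3⟩ := h
    exact ⟨x, hs _ h1, hl _ h2, h3.append hf hl hv⟩

/-- Completeness: for each operator the edge lists of the operands, and the additional edges that a
run uses, occur in the edge lists of the compound expression as sublists in the right order. -/
theorem spells_of_mem (R : RegularExpression (Fin σ)) (p : ℕ) (u : List (Fin σ)) (hu : u ≠ [])
    (h : u ∈ R.matches') : Spells R p u := by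
  have cons1 : ∀ {α : Type} (a : α) (l : List α), List.Sublist [a] (a :: l) :=
    fun a l => List.singleton_sublist.2 (by simp)
  induction R generalizing p u with
  | zero => exact h.elim
  | epsilon => exact absurd h hu
  | char a =>
    obtain rfl : u = [a] := h
    exact ⟨p, Path.refl _ _, by simp [letters], Path.refl _ _⟩
  | comp S T ihS ihT =>
    obtain ⟨v, hv, w, hw, rfl⟩ := Language.mem_mul.1 h
    set q := p + S.written.length + 4 with hq
    have fS : List.Sublist (finE S (p + 1)) (finE (.comp S T) p) := by
      simp only [finE]
      exact (List.sublist_append_left _ _).trans (List.sublist_append_right _ _)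
    have fT : List.Sublist (finE T q) (finE (.comp S T) p) := by
      simp only [finE]
      exact List.sublist_append_left _ _
    have iS : List.Sublist ((2 * p + 1, 2 * (p + 1) + 1) :: inE S (p + 1))
        (inE (.comp S T) p) := by
      simp only [inE]
      exact List.Sublist.append (cons1 _ _) (List.sublist_append_left _ _)
    have iT : List.Sublist ((2 * (p + 1), 2 * q + 1) :: inE T q) (inE (.comp S T) p) := by
      simp only [inE]
      exact List.Sublist.append (List.Sublist.cons _ (cons1 _ _)) (List.sublist_append_right _ _)
    have lS : ∀ x ∈ letters S (p + 1), x ∈ letters (.comp S T) p := fun x hx => by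
      simp [letters, hx]
    have lT : ∀ x ∈ letters T q, x ∈ letters (.comp S T) p := fun x hx => by
      simp only [letters, List.mem_append]; exact .inr hx
    have firstS : ∀ x, First S (p + 1) x → First (.comp S T) p x := fun x hx =>
      Path.sublist (E := (2 * p + 1, 2 * (p + 1) + 1) :: inE S (p + 1)) (Or.inr ⟨rfl, hx⟩) iS
    have followS : ∀ x y, Follow S (p + 1) x y → Follow (.comp S T) p x y := fun x y hx =>
      Path.sublist hx (fS.append ((List.sublist_cons_self _ _).trans iS))
    have followT : ∀ x y, Follow T q x y → Follow (.comp S T) p x y := fun x y hx =>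
      Path.sublist hx (fT.append ((List.sublist_cons_self _ _).trans iT))
    have lastT : ∀ x, Last T q x → Last (.comp S T) p x := fun x hx => by
      refine Path.sublist (Path.append hx (Path.edge (2 * q) (2 * p))) ?_
      simp only [finE]
      exact (List.Sublist.refl _).append
        ((cons1 _ _).trans (List.sublist_append_right _ _))
    rcases eq_or_ne v [] with rfl | hv0
    · have hfirst : ∀ x, First T q x → First (.comp S T) p x := fun x hx => by
        refine Path.sublist (E := (2 * p + 1, 2 * q + 1) :: inE T q) (Or.inr ⟨rfl, hx⟩) ?_
        simp only [inE, (matchEpsilon_iff S).2 hv, if_true]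
        exact List.Sublist.append (l₁ := [(2 * p + 1, 2 * q + 1)])
          (List.Sublist.cons _ (List.Sublist.cons _ (List.Sublist.refl _)))
          (List.sublist_append_right _ _)
      simpa using (ihT q w (by simpa using hu) hw).append hfirst followT lT
        (v := []) (fun x hx => lastT x hx)
    · have hS := ihS (p + 1) v hv0 hv
      rcases eq_or_ne w [] with rfl | hw0
      · refine hS.append firstS followS lS fun x hx => ?_
        refine Path.sublist (Path.append hx (Path.edge (2 * (p + 1)) (2 * p))) ?_
        simp only [finE, (matchEpsilon_iff T).2 hw, if_true]
        exact List.Sublist.trans ((List.Sublist.refl _).append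
          (List.Sublist.cons _ (List.Sublist.refl _))) (List.sublist_append_right _ _)
      · refine hS.append firstS followS lS fun x hx => ?_
        have hT := ihT q w hw0 hw
        cases w with
        | nil => exact hT.elim
        | cons a w =>
          obtain ⟨y, h1, h2, h3⟩ := hT
          have h3' := h3.append (v := []) followT lT (fun x hx => lastT x hx)
          rw [List.append_nil] at h3'
          exact ⟨y, Path.sublist (Path.append hx (Path.append (Path.edge (2 * (p + 1)) (2 * q + 1))
            h1)) (fS.append iT), lT _ h2, h3'⟩
  | plus S T ihS ihT =>
    set q := p + S.written.length + 4 with hq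
    rcases h with h | h
    · have hS := ihS (p + 1) u hu h
      rw [← List.append_nil u]
      refine hS.append (fun x hx => ?_) (fun x y hx => ?_) (fun x hx => ?_) fun x hx => ?_
      · refine Path.sublist (E := (2 * p + 1, 2 * (p + 1) + 1) :: inE S (p + 1))
          (Or.inr ⟨rfl, hx⟩) ?_
        simp only [inE]
        exact List.Sublist.append (cons1 _ _) (List.sublist_append_left _ _)
      · refine Path.sublist hx (List.Sublist.append ?_ ?_)
        · simp only [finE]
          exact (List.sublist_append_left _ _).trans (List.sublist_append_right _ _)
        · simp only [inE]
          exact (List.sublist_append_left _ _).trans (List.sublist_append_right _ _)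
      · simp [letters, hx]
      · refine Path.sublist (Path.append hx (Path.edge (2 * (p + 1)) (2 * p))) ?_
        simp only [finE]
        exact List.Sublist.trans ((List.Sublist.refl _).append (cons1 _ _))
          (List.sublist_append_right _ _)
    · have hT := ihT q u hu h
      rw [← List.append_nil u]
      refine hT.append (fun x hx => ?_) (fun x y hx => ?_) (fun x hx => ?_) fun x hx => ?_
      · refine Path.sublist (E := (2 * p + 1, 2 * q + 1) :: inE T q) (Or.inr ⟨rfl, hx⟩) ?_
        simp only [inE]
        exact List.Sublist.append (l₁ := [(2 * p + 1, 2 * q + 1)])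
          (List.Sublist.cons _ (List.Sublist.refl _)) (List.sublist_append_right _ _)
      · refine Path.sublist hx (List.Sublist.append ?_ ?_)
        · simp only [finE]
          exact List.sublist_append_left _ _
        · simp only [inE]
          exact (List.sublist_append_right _ _).trans (List.sublist_append_right _ _)
      · simp only [letters, List.mem_append]
        exact .inr hx
      · refine Path.sublist (Path.append hx (Path.edge (2 * q) (2 * p))) ?_
        simp only [finE]
        exact (List.Sublist.refl _).append
          ((List.Sublist.cons _ (List.Sublist.refl _)).trans (List.sublist_append_right _ _))
  | star S ihS =>
    have fS : List.Sublist (finE S (p + 1)) (finE (.star S) p) := by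
      simp only [finE]
      exact List.sublist_append_left _ _
    have iS : List.Sublist (inE S (p + 1)) (inE (.star S) p) := by
      simp only [inE]
      exact List.sublist_append_right _ _
    have followS : ∀ x y, Follow S (p + 1) x y → Follow (.star S) p x y := fun x y hx =>
      Path.sublist hx (fS.append iS)
    have firstS : ∀ x, First S (p + 1) x → First (.star S) p x := fun x hx => by
      refine Path.sublist (E := (2 * p + 1, 2 * (p + 1) + 1) :: inE S (p + 1))
          (Or.inr ⟨rfl, hx⟩) ?_
      simp only [inE]
      exact List.Sublist.append (cons1 _ _) (List.Sublist.refl _)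
    have next : ∀ x y, Last S (p + 1) x → First S (p + 1) y → Follow (.star S) p x y := by
      intro x y hx hy
      refine Path.sublist
        (Path.append hx (Path.append (Path.edge (2 * (p + 1)) (2 * (p + 1) + 1)) hy))
        (fS.append ?_)
      simp only [inE]
      exact List.Sublist.append (l₁ := [(2 * (p + 1), 2 * (p + 1) + 1)])
        (List.Sublist.cons _ (List.Sublist.refl _)) (List.Sublist.refl _)
    obtain ⟨L, rfl, hL⟩ := Language.mem_kstar_iff_exists_nonempty.1 h
    -- The run restarts inside the star, so its first step is described by `First S`.
    suffices H : ∀ L : List (List (Fin σ)), (∀ y ∈ L, y ∈ S.matches' ∧ y ≠ []) → L ≠ [] →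
        ∃ a u x, L.flatten = a :: u ∧ First S (p + 1) x ∧ (x, a) ∈ letters S (p + 1) ∧
          Chain (.star S) p u x by
      obtain ⟨a, u, x, h1, h2, h3, h4⟩ := H L hL (by rintro rfl; simp at hu)
      rw [h1]
      exact ⟨x, firstS x h2, h3, h4⟩
    clear hL hu h L
    intro L
    induction L with
    | nil => exact fun _ h => absurd rfl h
    | cons w L ih =>
      intro hL _
      have hw := hL w (by simp)
      have hS := ihS (p + 1) w hw.2 hw.1
      cases w with
      | nil => exact absurd rfl hw.2
      | cons a w =>
        obtain ⟨x, h1, h2, h3⟩ := hS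
        refine ⟨a, w ++ L.flatten, x, by simp, h1, h2, h3.append followS (fun _ h => h)
          fun z hz => ?_⟩
        rcases eq_or_ne L [] with rfl | hL0
        · refine Path.sublist (Path.append hz (Path.edge (2 * (p + 1)) (2 * p))) ?_
          simp only [finE]
          exact List.Sublist.refl _
        · obtain ⟨b, u, y, g1, g2, g3, g4⟩ := ih (fun y hy => hL y (by simp [hy])) hL0
          rw [g1]
          exact ⟨y, next z y hz g2, g3, g4⟩

theorem acc_of_chain {R : RegularExpression (Fin σ)} {u : List (Fin σ)} {x : ℕ}
    (h : Chain R 0 u x) : 2 * x ∈ Acc R u := by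
  induction u generalizing x with
  | nil => exact ⟨_, rfl, Path.append h (Path.refl _ _)⟩
  | cons a u ih =>
    obtain ⟨y, h1, h2, h3⟩ := h
    exact mem_acc_cons.2 ⟨2 * y, ⟨_, h1, .inl ⟨y, h2, rfl, rfl⟩⟩, ih h3⟩

/-- From the restart slot, exactly the words with a nonempty suffix in the language are accepted. -/
theorem mem_acc_one_iff {R : RegularExpression (Fin σ)} {u : List (Fin σ)} :
    1 ∈ Acc R u ↔ ∃ v, v ≠ [] ∧ v <:+ u ∧ v ∈ R.matches' := by
  refine ⟨exists_suffix_of_acc, ?_⟩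
  rintro ⟨v, hv, ⟨t, rfl⟩, hR⟩
  have hloop : ∀ t : List (Fin σ), Rel R t 1 1 := by
    intro t
    induction t with
    | nil => rfl
    | cons a t ih => exact ⟨1, ⟨1, Path.refl _ _, .inr ⟨rfl, rfl⟩⟩, ih⟩
  refine mem_acc_append.2 ⟨1, hloop t, ?_⟩
  have h := spells_of_mem R 0 v hv hR
  cases v with
  | nil => exact absurd rfl hv
  | cons a v =>
    obtain ⟨x, h1, h2, h3⟩ := h
    exact mem_acc_cons.2 ⟨2 * x, ⟨_, Path.append (Path.refl _ _) h1, .inl ⟨x, h2, rfl, rfl⟩⟩,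
      acc_of_chain h3⟩

end RegexMatch

/-! ### The trie of phrases -/

namespace RegexMatch

variable {σ : ℕ}

/-- Tries of words over `Fin σ` with the nodes `0, …, n`, the root being `0`: node `v` has the
parent `par v` and the word `str v`, whose last character is kept as the symbol `chr v`, in the
numbering of written regular expressions. Different nodes may have the same word. -/
structure IsTrie (σ n : ℕ) (par chr : ℕ → ℕ) (str : ℕ → List (Fin σ)) : Prop where
  par_le : ∀ i < n, par (i + 1) ≤ i
  str_zero : str 0 = []
  str_succ : ∀ i < n, ∃ a : Fin σ, chr (i + 1) = 7 + a ∧ str (i + 1) = str (par (i + 1)) ++ [a]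

/-- The nodes on the path from `v` up to, but excluding, the root. -/
def ancs (par : ℕ → ℕ) (v : ℕ) : List ℕ :=
  if _h : par v < v then v :: ancs par (par v) else []
termination_by v

open Classical in
/-- The first node with the property `P` on the path from `v` to the root; `0` if there is none. -/
noncomputable def firstAnc (par : ℕ → ℕ) (P : ℕ → Prop) (v : ℕ) : ℕ :=
  if _h : par v < v then if P v then v else firstAnc par P (par v) else 0
termination_by v

section firstAnc
variable (par : ℕ → ℕ) (P P' : ℕ → Prop) (v : ℕ)

theorem firstAnc_zero : firstAnc par P 0 = 0 := by
  rw [firstAnc, dif_neg (by omega)]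

theorem firstAnc_le : firstAnc par P v ≤ v := by
  induction v using Nat.strong_induction_on with
  | _ v ih =>
    rw [firstAnc]
    split_ifs with h h'
    · exact le_rfl
    · exact (ih _ h).trans h.le
    · omega

/-- Since ancestors have smaller numbers, the nearest of several ancestors is the largest. -/
theorem firstAnc_or : firstAnc par (fun v => P v ∨ P' v) v =
    max (firstAnc par P v) (firstAnc par P' v) := by
  induction v using Nat.strong_induction_on with
  | _ v ih =>
    have h1 := firstAnc_le par P v
    have h2 := firstAnc_le par P' v
    rw [firstAnc.eq_def par (fun v => P v ∨ P' v) v]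
    rw [firstAnc.eq_def par P v] at h1 ⊢
    rw [firstAnc.eq_def par P' v] at h2 ⊢
    by_cases h : par v < v
    · by_cases hP : P v <;> by_cases hP' : P' v <;> simp_all
    · simp [h]

theorem firstAnc_false (h : ∀ v, ¬ P v) : firstAnc par P v = 0 := by
  induction v using Nat.strong_induction_on with
  | _ v ih =>
    rw [firstAnc]
    split_ifs with h1 h2
    · exact absurd h2 (h _)
    · exact ih _ h1
    · rfl

open Classical in
/-- The ancestors with a property can be enumerated by repeated jumps to the nearest one. -/
theorem filter_ancs : (ancs par v).filter P = if firstAnc par P v = 0 then [] else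
    firstAnc par P v :: (ancs par (par (firstAnc par P v))).filter P := by
  induction v using Nat.strong_induction_on with
  | _ v ih =>
    rw [ancs, firstAnc]
    by_cases h : par v < v
    · by_cases hP : P v
      · have hv : v ≠ 0 := by omega
        simp [h, hP, hv]
      · simp [h, hP, ih _ h]
    · simp [h]

end firstAnc

variable {n : ℕ} {par chr : ℕ → ℕ} {str : ℕ → List (Fin σ)}

theorem IsTrie.par_lt (h : IsTrie σ n par chr str) {v : ℕ} (h0 : v ≠ 0) (hv : v ≤ n) :
    par v < v := by
  obtain ⟨i, rfl⟩ := Nat.exists_eq_succ_of_ne_zero h0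
  exact Nat.lt_succ_of_le (h.par_le i (by omega))

theorem IsTrie.length_str (h : IsTrie σ n par chr str) {v : ℕ} (h0 : v ≠ 0) (hv : v ≤ n) :
    (str v).length = (str (par v)).length + 1 := by
  obtain ⟨i, rfl⟩ := Nat.exists_eq_succ_of_ne_zero h0
  obtain ⟨a, -, ha⟩ := h.str_succ i (by omega)
  simp [ha]

theorem IsTrie.length_str_le (h : IsTrie σ n par chr str) {v : ℕ} (hv : v ≤ n) :
    (str v).length ≤ v := by
  induction v using Nat.strong_induction_on with
  | _ v ih =>
    rcases eq_or_ne v 0 with rfl | h0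
    · simp [h.str_zero]
    · have h1 := h.par_lt h0 hv
      have := ih _ h1 (by omega)
      rw [h.length_str h0 hv]; omega

theorem IsTrie.ancs_eq (h : IsTrie σ n par chr str) {v : ℕ} (h0 : v ≠ 0) (hv : v ≤ n) :
    ancs par v = v :: ancs par (par v) := by
  rw [ancs, dif_pos (h.par_lt h0 hv)]

theorem ancs_zero : ancs par 0 = [] := by rw [ancs, dif_neg (by omega)]

/-- The words on the path to the root are the nonempty prefixes. -/
theorem IsTrie.mem_ancs (h : IsTrie σ n par chr str) {v : ℕ} (hv : v ≤ n) :
    ∀ u ∈ ancs par v, u ≠ 0 ∧ u ≤ v ∧ str u = (str v).take (str u).length ∧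
      1 ≤ (str u).length ∧ (str u).length ≤ (str v).length := by
  induction v using Nat.strong_induction_on with
  | _ v ih =>
    intro u hu
    rcases eq_or_ne v 0 with rfl | h0
    · simp [ancs_zero] at hu
    · have h1 := h.par_lt h0 hv
      have h2 := h.length_str h0 hv
      rw [h.ancs_eq h0 hv, List.mem_cons] at hu
      rcases hu with rfl | hu
      · simp [h0]; omega
      · obtain ⟨g0, g1, g2, g3, g4⟩ := ih _ h1 (by omega) u hu
        refine ⟨g0, by omega, ?_, g3, by omega⟩
        obtain ⟨i, rfl⟩ := Nat.exists_eq_succ_of_ne_zero h0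
        obtain ⟨a, -, ha⟩ := h.str_succ i (by omega)
        rw [Nat.succ_eq_add_one, ha, List.take_append_of_le_length g4]
        exact g2

theorem IsTrie.exists_mem_ancs (h : IsTrie σ n par chr str) {v : ℕ} (hv : v ≤ n) {d : ℕ}
    (h1 : 1 ≤ d) (h2 : d ≤ (str v).length) : ∃ u ∈ ancs par v, (str u).length = d := by
  induction v using Nat.strong_induction_on with
  | _ v ih =>
    rcases eq_or_ne v 0 with rfl | h0
    · simp [h.str_zero] at h2; omega
    · rw [h.ancs_eq h0 hv]
      have h3 := h.par_lt h0 hv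
      have h4 := h.length_str h0 hv
      rcases eq_or_ne d (str v).length with rfl | hd
      · exact ⟨v, by simp, rfl⟩
      · obtain ⟨u, hu, hud⟩ := ih _ h3 (by omega) (by omega)
        exact ⟨u, by simp [hu], hud⟩

theorem IsTrie.ancs_pairwise (h : IsTrie σ n par chr str) {v : ℕ} (hv : v ≤ n) :
    (ancs par v).Pairwise fun x y => (str x).length ≠ (str y).length := by
  induction v using Nat.strong_induction_on with
  | _ v ih =>
    rcases eq_or_ne v 0 with rfl | h0
    · simp [ancs_zero]
    · rw [h.ancs_eq h0 hv]
      have h3 := h.par_lt h0 hv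
      have h4 := h.length_str h0 hv
      refine List.pairwise_cons.2 ⟨fun u hu => ?_, ih _ h3 (by omega)⟩
      have := h.mem_ancs (v := par v) (by omega) u hu
      omega

/-- The concatenation of the first `i` phrases. -/
def text (str : ℕ → List (Fin σ)) (i : ℕ) : List (Fin σ) :=
  ((List.range i).map fun j => str (j + 1)).flatten

theorem text_succ (str : ℕ → List (Fin σ)) (i : ℕ) :
    text str (i + 1) = text str i ++ str (i + 1) := by
  simp [text, List.range_succ]

theorem text_prefix (str : ℕ → List (Fin σ)) {i j : ℕ} (h : i ≤ j) : text str i <+: text str j := by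
  induction j, h using Nat.le_induction with
  | base => exact List.prefix_rfl
  | succ j _ ih => exact ih.trans (by rw [text_succ]; exact List.prefix_append _ _)

/-- The slots that the automaton may be in after the first `i` phrases. -/
def slots (R : RegularExpression (Fin σ)) (str : ℕ → List (Fin σ)) (i : ℕ) : Set ℕ :=
  {s | Rel R (text str i) 1 s}

/-- After the first `i` phrases and the word of node `v`, a match ends. -/
def Hit (R : RegularExpression (Fin σ)) (str : ℕ → List (Fin σ)) (i v : ℕ) : Prop :=
  ∃ s ∈ slots R str i, s ∈ Acc R (str v)

open Classical in
/-- The matches that end in the phrase number `i + 1`, given by ending positions. -/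
noncomputable def report (R : RegularExpression (Fin σ)) (par : ℕ → ℕ) (str : ℕ → List (Fin σ))
    (i : ℕ) : List ℕ :=
  ((ancs par (i + 1)).filter (Hit R str i)).map fun v => (text str i).length + (str v).length

theorem hit_iff {R : RegularExpression (Fin σ)} {i v : ℕ} : Hit R str i v ↔
    ∃ w, w ≠ [] ∧ w <:+ text str i ++ str v ∧ w ∈ R.matches' := by
  rw [← mem_acc_one_iff, mem_acc_append]; rfl

theorem mem_matchEnds_iff {R : RegularExpression (Fin σ)} {Q : List (Fin σ)} {j : ℕ} :
    j ∈ matchEnds R Q ↔ j ≤ Q.length ∧ ∃ w, w ≠ [] ∧ w <:+ Q.take j ∧ w ∈ R.matches' := by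
  refine and_congr_right fun hj => ⟨?_, ?_⟩
  · rintro ⟨i, h1, h2, h3⟩
    refine ⟨_, ?_, List.drop_suffix (i - 1) _, h3⟩
    intro h
    have := congrArg List.length h
    simp at this; omega
  · rintro ⟨w, hw, ⟨t, ht⟩, hR⟩
    have hl := congrArg List.length ht
    have : 0 < w.length := List.length_pos_iff.2 hw
    simp at hl
    refine ⟨t.length + 1, by omega, by omega, ?_⟩
    rw [substringAt, ← ht]
    simpa using hR

theorem IsTrie.take_text (h : IsTrie σ n par chr str) {i u : ℕ} (hi : i < n)
    (hu : u ∈ ancs par (i + 1)) :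
    (text str n).take ((text str i).length + (str u).length) = text str i ++ str u := by
  obtain ⟨-, -, h1, -, h2⟩ := h.mem_ancs (v := i + 1) (by omega) u hu
  obtain ⟨t, ht⟩ := text_prefix str (show i + 1 ≤ n by omega)
  rw [← ht, text_succ, List.append_assoc, List.take_length_add_append,
    List.take_append_of_le_length h2, ← h1]

theorem length_text_succ (str : ℕ → List (Fin σ)) (i : ℕ) :
    (text str (i + 1)).length = (text str i).length + (str (i + 1)).length := by
  simp [text_succ]

theorem length_text_mono (str : ℕ → List (Fin σ)) {i j : ℕ} (h : i ≤ j) :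
    (text str i).length ≤ (text str j).length := (text_prefix str h).length_le

theorem mem_report {R : RegularExpression (Fin σ)} {i j : ℕ} :
    j ∈ report R par str i ↔
      ∃ u ∈ ancs par (i + 1), Hit R str i u ∧ (text str i).length + (str u).length = j := by
  simp [report, and_assoc]

theorem IsTrie.mem_reports_iff (h : IsTrie σ n par chr str) {R : RegularExpression (Fin σ)}
    {j : ℕ} :
    j ∈ (List.range n).flatMap (report R par str) ↔ j ∈ matchEnds R (text str n) := by
  simp only [List.mem_flatMap, List.mem_range, mem_report, mem_matchEnds_iff]
  constructor
  · rintro ⟨i, hi, u, hu, hit, rfl⟩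
    have h2 := (h.mem_ancs (v := i + 1) (by omega) u hu).2.2.2.2
    have h3 := length_text_mono str (show i + 1 ≤ n by omega)
    rw [length_text_succ] at h3
    exact ⟨by omega, by rw [h.take_text hi hu]; exact hit_iff.1 hit⟩
  · rintro ⟨hj, w, hw, hs, hR⟩
    have hj0 : 0 < j := by
      rcases Nat.eq_zero_or_pos j with rfl | h
      · simp at hs; exact absurd hs hw
      · exact h
    -- The phrase that contains position `j`.
    obtain ⟨i, hi, h1, h2⟩ : ∃ i < n, (text str i).length < j ∧ j ≤ (text str (i + 1)).length := by
      clear hs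
      have : ∀ k ≤ n, j ≤ (text str k).length →
          ∃ i < n, (text str i).length < j ∧ j ≤ (text str (i + 1)).length := by
        intro k
        induction k with
        | zero => intro _ h; simp [text] at h; omega
        | succ k ih =>
          intro hk h
          by_cases h' : j ≤ (text str k).length
          · exact ih (by omega) h'
          · exact ⟨k, by omega, by omega, h⟩
      exact this n le_rfl hj
    rw [length_text_succ] at h2
    obtain ⟨u, hu, hud⟩ := h.exists_mem_ancs (v := i + 1) (by omega)
      (d := j - (text str i).length) (by omega) (by omega)
    have e : (text str i).length + (str u).length = j := by omega
    refine ⟨i, hi, u, hu, ?_, e⟩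
    rw [hit_iff, ← h.take_text hi hu, e]
    exact ⟨w, hw, hs, hR⟩

theorem IsTrie.nodup_reports (h : IsTrie σ n par chr str) {R : RegularExpression (Fin σ)} :
    ((List.range n).flatMap (report R par str)).Nodup := by
  refine List.nodup_flatMap.2 ⟨fun i hi => ?_, ?_⟩
  · rw [List.mem_range] at hi
    rw [report, List.Nodup, List.pairwise_map]
    refine ((h.ancs_pairwise (v := i + 1) (by omega)).filter _).imp fun hxy => ?_
    omega
  · refine (List.pairwise_lt_range).imp_of_mem fun {i j} hi hj hij => ?_
    rw [List.mem_range] at hi hj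
    intro x hx hx'
    obtain ⟨u, hu, -, hux⟩ := mem_report.1 hx
    obtain ⟨u', hu', -, hux'⟩ := mem_report.1 hx'
    have h1 := (h.mem_ancs (v := i + 1) (by omega) u hu).2.2.2.2
    have h2 := (h.mem_ancs (v := j + 1) (by omega) u' hu').2.2.2.1
    have h3 := length_text_mono str (show i + 1 ≤ j by omega)
    rw [length_text_succ] at h3
    omega

/-! ### The tries of the two formats -/

theorem isTrie_of_zl78 {Z : List (ℕ × Fin σ)} {Q : List (Fin σ)} (hZ : ZL78Represents Z Q)
    (hpar : ∀ (i : ℕ) (hi : i < Z.length), par (i + 1) = Z[i].1)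
    (hchr : ∀ (i : ℕ) (hi : i < Z.length), chr (i + 1) = 7 + Z[i].2) :
    ∃ str, IsTrie σ Z.length par chr str ∧ text str Z.length = Q := by
  obtain ⟨phrase, h0, h1, rfl⟩ := hZ
  exact ⟨phrase, ⟨fun i hi => by rw [hpar i hi]; exact (h1 i hi).1, h0,
    fun i hi => ⟨Z[i].2, hchr i hi, by rw [hpar i hi]; exact (h1 i hi).2⟩⟩, rfl⟩

/-- A ZLW code `entry j` extends the phrase `j`, node `j + 1`, by the first character of the next
phrase; for `j + 1 = i` this is the first character of the phrase `i` itself. -/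
theorem isTrie_of_zlw {Z : List (ZLWCode σ)} {Q : List (Fin σ)} (hZ : ZLWRepresents Z Q)
    {fst : ℕ → ℕ}
    (hchar : ∀ (i : ℕ) (hi : i < Z.length), Z[i].word < σ →
      par (i + 1) = 0 ∧ fst (i + 1) = Z[i].word ∧ chr (i + 1) = 7 + Z[i].word)
    (hentry : ∀ (i : ℕ) (hi : i < Z.length), ¬ Z[i].word < σ →
      par (i + 1) = Z[i].word - σ + 1 ∧ fst (i + 1) = fst (Z[i].word - σ + 1) ∧
      chr (i + 1) = 7 + fst (Z[i].word - σ + 2)) :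
    ∃ str, IsTrie σ Z.length par chr str ∧ text str Z.length = Q := by
  obtain ⟨phrase, h1, rfl⟩ := hZ
  -- `fst` holds the first characters of the phrases.
  have hfst : ∀ i (hi : i < Z.length), ∃ a t, phrase i = a :: t ∧ fst (i + 1) = (a : ℕ) := by
    intro i
    induction i using Nat.strong_induction_on with
    | _ i ih =>
      intro hi
      have h2 := h1 i hi
      cases hz : Z[i] with
      | char a =>
        rw [hz] at h2
        have h3 := hchar i hi (by simp [hz, ZLWCode.word])
        exact ⟨a, [], h2, by simp [h3.2.1, hz, ZLWCode.word]⟩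
      | entry j =>
        rw [hz] at h2
        have h3 := hentry i hi (by simp [hz, ZLWCode.word])
        obtain ⟨a, t, ha, hf⟩ := ih j h2.1 (h2.1.trans hi)
        refine ⟨a, t ++ (phrase (j + 1)).take 1, by rw [h2.2, ha]; rfl, ?_⟩
        rw [h3.2.1]; simpa [hz, ZLWCode.word] using hf
  refine ⟨fun v => if v = 0 then [] else phrase (v - 1), ⟨fun i hi => ?_, rfl, fun i hi => ?_⟩,
    by simp [text]⟩
  · have h2 := h1 i hi
    cases hz : Z[i] with
    | char a => rw [(hchar i hi (by simp [hz, ZLWCode.word])).1]; omega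
    | entry j =>
      rw [hz] at h2
      have := (hentry i hi (by simp [hz, ZLWCode.word])).1
      have h3 := h2.1
      simp [hz, ZLWCode.word] at this
      omega
  · have h2 := h1 i hi
    cases hz : Z[i] with
    | char a =>
      rw [hz] at h2
      have h3 := hchar i hi (by simp [hz, ZLWCode.word])
      exact ⟨a, by simpa [hz, ZLWCode.word] using h3.2.2,
        by simpa [h3.1, ZLWCode.StandsFor] using h2⟩
    | entry j =>
      rw [hz] at h2
      have h3 := hentry i hi (by simp [hz, ZLWCode.word])
      simp [hz, ZLWCode.word] at h3
      obtain ⟨a, t, ha, hf⟩ := hfst (j + 1) (lt_of_le_of_lt h2.1 hi)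
      exact ⟨a, by rw [h3.2.2, hf], by simpa [h3.1, ha] using h2.2⟩

end RegexMatch

/-! ### Tables for a written regular expression -/

namespace RegexMatch

open RegularExpression

variable {σ : ℕ}

/-- The tables `kind` and `sec` describe the expression `R` that is written from position `p` on:
`kind` gives the operator or atom of the subexpression that begins at a position, `sec` the
position of its second operand; `kind` is zero where no subexpression begins. -/
def Parsed (kind sec : ℕ → ℕ) : RegularExpression (Fin σ) → ℕ → Prop
  | .zero, p => kind p = 5
  | .epsilon, p => kind p = 6
  | .char a, p => kind p = 7 + a
  | .comp S T, p => kind p = 2 ∧ sec p = p + S.written.length + 4 ∧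
      kind (p + S.written.length + 1) = 0 ∧ kind (p + S.written.length + 2) = 0 ∧
      kind (p + S.written.length + 3) = 0 ∧
      kind (p + S.written.length + 4 + T.written.length) = 0 ∧
      Parsed kind sec S (p + 1) ∧ Parsed kind sec T (p + S.written.length + 4)
  | .plus S T, p => kind p = 3 ∧ sec p = p + S.written.length + 4 ∧
      kind (p + S.written.length + 1) = 0 ∧ kind (p + S.written.length + 2) = 0 ∧
      kind (p + S.written.length + 3) = 0 ∧
      kind (p + S.written.length + 4 + T.written.length) = 0 ∧
      Parsed kind sec S (p + 1) ∧ Parsed kind sec T (p + S.written.length + 4)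
  | .star S, p => kind p = 4 ∧ kind (p + S.written.length + 1) = 0 ∧
      kind (p + S.written.length + 2) = 0 ∧ Parsed kind sec S (p + 1)

theorem Parsed.congr {kind sec kind' sec' : ℕ → ℕ} {R : RegularExpression (Fin σ)} {p : ℕ}
    (h : Parsed kind sec R p)
    (hc : ∀ x, p ≤ x → x < p + R.written.length → kind' x = kind x ∧ sec' x = sec x) :
    Parsed kind' sec' R p := by
  induction R generalizing p with
  | zero | epsilon | char =>
    simp only [Parsed] at h ⊢
    rw [(hc p le_rfl (by simp)).1, h]
  | comp S T ihS ihT | plus S T ihS ihT =>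
    simp only [comp_def, plus_def, length_comp, length_plus] at hc
    obtain ⟨h1, h2, h3, h4, h5, h6, h7, h8⟩ := h
    refine ⟨?_, ?_, ?_, ?_, ?_, ?_, ihS h7 fun x hx hx' => hc x (by omega) (by omega),
      ihT h8 fun x hx hx' => hc x (by omega) (by omega)⟩
    · rw [(hc _ (by omega) (by omega)).1, h1]
    · rw [(hc _ (by omega) (by omega)).2, h2]
    · rw [(hc _ (by omega) (by omega)).1, h3]
    · rw [(hc _ (by omega) (by omega)).1, h4]
    · rw [(hc _ (by omega) (by omega)).1, h5]
    · rw [(hc _ (by omega) (by omega)).1, h6]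
  | star S ihS =>
    simp only [length_star] at hc
    obtain ⟨h1, h2, h3, h4⟩ := h
    refine ⟨?_, ?_, ?_, ihS h4 fun x hx hx' => hc x (by omega) (by omega)⟩
    · rw [(hc _ (by omega) (by omega)).1, h1]
    · rw [(hc _ (by omega) (by omega)).1, h2]
    · rw [(hc _ (by omega) (by omega)).1, h3]

/-- The state of the parser: a stack of the positions of open parentheses, the partner `r` of the
parenthesis that was closed last, and the tables. -/
structure Parser where
  sp : ℕ
  r : ℕ
  stk : ℕ → ℕ
  kind : ℕ → ℕ
  sec : ℕ → ℕ

/-- The parser reads the symbol `x` at position `i`. -/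
def Parser.step (x i : ℕ) (P : Parser) : Parser :=
  if x = 0 then { P with
    sp := P.sp + 1
    stk := Function.update P.stk P.sp i
    kind := Function.update P.kind i 0 }
  else if x = 1 then { P with
    sp := P.sp - 1
    r := P.stk (P.sp - 1)
    kind := Function.update P.kind i 0 }
  else if x < 5 then { P with
    kind := Function.update (Function.update P.kind i 0) P.r x
    sec := Function.update P.sec P.r (i + 2) }
  else { P with kind := Function.update P.kind i x }

/-- The parser reads a list of symbols that begins at position `i`. -/
def Parser.run : List ℕ → ℕ → Parser → Parser
  | [], _, P => P
  | x :: l, i, P => run l (i + 1) (P.step x i)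

theorem Parser.run_append (l l' : List ℕ) (i : ℕ) (P : Parser) :
    P.run (l ++ l') i = (P.run l i).run l' (i + l.length) := by
  induction l generalizing i P with
  | nil => rfl
  | cons x l ih => simp only [List.cons_append, run, ih, List.length_cons]; congr 1; omega

/-- Reading an expression fills its part of the tables, and leaves alone the stack that it found and
the entries of the tables further to the left. -/
theorem Parser.run_written (R : RegularExpression (Fin σ)) (p : ℕ) (P : Parser) :
    (P.run R.written p).sp = P.sp ∧ (∀ k < P.sp, (P.run R.written p).stk k = P.stk k) ∧
    (∀ x < p, (P.run R.written p).kind x = P.kind x ∧ (P.run R.written p).sec x = P.sec x) ∧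
    Parsed (P.run R.written p).kind (P.run R.written p).sec R p := by
  have atom : ∀ x p (P : Parser), 5 ≤ x → (P.run [x] p).sp = P.sp ∧
      (∀ k < P.sp, (P.run [x] p).stk k = P.stk k) ∧
      (∀ y < p, (P.run [x] p).kind y = P.kind y ∧ (P.run [x] p).sec y = P.sec y) ∧
      (P.run [x] p).kind p = x := by
    intro x p P hx
    simp only [run, step, if_neg (show x ≠ 0 by omega), if_neg (show x ≠ 1 by omega),
      if_neg (show ¬ x < 5 by omega)]
    refine ⟨by simp, by simp, fun y hy => ⟨?_, trivial⟩, by simp⟩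
    rw [Function.update_of_ne (by omega)]
  -- Both binary operators are parsed alike.
  have bin : ∀ (S T : RegularExpression (Fin σ)) (op : ℕ), (op = 2 ∨ op = 3) →
      (∀ (p : ℕ) (P : Parser), (P.run S.written p).sp = P.sp ∧
        (∀ k < P.sp, (P.run S.written p).stk k = P.stk k) ∧
        (∀ x < p, (P.run S.written p).kind x = P.kind x ∧ (P.run S.written p).sec x = P.sec x) ∧
        Parsed (P.run S.written p).kind (P.run S.written p).sec S p) →
      (∀ (p : ℕ) (P : Parser), (P.run T.written p).sp = P.sp ∧
        (∀ k < P.sp, (P.run T.written p).stk k = P.stk k) ∧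
        (∀ x < p, (P.run T.written p).kind x = P.kind x ∧ (P.run T.written p).sec x = P.sec x) ∧
        Parsed (P.run T.written p).kind (P.run T.written p).sec T p) →
      ∀ (p : ℕ) (P P' : Parser),
      P' = P.run ([0] ++ S.written ++ [1, op, 0] ++ T.written ++ [1]) p → P'.sp = P.sp ∧
      (∀ k < P.sp, P'.stk k = P.stk k) ∧
      (∀ x < p, P'.kind x = P.kind x ∧ P'.sec x = P.sec x) ∧ P'.kind p = op ∧
      P'.sec p = p + S.written.length + 4 ∧
      P'.kind (p + S.written.length + 1) = 0 ∧ P'.kind (p + S.written.length + 2) = 0 ∧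
      P'.kind (p + S.written.length + 3) = 0 ∧
      P'.kind (p + S.written.length + 4 + T.written.length) = 0 ∧
      Parsed P'.kind P'.sec S (p + 1) ∧ Parsed P'.kind P'.sec T (p + S.written.length + 4) := by
    intro S T op hop hS hT p P P' hP'
    have op0 : op ≠ 0 := by omega
    have op1 : op ≠ 1 := by omega
    have op5 : op < 5 := by omega
    rw [run_append, run_append, run_append, run_append] at hP'
    simp only [List.length_append, List.length_cons, List.length_nil, zero_add] at hP'
    obtain ⟨P₁, e₁⟩ : ∃ P₁, P₁ = P.run [0] p := ⟨_, rfl⟩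
    obtain ⟨P₂, e₂⟩ : ∃ P₂, P₂ = P₁.run S.written (p + 1) := ⟨_, rfl⟩
    obtain ⟨P₃, e₃⟩ : ∃ P₃, P₃ = P₂.run [1, op, 0] (p + (1 + S.written.length)) := ⟨_, rfl⟩
    obtain ⟨P₄, e₄⟩ : ∃ P₄, P₄ = P₃.run T.written (p + S.written.length + 4) := ⟨_, rfl⟩
    rw [← e₁, ← e₂, ← e₃, show p + (1 + S.written.length + (1 + 1 + 1)) =
      p + S.written.length + 4 by omega, ← e₄] at hP'
    obtain ⟨a1, a2, a3, a4⟩ := hS (p + 1) P₁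
    rw [← e₂] at a1 a2 a3 a4
    obtain ⟨b1, b2, b3, b4⟩ := hT (p + S.written.length + 4) P₃
    rw [← e₄] at b1 b2 b3 b4
    simp only [run, step, if_true] at e₁
    have c1 : P₁.sp = P.sp + 1 := by rw [e₁]
    have hr : P₂.stk (P₂.sp - 1) = p := by
      rw [a1, c1, a2 _ (by omega), e₁]; simp
    simp only [run, step, if_true, op0, op1, op5, if_false, one_ne_zero] at e₃
    have c3 : P₃.sp = P.sp + 1 := by rw [e₃]; simp only; omega
    simp only [run, step, if_true, one_ne_zero, if_false] at hP'
    have d1 : P'.sp = P₄.sp - 1 := by rw [hP']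
    have d2 : P'.stk = P₄.stk := by rw [hP']
    have d3 : P'.sec = P₄.sec := by rw [hP']
    have d4 : P'.kind =
        Function.update P₄.kind (p + S.written.length + 4 + T.written.length) 0 := by
      rw [hP']; simp only; congr 1; omega
    have d5 : ∀ x, x < p + S.written.length + 4 + T.written.length → P'.kind x = P₄.kind x := by
      intro x hx; rw [d4, Function.update_of_ne (by omega)]
    have k3 : ∀ x, x ≠ p → x ≠ p + S.written.length + 1 → x ≠ p + S.written.length + 2 →
        x ≠ p + S.written.length + 3 → P₃.kind x = P₂.kind x ∧ P₃.sec x = P₂.sec x := by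
      intro x h0 h1 h2 h3
      simp only [e₃, hr]
      rw [Function.update_of_ne (by omega), Function.update_of_ne (by omega),
        Function.update_of_ne (by omega), Function.update_of_ne (by omega),
        Function.update_of_ne (by omega)]
      exact ⟨rfl, rfl⟩
    have k3' : P₃.kind p = op ∧ P₃.sec p = p + S.written.length + 4 ∧
        P₃.kind (p + S.written.length + 1) = 0 ∧ P₃.kind (p + S.written.length + 2) = 0 ∧
        P₃.kind (p + S.written.length + 3) = 0 := by
      simp only [e₃, hr, Function.update_apply]
      refine ⟨?_, ?_, ?_, ?_, ?_⟩
      · rw [if_neg (by omega), if_pos trivial]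
      · rw [if_pos trivial]; omega
      · rw [if_neg (by omega), if_neg (by omega), if_neg (by omega), if_pos (by omega)]
      · rw [if_neg (by omega), if_neg (by omega), if_pos (by omega)]
      · rw [if_pos (by omega)]
    have hSl := length_pos S
    have hTl := length_pos T
    refine ⟨by omega, fun k hk => ?_, fun x hx => ⟨?_, ?_⟩, ?_, ?_, ?_, ?_, ?_, ?_, ?_, ?_⟩
    · rw [d2, b2 k (by omega)]
      have : P₃.stk k = P₂.stk k := by
        simp only [e₃]
        rw [Function.update_of_ne (by omega)]
      rw [this, a2 k (by omega), e₁]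
      simp only
      rw [Function.update_of_ne (by omega)]
    · rw [d5 x (by omega), (b3 x (by omega)).1, (k3 x (by omega) (by omega) (by omega)
        (by omega)).1, (a3 x (by omega)).1, e₁]
      simp only
      rw [Function.update_of_ne (by omega)]
    · rw [d3, (b3 x (by omega)).2, (k3 x (by omega) (by omega) (by omega)
        (by omega)).2, (a3 x (by omega)).2, e₁]
    · rw [d5 _ (by omega), (b3 _ (by omega)).1, k3'.1]
    · rw [d3, (b3 _ (by omega)).2, k3'.2.1]
    · rw [d5 _ (by omega), (b3 _ (by omega)).1, k3'.2.2.1]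
    · rw [d5 _ (by omega), (b3 _ (by omega)).1, k3'.2.2.2.1]
    · rw [d5 _ (by omega), (b3 _ (by omega)).1, k3'.2.2.2.2]
    · rw [d4]; simp
    · refine a4.congr fun x hx hx' => ⟨?_, ?_⟩
      · rw [d5 _ (by omega), (b3 _ (by omega)).1,
          (k3 x (by omega) (by omega) (by omega) (by omega)).1]
      · rw [d3, (b3 _ (by omega)).2, (k3 x (by omega) (by omega) (by omega) (by omega)).2]
    · exact b4.congr fun x hx hx' => ⟨d5 _ (by omega), by rw [d3]⟩
  induction R generalizing p P with
  | zero => exact atom 5 p P (by omega)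
  | epsilon => exact atom 6 p P (by omega)
  | char a => exact atom (7 + a) p P (by omega)
  | comp S T ihS ihT => exact bin S T 2 (.inl rfl) ihS ihT p P _ rfl
  | plus S T ihS ihT => exact bin S T 3 (.inr rfl) ihS ihT p P _ rfl
  | star S ihS =>
    obtain ⟨P', hP'⟩ : ∃ P', P' = P.run (RegularExpression.star S).written p := ⟨_, rfl⟩
    rw [← hP']
    simp only [written] at hP'
    rw [run_append, run_append] at hP'
    simp only [List.length_append, List.length_cons, List.length_nil, zero_add] at hP'
    obtain ⟨P₁, e₁⟩ : ∃ P₁, P₁ = P.run [0] p := ⟨_, rfl⟩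
    obtain ⟨P₂, e₂⟩ : ∃ P₂, P₂ = P₁.run S.written (p + 1) := ⟨_, rfl⟩
    rw [← e₁, ← e₂] at hP'
    obtain ⟨a1, a2, a3, a4⟩ := ihS (p + 1) P₁
    rw [← e₂] at a1 a2 a3 a4
    simp only [run, step, if_true] at e₁
    have c1 : P₁.sp = P.sp + 1 := by rw [e₁]
    have hr : P₂.stk (P₂.sp - 1) = p := by
      rw [a1, c1, a2 _ (by omega), e₁]; simp
    have h40 : (4 : ℕ) ≠ 0 := by omega
    have h41 : (4 : ℕ) ≠ 1 := by omega
    have h45 : (4 : ℕ) < 5 := by omega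
    simp only [run, step, if_true, one_ne_zero, if_false, h40, h41, h45, hr] at hP'
    have hSl := length_pos S
    have k3 : ∀ x, x ≠ p → x ≠ p + S.written.length + 1 → x ≠ p + S.written.length + 2 →
        P'.kind x = P₂.kind x ∧ P'.sec x = P₂.sec x := by
      intro x h0 h1 h2
      simp only [hP']
      rw [Function.update_of_ne (by omega), Function.update_of_ne (by omega),
        Function.update_of_ne (by omega), Function.update_of_ne (by omega)]
      exact ⟨rfl, rfl⟩
    refine ⟨by rw [hP']; simp only; omega, fun k hk => ?_, fun x hx => ⟨?_, ?_⟩, ?_, ?_, ?_, ?_⟩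
    · rw [hP']; simp only
      rw [a2 k (by omega), e₁]
      simp only
      rw [Function.update_of_ne (by omega)]
    · rw [(k3 x (by omega) (by omega) (by omega)).1, (a3 x (by omega)).1, e₁]
      simp only
      rw [Function.update_of_ne (by omega)]
    · rw [(k3 x (by omega) (by omega) (by omega)).2, (a3 x (by omega)).2, e₁]
    · rw [hP']; simp
    · simp only [hP', Function.update_apply]
      rw [if_neg (by omega), if_neg (by omega), if_pos (by omega)]
    · simp only [hP', Function.update_apply]
      rw [if_neg (by omega), if_pos (by omega)]
    · exact a4.congr fun x hx hx' => k3 x (by omega) (by omega) (by omega)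

/-- Bounds on the state of the parser after `i` symbols. -/
structure Parser.Bounds (P : Parser) (i : ℕ) : Prop where
  sp_le : P.sp ≤ i
  r_le : P.r ≤ i
  stk_le : ∀ k, P.stk k ≤ i
  sec_le : ∀ k, P.sec k ≤ i + 1
  lt_sec : ∀ k, P.kind k = 2 ∨ P.kind k = 3 → k < P.sec k

theorem Parser.Bounds.step {P : Parser} {i : ℕ} (h : P.Bounds i) (x : ℕ) :
    (P.step x i).Bounds (i + 1) := by
  obtain ⟨h1, h2, h3, h4, h5⟩ := h
  unfold Parser.step
  split_ifs with c1 c2 c3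
  · refine ⟨by simp; omega, by simp; omega, fun k => ?_, fun k => by have := h4 k; simp; omega,
      fun k => ?_⟩ <;> simp only [Function.update_apply] <;> split_ifs
    · omega
    · have := h3 k; omega
    · intro h; simp at h
    · exact h5 k
  · refine ⟨by simp; omega, by have := h3 (P.sp - 1); simp; omega,
      fun k => by have := h3 k; simp; omega, fun k => by have := h4 k; simp; omega,
      fun k => ?_⟩
    simp only [Function.update_apply]; split_ifs
    · intro h; simp at h
    · exact h5 k
  · refine ⟨by simp; omega, by simp; omega,
      fun k => by have := h3 k; simp; omega, fun k => ?_, fun k => ?_⟩ <;>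
      simp only [Function.update_apply] <;> split_ifs with h6
    · omega
    · have := h4 k; omega
    · intro _; omega
    · intro h; simp at h
    · exact h5 k
  · refine ⟨by simp; omega, by simp; omega,
      fun k => by have := h3 k; simp; omega, fun k => by have := h4 k; simp; omega,
      fun k => ?_⟩
    simp only [Function.update_apply]; split_ifs
    · intro h; omega
    · exact h5 k

theorem Parser.Bounds.run {P : Parser} {i : ℕ} (h : P.Bounds i) (l : List ℕ) :
    (P.run l i).Bounds (i + l.length) := by
  induction l generalizing P i with
  | nil => exact h
  | cons x l ih =>
    have := ih (h.step x)
    rw [show i + 1 + l.length = i + (x :: l).length by simp; omega] at this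
    exact this

/-- The value of the nullability table at `p`, computed from its values further to the right. -/
def nulVal (kind sec nul : ℕ → ℕ) (p : ℕ) : ℕ :=
  if kind p = 2 then if nul (p + 1) = 1 then nul (sec p) else 0
  else if kind p = 3 then if nul (p + 1) = 1 then 1 else nul (sec p)
  else if kind p = 4 then 1
  else if kind p = 6 then 1
  else 0

/-- The upward edges into the end of the subexpression that begins at `p`. -/
def finAt (kind sec nul : ℕ → ℕ) (p : ℕ) : List (ℕ × ℕ) :=
  if kind p = 2 then
    (2 * sec p, 2 * p) :: if nul (sec p) = 1 then [(2 * (p + 1), 2 * p)] else []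
  else if kind p = 3 then [(2 * (p + 1), 2 * p), (2 * sec p, 2 * p)]
  else if kind p = 4 then [(2 * (p + 1), 2 * p)]
  else []

/-- The edges from the beginning, and between the operands, of the subexpression that begins at
`p`. -/
def inAt (kind sec nul : ℕ → ℕ) (p : ℕ) : List (ℕ × ℕ) :=
  if kind p = 2 then
    (2 * p + 1, 2 * (p + 1) + 1) :: (2 * (p + 1), 2 * sec p + 1) ::
      if nul (p + 1) = 1 then [(2 * p + 1, 2 * sec p + 1)] else []
  else if kind p = 3 then [(2 * p + 1, 2 * (p + 1) + 1), (2 * p + 1, 2 * sec p + 1)]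
  else if kind p = 4 then [(2 * p + 1, 2 * (p + 1) + 1), (2 * (p + 1), 2 * (p + 1) + 1)]
  else []

section Tables
variable {kind sec nul : ℕ → ℕ}

theorem Parsed.nul_iff {R : RegularExpression (Fin σ)} {p : ℕ} (h : Parsed kind sec R p)
    (hn : ∀ x, p ≤ x → x < p + R.written.length → nul x = nulVal kind sec nul x) :
    nul p = 1 ↔ R.matchEpsilon = true := by
  have h0 := hn p le_rfl (by have := length_pos R; omega)
  induction R generalizing p with
  | zero => simp only [Parsed] at h; simp [h0, nulVal, h, matchEpsilon]
  | epsilon => simp only [Parsed] at h; simp [h0, nulVal, h, matchEpsilon]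
  | char a =>
    simp only [Parsed] at h
    rw [h0, nulVal, if_neg (by omega), if_neg (by omega), if_neg (by omega), if_neg (by omega)]
    simp [matchEpsilon]
  | comp S T ihS ihT =>
    simp only [comp_def, length_comp] at hn
    obtain ⟨h1, h2, -, -, -, -, h7, h8⟩ := h
    have gS := ihS h7 (fun x hx hx' => hn x (by omega) (by omega))
      (hn _ (by omega) (by omega))
    have gT := ihT h8 (fun x hx hx' => hn x (by omega) (by omega))
      (hn _ (by omega) (by have := length_pos T; omega))
    simp only [h0, nulVal, h1, if_true, h2, matchEpsilon, Bool.and_eq_true, ← gS, ← gT]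
    split_ifs <;> simp_all
  | plus S T ihS ihT =>
    simp only [plus_def, length_plus] at hn
    obtain ⟨h1, h2, -, -, -, -, h7, h8⟩ := h
    have gS := ihS h7 (fun x hx hx' => hn x (by omega) (by omega))
      (hn _ (by omega) (by omega))
    have gT := ihT h8 (fun x hx hx' => hn x (by omega) (by omega))
      (hn _ (by omega) (by have := length_pos T; omega))
    simp only [h0, nulVal, h1, if_true, h2, matchEpsilon, Bool.or_eq_true, ← gS, ← gT]
    by_cases hS : nul (p + 1) = 1 <;> simp [hS]
  | star S ihS => simp [h0, nulVal, h.1, matchEpsilon]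

theorem range'_binary (p a b : ℕ) : List.range' p (a + b + 5) = p :: (List.range' (p + 1) a ++
    (p + a + 1) :: (p + a + 2) :: (p + a + 3) :: (List.range' (p + a + 4) b ++
      [p + a + 4 + b])) := by
  rw [show a + b + 5 = 1 + (a + (3 + (b + 1))) by omega, ← List.range'_append_1,
    ← List.range'_append_1, ← List.range'_append_1, ← List.range'_append_1]
  simp [List.range'_succ]
  omega

theorem range'_unary (p a : ℕ) : List.range' p (a + 3) = p :: (List.range' (p + 1) a ++
    [p + a + 1, p + a + 2]) := by
  rw [show a + 3 = 1 + (a + 2) by omega, ← List.range'_append_1, ← List.range'_append_1]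
  simp [List.range'_succ]
  omega

theorem finAt_zero {x : ℕ} (h : kind x = 0) : finAt kind sec nul x = [] := by simp [finAt, h]

theorem inAt_zero {x : ℕ} (h : kind x = 0) : inAt kind sec nul x = [] := by simp [inAt, h]

theorem Parsed.finE_eq {R : RegularExpression (Fin σ)} {p : ℕ} (h : Parsed kind sec R p)
    (hn : ∀ x, p ≤ x → x < p + R.written.length → nul x = nulVal kind sec nul x) :
    (List.range' p R.written.length).reverse.flatMap (finAt kind sec nul) = finE R p := by
  induction R generalizing p with
  | zero => simp only [Parsed] at h; simp [finAt, h, finE]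
  | epsilon => simp only [Parsed] at h; simp [finAt, h, finE]
  | char a =>
    simp only [Parsed] at h
    have h2 : kind p ≠ 2 := by omega
    have h3 : kind p ≠ 3 := by omega
    have h4 : kind p ≠ 4 := by omega
    simp [finAt, h2, h3, h4, finE]
  | comp S T ihS ihT =>
    simp only [comp_def, length_comp] at hn
    obtain ⟨h1, h2, h3, h4, h5, h6, h7, h8⟩ := h
    have gS := ihS h7 (fun x hx hx' => hn x (by omega) (by omega))
    have gT := ihT h8 (fun x hx hx' => hn x (by omega) (by omega))
    have nT := h8.nul_iff (fun x hx hx' => hn x (by omega) (by omega))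
    simp only [comp_def, length_comp]
    rw [range'_binary]
    simp only [List.reverse_cons, List.reverse_append, List.flatMap_append, List.flatMap_cons,
      List.flatMap_nil, List.append_nil, finAt_zero h3, finAt_zero h4, finAt_zero h5,
      finAt_zero h6, gS, gT, List.nil_append, List.append_assoc, List.reverse_nil]
    rw [← comp_def, finE, finAt, if_pos h1, h2]
    simp only [nT]
  | plus S T ihS ihT =>
    simp only [plus_def, length_plus] at hn
    obtain ⟨h1, h2, h3, h4, h5, h6, h7, h8⟩ := h
    have gS := ihS h7 (fun x hx hx' => hn x (by omega) (by omega))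
    have gT := ihT h8 (fun x hx hx' => hn x (by omega) (by omega))
    simp only [plus_def, length_plus]
    rw [range'_binary]
    simp only [List.reverse_cons, List.reverse_append, List.flatMap_append, List.flatMap_cons,
      List.flatMap_nil, List.append_nil, finAt_zero h3, finAt_zero h4, finAt_zero h5,
      finAt_zero h6, gS, gT, List.nil_append, List.append_assoc, List.reverse_nil]
    rw [← plus_def, finE, finAt, if_neg (by omega), if_pos h1, h2]
  | star S ihS =>
    simp only [length_star] at hn
    obtain ⟨h1, h3, h4, h7⟩ := h
    have gS := ihS h7 (fun x hx hx' => hn x (by omega) (by omega))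
    simp only [length_star]
    rw [range'_unary]
    simp only [List.reverse_cons, List.reverse_append, List.flatMap_append, List.flatMap_cons,
      List.flatMap_nil, List.append_nil, finAt_zero h3, finAt_zero h4,
      gS, List.nil_append, List.append_assoc, List.reverse_nil]
    rw [finE, finAt, if_neg (by omega), if_neg (by omega), if_pos h1]

theorem Parsed.inE_eq {R : RegularExpression (Fin σ)} {p : ℕ} (h : Parsed kind sec R p)
    (hn : ∀ x, p ≤ x → x < p + R.written.length → nul x = nulVal kind sec nul x) :
    (List.range' p R.written.length).flatMap (inAt kind sec nul) = inE R p := by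
  induction R generalizing p with
  | zero => simp only [Parsed] at h; simp [inAt, h, inE]
  | epsilon => simp only [Parsed] at h; simp [inAt, h, inE]
  | char a =>
    simp only [Parsed] at h
    have h2 : kind p ≠ 2 := by omega
    have h3 : kind p ≠ 3 := by omega
    have h4 : kind p ≠ 4 := by omega
    simp [inAt, h2, h3, h4, inE]
  | comp S T ihS ihT =>
    simp only [comp_def, length_comp] at hn
    obtain ⟨h1, h2, h3, h4, h5, h6, h7, h8⟩ := h
    have gS := ihS h7 (fun x hx hx' => hn x (by omega) (by omega))
    have gT := ihT h8 (fun x hx hx' => hn x (by omega) (by omega))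
    have nS := h7.nul_iff (fun x hx hx' => hn x (by omega) (by omega))
    simp only [comp_def, length_comp]
    rw [range'_binary]
    simp only [List.flatMap_append, List.flatMap_cons,
      List.flatMap_nil, List.append_nil, inAt_zero h3, inAt_zero h4, inAt_zero h5,
      inAt_zero h6, gS, gT, List.nil_append]
    rw [← comp_def, inE, inAt, if_pos h1, h2]
    simp only [nS]
  | plus S T ihS ihT =>
    simp only [plus_def, length_plus] at hn
    obtain ⟨h1, h2, h3, h4, h5, h6, h7, h8⟩ := h
    have gS := ihS h7 (fun x hx hx' => hn x (by omega) (by omega))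
    have gT := ihT h8 (fun x hx hx' => hn x (by omega) (by omega))
    simp only [plus_def, length_plus]
    rw [range'_binary]
    simp only [List.flatMap_append, List.flatMap_cons,
      List.flatMap_nil, List.append_nil, inAt_zero h3, inAt_zero h4, inAt_zero h5,
      inAt_zero h6, gS, gT, List.nil_append]
    rw [← plus_def, inE, inAt, if_neg (by omega), if_pos h1, h2]
  | star S ihS =>
    simp only [length_star] at hn
    obtain ⟨h1, h3, h4, h7⟩ := h
    have gS := ihS h7 (fun x hx hx' => hn x (by omega) (by omega))
    simp only [length_star]
    rw [range'_unary]
    simp only [List.flatMap_append, List.flatMap_cons,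
      List.flatMap_nil, List.append_nil, inAt_zero h3, inAt_zero h4, gS]
    rw [inE, inAt, if_neg (by omega), if_neg (by omega), if_pos h1]

theorem Parsed.mem_letters_iff {R : RegularExpression (Fin σ)} {p : ℕ} (h : Parsed kind sec R p)
    (x : ℕ) (a : Fin σ) :
    (x, a) ∈ letters R p ↔ p ≤ x ∧ x < p + R.written.length ∧ kind x = 7 + a := by
  induction R generalizing p with
  | zero | epsilon =>
    simp only [Parsed] at h
    simp [letters]
    intro h1 h2
    obtain rfl : x = p := by omega
    omega
  | char b =>
    simp only [Parsed] at h
    simp only [letters, List.mem_singleton, Prod.mk.injEq, length_char]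
    constructor
    · rintro ⟨rfl, rfl⟩; exact ⟨le_rfl, by omega, h⟩
    · rintro ⟨h1, h2, h3⟩
      obtain rfl : x = p := by omega
      exact ⟨rfl, Fin.ext (by omega)⟩
  | comp S T ihS ihT | plus S T ihS ihT =>
    obtain ⟨h1, h2, h3, h4, h5, h6, h7, h8⟩ := h
    simp only [letters, List.mem_append, ihS h7, ihT h8, comp_def, plus_def, length_comp,
      length_plus]
    constructor
    · omega
    · rintro ⟨g1, g2, g3⟩
      have e : ∀ y, kind y = 0 ∨ kind y = 2 ∨ kind y = 3 → x ≠ y := by rintro y hy rfl; omega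
      have := e _ (.inl h3)
      have := e _ (.inl h4)
      have := e _ (.inl h5)
      have := e _ (.inl h6)
      have := e p (by omega)
      omega
  | star S ihS =>
    obtain ⟨h1, h3, h4, h7⟩ := h
    simp only [letters, ihS h7, length_star]
    constructor
    · omega
    · rintro ⟨g1, g2, g3⟩
      have e : ∀ y, kind y = 0 ∨ kind y = 4 → x ≠ y := by rintro y hy rfl; omega
      have := e _ (.inl h3)
      have := e _ (.inl h4)
      have := e p (by omega)
      omega

end Tables

end RegexMatch

/-! ### Sweeps over the position automaton -/

namespace RegexMatch

open WordRAM

instance : Coe Var Expr := ⟨Expr.var⟩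

infixl:65 " +ₑ " => Expr.add
infixl:65 " -ₑ " => Expr.sub
infixl:70 " *ₑ " => Expr.mul
infixl:70 " /ₑ " => Expr.div

variable {A : ℕ} {E : Env} {R : RegularExpression (Fin A)}

/-- The two stores agree on the given variables and arrays. -/
structure Agree (vs : List Var) (as : List Arr) (σ σ' : Store) : Prop where
  var : ∀ v ∈ vs, σ'.var v = σ.var v
  arr : ∀ a ∈ as, σ'.arr a = σ.arr a

/-- The command assigns to none of the given variables and arrays. -/
def Keeps (vs : List Var) (as : List Arr) (c : Cmd) : Bool :=
  vs.all (fun v => !c.setsVar v) && as.all fun a => !c.setsArr a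

theorem agree_of_frame {vs : List Var} {as : List Arr} {c : Cmd} {σ σ' : Store}
    (h : c.Frame σ σ') (hk : Keeps vs as c = true) : Agree vs as σ σ' := by
  simp [Keeps] at hk
  exact ⟨fun v hv => h.var v (hk.1 v hv), fun a ha => h.arr a (hk.2 a ha)⟩

/-- The array `a` holds the characteristic vector of a set of numbers below `N`. -/
def Vec (a : Arr) (N : ℕ) (S : Set ℕ) (σ : Store) : Prop :=
  (∀ t < N, σ.arr a t = 1 ↔ t ∈ S) ∧ ∀ t ∈ S, t < N

/-- The arrays `src` and `dst` hold the list `L` of edges. -/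
def EdgeArr (src dst : Arr) (L : List (ℕ × ℕ)) (σ : Store) : Prop :=
  ∀ (k : ℕ) (h : k < L.length), σ.arr src k = L[k].1 ∧ σ.arr dst k = L[k].2

/-- Replace the set in `X` by its image under the paths along the edges in `src` and `dst`. -/
def relax (src dst : Arr) : Cmd :=
  .count .k .ec (.ite (.eq (.arr .X (.arr src Var.k)) (.lit 1))
    (.aset .X (.arr dst Var.k) (.lit 1)) .skip)

theorem relax_spec {src dst : Arr} {L : List (ℕ × ℕ)} {N : ℕ} {S : Set ℕ} {σ : Store}
    (hs : src ≠ .X) (hd : dst ≠ .X) (hec : σ.var .ec = L.length) (hL : EdgeArr src dst L σ)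
    (hlt : ∀ e ∈ L, e.1 < N ∧ e.2 < N) (hN : N ≤ E.M) (hM : L.length ≤ E.M)
    (hX : Vec .X N S σ) :
    Run E (relax src dst) σ fun σ' => Vec .X N {j | ∃ i ∈ S, Path L i j} σ' ∧
      σ'.time ≤ σ.time + (L.length * 40 + 5) := by
  refine (Run.countConst (fun k σ' => Vec .X N {j | ∃ i ∈ S, Path (L.take k) i j} σ') 33 hec
    (by decide) rfl rfl (fun _ _ _ _ h => h) (fun _ _ _ h => h) ?_ ?_).conseq
    fun σ' _ _ h => ⟨by simpa using h.1, h.2⟩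
  · simpa [Path] using hX
  · intro k hk σ' hF hvk _ hI
    have h1 : σ'.arr src = σ.arr src := hF.arr src (by
      simp [Cmd.count, Cmd.setsArr, hs])
    have h2 : σ'.arr dst = σ.arr dst := hF.arr dst (by
      simp [Cmd.count, Cmd.setsArr, hd])
    have h3 := hlt _ (List.getElem_mem hk)
    have h4 := E.one_lt
    have hnew : ∀ j, (∃ i ∈ S, Path (L.take (k + 1)) i j) ↔
        (∃ i ∈ S, Path (L.take k) i j) ∨ (j = L[k].2 ∧ ∃ i ∈ S, Path (L.take k) i L[k].1) := by
      intro j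
      simp only [List.take_succ_eq_append_getElem hk, path_append, Path]
      grind
    refine Run.intro fun hb => ?_
    simp only [Cmd.wp, Expr.Safe, Expr.eval, Cond.Safe, Cond.Holds, hvk, h1, h2, hL k hk,
      Store.tick_var, Store.tick_arr]
    refine ⟨⟨⟨⟨trivial, by omega⟩, by omega⟩, trivial⟩, fun hh => ⟨trivial, ⟨trivial, by omega⟩,
      by omega, h4, ⟨?_, ?_⟩, by simp⟩, fun hh => ⟨⟨?_, ?_⟩, by simp⟩⟩
    · intro t ht
      simp only [Store.aset_arr, if_true, Function.update_apply, Store.tick_arr, Set.mem_ofPred_eq,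
        hnew]
      have := hI.1 t ht
      have := (hI.1 _ h3.1).1 hh
      split_ifs with htk
      · exact ⟨fun _ => .inr ⟨htk, this⟩, fun _ => rfl⟩
      · simp_all
    · rintro t ht
      rcases (hnew t).1 ht with h | ⟨rfl, -⟩
      · exact hI.2 t h
      · exact h3.2
    · intro t ht
      simp only [Store.tick_arr, Set.mem_ofPred_eq, hnew]
      have := hI.1 t ht
      have := hI.1 _ h3.1
      simp_all
    · rintro t ht
      rcases (hnew t).1 ht with h | ⟨rfl, -⟩
      · exact hI.2 t h
      · exact h3.2

/-- Let the set in `X` read the symbol in the variable `lab`; `o` and `o'` are the offsets of the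
slots that characters are read from and lead to. -/
def letter (o o' : ℕ) : Cmd :=
  .tmp ::= .arr .X (.lit 1) ;;
  .count .k .m (
    .ite (.eq (.arr .kind Var.k) Var.lab)
      (.aset .X (.lit 2 *ₑ Var.k +ₑ .lit o') (.arr .X (.lit 2 *ₑ Var.k +ₑ .lit o)))
      (.aset .X (.lit 2 *ₑ Var.k +ₑ .lit o') (.lit 0)) ;;
    .aset .X (.lit 2 *ₑ Var.k +ₑ .lit o) (.lit 0)) ;;
  .ite (.eq Var.tmp (.lit 1)) (.aset .X (.lit 1) (.lit 1)) .skip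

theorem letter_spec {o o' m : ℕ} {S : Set ℕ} {σ : Store} (ho : o + o' = 1)
    (hm : σ.var .m = m) (hm0 : 0 < m) (hM : 2 * m ≤ E.M) (hX : Vec .X (2 * m) S σ) :
    Run E (letter o o') σ fun σ' => Vec .X (2 * m)
      {j | (∃ x < m, σ.arr .kind x = σ.var .lab ∧ 2 * x + o ∈ S ∧ j = 2 * x + o') ∨
        (1 ∈ S ∧ j = 1)} σ' ∧ σ'.time ≤ σ.time + (m * 60 + 30) := by
  have h0 := E.one_lt
  refine Run.intro fun hb => ?_
  simp only [letter, Cmd.wp, Expr.Safe, Expr.eval, Cmd.wp_count]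
  refine ⟨⟨trivial, by omega⟩, hb.2 _ _, ?_⟩
  refine (Run.countConst (fun k σ' => ∀ t < 2 * m, σ'.arr .X t = 1 ↔ if t / 2 < k then
    t % 2 = o' ∧ σ.arr .kind (t / 2) = σ.var .lab ∧ 2 * (t / 2) + o ∈ S else t ∈ S) 50
    (H := m) (by simpa using hm)
    (by decide) rfl rfl (fun _ _ _ _ h => h) (fun _ _ _ h => h) ?_ ?_).conseq ?_
  · simpa using hX.1
  · intro k hk σ' hF hvk _ hI
    have h1 : σ'.arr .kind = σ.arr .kind := hF.arr .kind rfl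
    have h2 : σ'.var .lab = σ.var .lab := hF.var .lab rfl
    have hso : 2 * k + o ∈ S ↔ σ'.arr .X (2 * k + o) = 1 := by
      rw [hI _ (by omega), if_neg (by omega)]
    refine Run.intro fun hb' => ?_
    simp only [Cmd.wp, Expr.Safe, Expr.eval, Cond.Safe, Cond.Holds, hvk, h1, h2,
      Store.tick_var, Store.tick_arr, Store.aset_var]
    refine ⟨by simp; omega, fun hh => ⟨by simp; omega, by simp, by omega, hb'.2 _ _, by simp,
      by simp, by omega, by omega, ?_, by simp⟩, fun hh => ⟨by simp, by simp, by omega, by omega,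
      by simp, by simp, by omega, by omega, ?_, by simp⟩⟩
    · intro t ht
      simp only [Store.aset_arr, if_true, Function.update_apply, Store.tick_arr]
      have := hI t ht
      split_ifs with c1 c2 c3 c4 c5
      · simp; omega
      · omega
      · subst c3
        have e1 : (2 * k + o') / 2 = k := by omega
        have e2 : (2 * k + o') % 2 = o' := by omega
        simp [e1, e2, hh, hso]
      · omega
      · rw [this, if_pos (by omega)]
      · rw [this, if_neg (by omega)]
    · intro t ht
      simp only [Store.aset_arr, if_true, Function.update_apply, Store.tick_arr]
      have := hI t ht
      split_ifs with c1 c2 c3 c4 c5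
      · simp; omega
      · omega
      · subst c3
        have e1 : (2 * k + o') / 2 = k := by omega
        simp [e1, hh]
      · omega
      · rw [this, if_pos (by omega)]
      · rw [this, if_neg (by omega)]
  · intro σ' hb' hF ⟨hI, ht⟩
    have h2 : σ'.var .tmp = σ.arr .X 1 := by rw [hF.var .tmp rfl]; simp
    have h1S := hX.1 1 (by omega)
    have key : ∀ t < 2 * m, (t % 2 = o' ∧ σ.arr .kind (t / 2) = σ.var .lab ∧ 2 * (t / 2) + o ∈ S) ↔
        ∃ x < m, σ.arr .kind x = σ.var .lab ∧ 2 * x + o ∈ S ∧ t = 2 * x + o' := by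
      intro t ht
      constructor
      · rintro ⟨h1, h2, h3⟩; exact ⟨t / 2, by omega, h2, h3, by omega⟩
      · rintro ⟨x, h1, h2, h3, rfl⟩
        have e1 : (2 * x + o') / 2 = x := by omega
        rw [e1]; exact ⟨by omega, h2, h3⟩
    have hlt : ∀ t, ((∃ x < m, σ.arr .kind x = σ.var .lab ∧ 2 * x + o ∈ S ∧ t = 2 * x + o') ∨
        (1 ∈ S ∧ t = 1)) → t < 2 * m := by
      rintro t (⟨x, h1, -, -, rfl⟩ | ⟨-, rfl⟩) <;> omega
    simp only [Cond.Safe, Cond.Holds, Expr.Safe, Expr.eval, h2, Expr.cost, Cond.cost]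
    simp only [Store.set_time, Expr.cost] at ht
    refine ⟨by simp, fun hh => ⟨trivial, trivial, by omega, h0, ⟨?_, hlt⟩, by simp; omega⟩,
      fun hh => ⟨⟨?_, hlt⟩, by simp; omega⟩⟩
    · intro t ht'
      simp only [Store.aset_arr, if_true, Function.update_apply, Store.tick_arr, Set.mem_ofPred_eq]
      have := hI t ht'
      rw [if_pos (by omega), key t ht'] at this
      split_ifs with c
      · simp [c, h1S.1 hh]
      · rw [this]; simp [c]
    · intro t ht'
      simp only [Store.tick_arr, Set.mem_ofPred_eq]
      have := hI t ht'
      rw [if_pos (by omega), key t ht'] at this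
      rw [this]
      simp [← h1S, hh]

/-- The store holds the position automaton of `R`, forwards and backwards. -/
structure Auto (R : RegularExpression (Fin A)) (σ : Store) : Prop where
  m : σ.var .m = R.written.length
  N : σ.var .N = 2 * R.written.length
  ec : σ.var .ec = (edges R).length
  fwd : EdgeArr .fsrc .fdst (edges R) σ
  bwd : EdgeArr .bsrc .bdst ((edges R).map Prod.swap).reverse σ
  kind : ∀ x < R.written.length, ∀ a : Fin A, σ.arr .kind x = 7 + a ↔ (x, a) ∈ letters R 0
  len : (edges R).length ≤ 5 * R.written.length

theorem Auto.agree {σ σ' : Store} (h : Auto R σ)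
    (hA : Agree [.m, .N, .ec] [.fsrc, .fdst, .bsrc, .bdst, .kind] σ σ') : Auto R σ' := by
  have hv := hA.var
  have ha := hA.arr
  simp at hv ha
  obtain ⟨v1, v2, v3⟩ := hv
  obtain ⟨a1, a2, a3, a4, a5⟩ := ha
  exact ⟨v1 ▸ h.m, v2 ▸ h.N, v3 ▸ h.ec, by unfold EdgeArr; rw [a1, a2]; exact h.fwd,
    by unfold EdgeArr; rw [a3, a4]; exact h.bwd, by rw [a5]; exact h.kind, h.len⟩

theorem Auto.frame {σ σ' : Store} {c : Cmd} (h : Auto R σ) (hF : c.Frame σ σ')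
    (hk : Keeps [.m, .N, .ec] [.fsrc, .fdst, .bsrc, .bdst, .kind] c = true) : Auto R σ' :=
  h.agree (agree_of_frame hF hk)

/-- One step of the automaton. -/
def stepF : Cmd := .block (relax .fsrc .fdst ;; letter 1 0)

/-- One step of the automaton, backwards. -/
def stepB : Cmd := .block (letter 0 1 ;; relax .bsrc .bdst)

theorem wp_stepF (Q : Store → Prop) (σ : Store) : stepF.wp E Q σ = Run E stepF σ Q := rfl

theorem wp_stepB (Q : Store → Prop) (σ : Store) : stepB.wp E Q σ = Run E stepB σ Q := rfl

theorem swap_lt {e : ℕ × ℕ} (he : e ∈ ((edges R).map Prod.swap).reverse) :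
    e.1 < 2 * R.written.length ∧ e.2 < 2 * R.written.length := by
  simp only [List.mem_reverse, List.mem_map] at he
  obtain ⟨f, hf, rfl⟩ := he
  exact (edges_range R f hf).symm

theorem relaxB_spec {S : Set ℕ} {σ : Store} (hA : Auto R σ)
    (hM : 5 * R.written.length ≤ E.M) (hX : Vec .X (2 * R.written.length) S σ) :
    Run E (relax .bsrc .bdst) σ fun σ' =>
      Vec .X (2 * R.written.length) {i | ∃ j ∈ S, Path (edges R) i j} σ' ∧
      σ'.time ≤ σ.time + (R.written.length * 200 + 5) := by
  have hl := hA.len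
  refine (relax_spec (by decide) (by decide) (by simpa using hA.ec) hA.bwd (fun e he => swap_lt he)
    (by omega) (by simp; omega) hX).conseq fun σ' _ _ h => ?_
  simp only [path_swap, List.length_reverse, List.length_map] at h
  exact ⟨h.1, by omega⟩

theorem stepF_spec {S : Set ℕ} {σ : Store} {a : Fin A} (hA : Auto R σ) (ha : σ.var .lab = 7 + a)
    (hM : 5 * R.written.length ≤ E.M) (hX : Vec .X (2 * R.written.length) S σ) :
    Run E stepF σ fun σ' => Vec .X (2 * R.written.length) {j | ∃ i ∈ S, Step R a i j} σ' ∧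
      σ'.time ≤ σ.time + R.written.length * 300 := by
  have hl := hA.len
  have hp := length_pos R
  refine Run.block (Run.seq ?_)
  refine (relax_spec (by decide) (by decide) hA.ec hA.fwd (fun e he => edges_range R e he)
    (by omega) (by omega) hX).conseq fun σ₁ _ hF h => ?_
  have hA₁ := hA.frame hF rfl
  have ha₁ : σ₁.var .lab = 7 + a := by rw [hF.var .lab rfl, ha]
  refine (letter_spec rfl hA₁.m hp (by omega) h.1).conseq fun σ₂ _ _ h₂ => ⟨?_, by omega⟩
  convert h₂.1 using 1
  ext j
  rw [ha₁]
  constructor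
  · rintro ⟨i, hi, k, hk, ⟨x, hx, rfl, rfl⟩ | ⟨rfl, rfl⟩⟩
    · have := letters_range R 0 _ hx
      simp at this
      exact .inl ⟨x, this, (hA₁.kind x this a).2 hx, ⟨i, hi, hk⟩, rfl⟩
    · exact .inr ⟨⟨i, hi, hk⟩, rfl⟩
  · rintro (⟨x, h1, h2, ⟨i, hi, hk⟩, rfl⟩ | ⟨⟨i, hi, hk⟩, rfl⟩)
    · exact ⟨i, hi, _, hk, .inl ⟨x, (hA₁.kind x h1 a).1 h2, rfl, rfl⟩⟩
    · exact ⟨i, hi, 1, hk, .inr ⟨rfl, rfl⟩⟩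

theorem stepB_spec {S : Set ℕ} {σ : Store} {a : Fin A} (hA : Auto R σ) (ha : σ.var .lab = 7 + a)
    (hM : 5 * R.written.length ≤ E.M) (hX : Vec .X (2 * R.written.length) S σ) :
    Run E stepB σ fun σ' => Vec .X (2 * R.written.length) {i | ∃ j ∈ S, Step R a i j} σ' ∧
      σ'.time ≤ σ.time + R.written.length * 300 := by
  have hp := length_pos R
  refine Run.block (Run.seq ?_)
  refine (letter_spec rfl hA.m hp (by omega) hX).conseq fun σ₁ _ hF h => ?_
  have hA₁ := hA.frame hF rfl
  refine (relaxB_spec hA₁ hM h.1).conseq fun σ₂ _ _ h₂ => ⟨?_, by omega⟩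
  convert h₂.1 using 1
  ext i
  rw [ha]
  constructor
  · rintro ⟨j, hj, k, hk, ⟨x, hx, rfl, rfl⟩ | ⟨rfl, rfl⟩⟩
    · have := letters_range R 0 _ hx
      simp at this
      exact ⟨_, .inl ⟨x, this, (hA.kind x this a).2 hx, hj, rfl⟩, hk⟩
    · exact ⟨1, .inr ⟨hj, rfl⟩, hk⟩
  · rintro ⟨k, ⟨x, h1, h2, hj, rfl⟩ | ⟨hj, rfl⟩, hk⟩
    · exact ⟨_, hj, _, hk, .inl ⟨x, (hA.kind x h1 a).1 h2, rfl, rfl⟩⟩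
    · exact ⟨1, hj, 1, hk, .inr ⟨rfl, rfl⟩⟩

end RegexMatch

/-! ### Walks in the trie -/

namespace RegexMatch

open WordRAM

variable {A : ℕ} {E : Env} {R : RegularExpression (Fin A)} {n : ℕ} {str : ℕ → List (Fin A)}

/-- The store holds the trie with the node words `str`. -/
structure Trie (n : ℕ) (str : ℕ → List (Fin A)) (σ : Store) : Prop where
  isTrie : IsTrie A n (σ.arr .par) (σ.arr .chr) str
  dep : ∀ v ≤ n, σ.arr .dep v = (str v).length
  n : σ.var .n = n

theorem Trie.frame {σ σ' : Store} {c : Cmd} (h : Trie n str σ) (hF : c.Frame σ σ')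
    (hk : Keeps [.n] [.par, .chr, .dep] c = true) : Trie n str σ' := by
  have hv := (agree_of_frame hF hk).var
  have ha := (agree_of_frame hF hk).arr
  simp at hv ha
  obtain ⟨a1, a2, a3⟩ := ha
  exact ⟨by rw [a1, a2]; exact h.isTrie, by rw [a3]; exact h.dep, hv ▸ h.n⟩

/-- The stack holds a word, the first character on top. -/
def StackHolds : List (Fin A) → (ℕ → ℕ) → Prop
  | [], _ => True
  | a :: u, f => f u.length = 7 + a ∧ StackHolds u f

theorem StackHolds.update {u : List (Fin A)} {f : ℕ → ℕ} (h : StackHolds u f) {k : ℕ}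
    (hk : u.length ≤ k) (x : ℕ) : StackHolds u (Function.update f k x) := by
  induction u with
  | nil => trivial
  | cons a u ih =>
    simp at hk
    exact ⟨by rw [Function.update_of_ne (by omega)]; exact h.1, ih h.2 (by omega)⟩

theorem StackHolds.getElem {u : List (Fin A)} {f : ℕ → ℕ} (h : StackHolds u f) (k : ℕ)
    (hk : k < u.length) : f k = 7 + u[u.length - 1 - k] := by
  induction u with
  | nil => simp at hk
  | cons a u ih =>
    simp at hk
    rcases Nat.lt_or_eq_of_le hk with h1 | rfl
    · have := ih h.2 h1
      simp only [List.length_cons]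
      have e : u.length + 1 - 1 - k = (u.length - 1 - k) + 1 := by omega
      simp only [e, List.getElem_cons_succ]
      exact this
    · simp [h.1]

/-- Among `τ` consecutive numbers there is one of each residue. -/
theorem exists_residue {τ r : ℕ} (hr : r < τ) (x : ℕ) : ∃ e, x ≤ e ∧ e < x + τ ∧ e % τ = r := by
  have h1 := Nat.mod_lt x (show 0 < τ by omega)
  have h2 := Nat.div_add_mod x τ
  by_cases h : x % τ ≤ r
  · refine ⟨τ * (x / τ) + r, by omega, by omega, ?_⟩
    rw [Nat.mul_add_mod, Nat.mod_eq_of_lt hr]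
  · refine ⟨τ * (x / τ + 1) + r, ?_, ?_, ?_⟩
    · rw [mul_add]; omega
    · rw [mul_add]; omega
    · rw [Nat.mul_add_mod, Nat.mod_eq_of_lt hr]

/-- Go from the node `up` to its nearest marked ancestor-or-self, pushing the characters on the way
onto the stack. -/
def upwalk : Cmd :=
  .block (.sp ::= .lit 0 ;;
    .loop (.eq (.arr .sel Var.up) (.lit 0))
      (.aset .stk Var.sp (.arr .chr Var.up) ;;
        .sp ::= Var.sp +ₑ .lit 1 ;;
        .up ::= .arr .par Var.up))

theorem upwalk_spec {σ : Store} {v τ r : ℕ} (hT : Trie n str σ) (hv : v ≤ n)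
    (hup : σ.var .up = v) (hr : r < τ) (h0 : σ.arr .sel 0 ≠ 0)
    (hsel : ∀ u < v, u ≠ 0 → (str u).length % τ = r → σ.arr .sel u ≠ 0) (hM : n < E.M) :
    Run E upwalk σ fun σ' => (∃ u w, σ'.var .up = u ∧ u ≤ v ∧ σ.arr .sel u ≠ 0 ∧
      str v = str u ++ w ∧ w.length ≤ τ ∧ σ'.var .sp = w.length ∧
      StackHolds w (σ'.arr .stk)) ∧ σ'.time ≤ σ.time + (τ * 40 + 20) := by
  have h1 := E.one_lt
  refine Run.block (Run.intro fun hb => ?_)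
  simp only [Cmd.wp, Expr.Safe, Expr.eval]
  refine ⟨trivial, by omega, ?_⟩
  -- In the invariant, `w` is what the walk from `v` up to `u` has read, and no node strictly below
  -- `u` on the way has the selected residue.
  refine Run.loop (fun k σ' => ∃ u w, σ'.var .up = u ∧ u ≤ v ∧
      str v = str u ++ w ∧ w.length + k = τ ∧ σ'.var .sp = w.length ∧
      StackHolds w (σ'.arr .stk) ∧ σ'.arr .sel = σ.arr .sel ∧
      (∀ e, (str u).length < e → e < (str v).length → e % τ ≠ r) ∧
      σ'.time ≤ σ.time + (w.length * 40 + 10)) τ ?_ ?_ ?_ ?_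
  · exact ⟨v, [], by simpa using hup, le_rfl, by simp, by simp, by simp, trivial, rfl,
      fun e h h' => by omega, by simp⟩
  · rintro k σ' ⟨u, w, g1, g2, -⟩
    simp [g1]; omega
  · rintro k σ' hF hb' ⟨u, w, g1, g2, g3, g4, g5, g6, g7, g8, g9⟩ hh
    simp only [Cond.Holds, Expr.eval, g1, g7] at hh
    have hu0 : u ≠ 0 := by rintro rfl; exact h0 hh
    have hres : u < v → (str u).length % τ ≠ r := fun h h' => hsel u h hu0 h' hh
    have hlen : (str v).length = (str u).length + w.length := by rw [g3]; simp
    have huv : w.length ≠ 0 → u < v := by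
      intro hw
      refine lt_of_le_of_ne g2 ?_
      rintro rfl
      omega
    -- After `τ` steps some node on the way had the selected residue.
    have hk : k ≠ 0 := by
      rintro rfl
      obtain ⟨e, e1, e2, e3⟩ := exists_residue hr (str u).length
      rcases Nat.eq_or_lt_of_le e1 with rfl | e1
      · exact hres (huv (by omega)) e3
      · exact g8 e e1 (by omega) e3
    have hT' : Trie n str σ' := (hT.frame (c := .sp ::= .lit 0) (σ' := σ.set .sp 0 2)
      ⟨fun v hv => by simp [Cmd.setsVar] at hv; simp [hv], fun _ _ => rfl, fun _ => rfl⟩ rfl).frame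
        hF rfl
    have hpar := hT'.isTrie.par_lt hu0 (by omega)
    obtain ⟨i, rfl⟩ := Nat.exists_eq_add_one_of_ne_zero hu0
    obtain ⟨a, ha, hstr⟩ := hT'.isTrie.str_succ i (by omega)
    have hwl : w.length < n := by
      have := hT.isTrie.length_str_le hv
      rw [hlen, hstr, List.length_append, List.length_singleton] at this
      omega
    refine ⟨k - 1, by omega, Run.intro fun hb'' => ?_⟩
    simp only [Cmd.wp, Expr.Safe, Expr.eval, Store.tick_var, Store.tick_arr, g1, g5,
      Store.aset_var, Store.set_var, Store.aset_arr, Store.set_arr]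
    have e2 : (str (σ'.arr .par (i + 1))).length + 1 = (str (i + 1)).length := by
      rw [hstr]; simp
    have hMU := E.mem_le
    refine ⟨by simp; omega, by simp, by omega, hb''.2 _ _, by simp, by omega, by simp; omega,
      hb''.2 _ _, ⟨_, a :: w, rfl, ?_, ?_, ?_, ?_, ?_, ?_, ?_, ?_⟩, ?_⟩
    · simp; omega
    · simp [g3, hstr]
    · simp; omega
    · simp
    · exact ⟨by simp [ha], g6.update le_rfl _⟩
    · simp [g7]
    · intro e he he'
      simp at he
      by_cases hee : e = (str (i + 1)).length
      · rw [hee]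
        refine hres ?_
        refine lt_of_le_of_ne g2 ?_
        rintro rfl
        omega
      · exact g8 e (by omega) he'
    · simp; omega
    · simp; omega
  · rintro k σ' hF hb' ⟨u, w, g1, g2, g3, g4, g5, g6, g7, g8, g9⟩ hh
    simp only [Cond.Holds, Expr.eval, g1, g7] at hh
    refine ⟨⟨u, w, g1, g2, hh, g3, by omega, g5, g6⟩, ?_⟩
    have : w.length * 40 ≤ τ * 40 := by omega
    simp; omega

/-- Let the set in `X` read the word on the stack. -/
def walk : Cmd :=
  .block (.loop (.lt (.lit 0) Var.sp)
    (.sp ::= Var.sp -ₑ .lit 1 ;; .lab ::= .arr .stk Var.sp ;; stepF))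

theorem walk_spec {σ : Store} {w : List (Fin A)} {S : Set ℕ} (hA : Auto R σ)
    (hsp : σ.var .sp = w.length) (hw : StackHolds w (σ.arr .stk)) (hlw : w.length ≤ E.M)
    (hM : 5 * R.written.length ≤ E.M) (hX : Vec .X (2 * R.written.length) S σ) :
    Run E walk σ fun σ' => Vec .X (2 * R.written.length) {j | ∃ i ∈ S, Rel R w i j} σ' ∧
      σ'.time ≤ σ.time + (w.length * (R.written.length * 330) + 20) := by
  have hp := length_pos R
  refine Run.block (Run.loop (fun k σ' => ∃ u w', w = u ++ w' ∧ w'.length = k ∧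
    σ'.var .sp = k ∧ StackHolds w' (σ'.arr .stk) ∧
    Vec .X (2 * R.written.length) {j | ∃ i ∈ S, Rel R u i j} σ' ∧
    σ'.time ≤ σ.time + (u.length * (R.written.length * 330) + 10)) w.length ?_ ?_ ?_ ?_)
  · exact ⟨[], w, rfl, rfl, hsp, hw, by simpa [Rel, Vec] using hX, by simp⟩
  · rintro k σ' -
    simp
  · rintro k σ' hF hb ⟨u, w', g1, g2, g3, g4, g5, g6⟩ hh
    simp only [Cond.Holds, Expr.eval, g3] at hh
    cases w' with
    | nil => simp at g2; omega
    | cons a w' =>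
      simp at g2
      have hMU := E.mem_le
      have hk : w.length = u.length + k := by rw [g1]; simp; omega
      refine ⟨k - 1, by omega, Run.intro fun hb' => ?_⟩
      simp only [Cmd.wp, Expr.Safe, Expr.eval, Store.tick_var, Store.tick_arr, g3, wp_stepF,
        Store.set_var, Store.set_arr, if_true]
      refine ⟨by simp, by omega, by simp; omega, hb'.2 _ _, ?_⟩
      have hlab : σ'.arr .stk (k - 1) = 7 + a := by
        rw [← g4.1]; congr 1; omega
      rw [hlab]
      have hA' : Auto R σ' := hA.frame hF rfl
      refine Run.conseq (stepF_spec (a := a) (S := {j | ∃ i ∈ S, Rel R u i j})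
        (hA'.agree ⟨by simp, by simp⟩) (by simp) hM g5)
        fun σ₂ hb₂ hF₂ h₂ => ⟨⟨u ++ [a], w', by simp [g1], by omega, ?_, ?_, ?_, ?_⟩, by simp⟩
      · have : σ₂.var .sp = k - 1 := by rw [hF₂.var .sp rfl]; simp
        exact this
      · have : σ₂.arr .stk = σ'.arr .stk := by rw [hF₂.arr .stk rfl]; simp
        rw [this]; exact g4.2
      · have e : {j | ∃ i ∈ S, Rel R (u ++ [a]) i j} =
            {j | ∃ i ∈ {j | ∃ i ∈ S, Rel R u i j}, Step R a i j} := by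
          ext j
          simp only [rel_append, Rel, Set.mem_ofPred_eq]
          grind
        rw [e]
        exact h₂.1
      · have := h₂.2
        simp at this
        simp [add_mul]
        omega
  · rintro k σ' hF hb ⟨u, w', g1, g2, g3, g4, g5, g6⟩ hh
    simp only [Cond.Holds, Expr.eval, g3] at hh
    obtain rfl : w' = [] := List.eq_nil_of_length_eq_zero (by omega)
    rw [List.append_nil] at g1
    rw [g1]
    exact ⟨g5, by simp; omega⟩

/-- Let the set in `X` read the word on the stack backwards. -/
def walkB : Cmd := .count .j .sp (.lab ::= .arr .stk Var.j ;; stepB)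

theorem walkB_spec {σ : Store} {w : List (Fin A)} {S : Set ℕ} (hA : Auto R σ)
    (hsp : σ.var .sp = w.length) (hw : StackHolds w (σ.arr .stk)) (hlw : w.length ≤ E.M)
    (hM : 5 * R.written.length ≤ E.M) (hX : Vec .X (2 * R.written.length) S σ) :
    Run E walkB σ fun σ' => Vec .X (2 * R.written.length) {i | ∃ j ∈ S, Rel R w i j} σ' ∧
      σ'.time ≤ σ.time + (w.length * (R.written.length * 330) + 20) := by
  have hp := length_pos R
  refine (Run.countConst (fun k σ' => Vec .X (2 * R.written.length)
    {i | ∃ j ∈ S, Rel R (w.drop (w.length - k)) i j} σ') (R.written.length * 310) hsp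
    (by decide) rfl rfl (fun _ _ _ _ h => h) (fun _ _ _ h => h) ?_ ?_).conseq
    fun σ' _ _ h => ⟨by simpa using h.1, h.2.trans ?_⟩
  · simpa [Rel] using hX
  · intro k hk σ' hF hvk _ hI
    refine Run.intro fun hb => ?_
    have hst : σ'.arr .stk = σ.arr .stk := hF.arr .stk rfl
    have hlab := hw.getElem k hk
    simp only [Cmd.wp, Expr.Safe, Expr.eval, wp_stepB, hvk, hst]
    refine ⟨⟨trivial, by omega⟩, hst ▸ hb.2 _ _, ?_⟩
    refine Run.conseq (stepB_spec (a := w[w.length - 1 - k])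
      (S := {i | ∃ j ∈ S, Rel R (w.drop (w.length - k)) i j})
      ((hA.frame hF rfl).agree ⟨by simp, by simp⟩) (by simp [hlab]) hM hI)
      fun σ₂ _ _ h₂ => ⟨?_, ?_⟩
    · convert h₂.1 using 1
      ext i
      have e : w.drop (w.length - (k + 1)) = w[w.length - 1 - k] :: w.drop (w.length - k) := by
        rw [List.drop_eq_getElem_cons (by omega)]
        congr 1
        · congr 1; omega
        · congr 1; omega
      rw [e]
      simp only [Rel, Set.mem_ofPred_eq]
      grind
    · have := h₂.2
      simp at this ⊢
      omega
  · have : w.length * (R.written.length * 310 + 7) ≤ w.length * (R.written.length * 330) :=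
      Nat.mul_le_mul_left _ (by omega)
    omega

/-- The index, in the array `rel`, of entry `(s, t)` of block `blk`. -/
def relIx : Expr := (Var.blk *ₑ Var.N +ₑ Var.s) *ₑ Var.N +ₑ Var.t

/-- Replace the set in `X` by its image under block `blk` of the array `rel`; for
`out = t` and `inn = s` the block is read as a relation from `s` to `t`, for `out = s` and `inn = t`
it is read backwards. -/
def image (out inn : Var) : Cmd :=
  .block (.count out .N (.aset .Y out (.lit 0) ;;
      .count inn .N (.ite (.eq (.arr .rel relIx *ₑ .arr .X inn) (.lit 1))
        (.aset .Y out (.lit 1)) .skip)) ;;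
    .count out .N (.aset .X out (.arr .Y out)))

theorem image_spec {σ : Store} {out inn : Var} (hoi : out = .t ∧ inn = .s ∨ out = .s ∧ inn = .t)
    {N b : ℕ} {S : Set ℕ} {f : ℕ → ℕ → ℕ} {P : ℕ → ℕ → Prop} (hN : σ.var .N = N)
    (hb : σ.var .blk = b) (hNM : N ≤ E.M)
    (hf : ∀ σ' : Store, σ'.var .blk = b → σ'.var .N = N →
      relIx.eval E σ' = f (σ'.var inn) (σ'.var out))
    (hfM : ∀ i < N, ∀ o < N, f i o < E.M)
    (hP : ∀ i < N, ∀ o < N, σ.arr .rel (f i o) = 1 ↔ P i o) (hX : Vec .X N S σ)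
    (hPN : ∀ i ∈ S, ∀ o, P i o → o < N) :
    Run E (image out inn) σ fun σ' => Vec .X N {o | ∃ i ∈ S, P i o} σ' ∧
      σ'.time ≤ σ.time + (N * (N * 50 + 70) + 20) := by
  have h1 := E.one_lt
  have hsafe : ∀ σ' : Store, relIx.Safe E σ' := fun σ' => by simp [relIx]
  have hcost : relIx.cost = 9 := rfl
  have hne : out ≠ inn ∧ out ≠ .N ∧ inn ≠ .N ∧ out ≠ .blk ∧ inn ≠ .blk := by
    rcases hoi with ⟨rfl, rfl⟩ | ⟨rfl, rfl⟩ <;> decide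
  obtain ⟨hne1, hne2, hne3, hne4, hne5⟩ := hne
  have hne3' := hne3.symm
  refine Run.block (Run.seq ?_)
  refine (Run.countConst (fun o σ' => ∀ t < o, σ'.arr .Y t = 1 ↔ ∃ i ∈ S, P i t)
    (N * 43 + 20) hN hne2 ?_ ?_ (fun _ _ _ _ h => h) (fun _ _ _ h => h) ?_ ?_).conseq ?_
  · simp [Cmd.setsVar, Cmd.count, hne1]
  · simp [Cmd.setsVar, Cmd.count, hne3.symm]
  · intro t ht; omega
  · intro o ho σ₁ hF₁ hv₁ hN₁ hI₁
    have hfr : ∀ (c : Cmd) (σ₀ σ₀' : Store), (Cmd.count out .N (.aset .Y out (.lit 0) ;;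
      .count inn .N (.ite (.eq (.arr .rel relIx *ₑ .arr .X inn) (.lit 1))
        (.aset .Y out (.lit 1)) .skip))).Frame σ₀ σ₀' → σ₀'.arr .rel = σ₀.arr .rel ∧
          σ₀'.arr .X = σ₀.arr .X ∧ σ₀'.var .blk = σ₀.var .blk := fun c σ₀ σ₀' h =>
      ⟨h.arr _ rfl, h.arr _ rfl, h.var _ (by
        simp [Cmd.count, Cmd.setsVar, hne4.symm, hne5.symm])⟩
    obtain ⟨r1, r2, r3⟩ := hfr .skip _ _ hF₁
    refine Run.intro fun hb₁ => ?_
    simp only [Cmd.wp, Expr.Safe, Expr.eval, hv₁, Cmd.wp_count]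
    refine ⟨trivial, trivial, by omega, by omega, ?_⟩
    refine (Run.countConst (fun i σ' => (∀ t < o, σ'.arr .Y t = 1 ↔ ∃ i ∈ S, P i t) ∧
      (σ'.arr .Y o = 1 ↔ ∃ i' ∈ S, i' < i ∧ P i' o)) 36 (σ := _) (H := N) (by simpa using hN₁)
      hne3 ?_ ?_ (fun _ _ _ _ h => h) (fun _ _ _ h => h) ?_ ?_).conseq ?_
    · simp [Cmd.setsVar]
    · simp [Cmd.setsVar]
    · refine ⟨fun t ht => ?_, by simp⟩
      simp only [Store.aset_arr, if_true, Function.update_of_ne (show t ≠ o by omega)]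
      exact hI₁ t ht
    · intro i hi σ₂ hF₂ hv₂ hN₂ hI₂
      have q1 : σ₂.arr .rel = σ.arr .rel := by rw [hF₂.arr _ rfl]; simpa using r1
      have q2 : σ₂.arr .X = σ.arr .X := by rw [hF₂.arr _ rfl]; simpa using r2
      have q3 : σ₂.var .blk = b := by
        rw [hF₂.var .blk (by simp [Cmd.count, Cmd.setsVar, hne5.symm])]
        simp [r3, hb]
      have q4 : σ₂.var out = o := by
        rw [hF₂.var out (by simp [Cmd.count, Cmd.setsVar, hne1])]
        simpa using hv₁
      have q5 : relIx.eval E σ₂ = f i o := by rw [hf _ q3 hN₂, hv₂, q4]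
      have hPio := hP i hi o ho
      have hXi := hX.1 i hi
      refine Run.intro fun hb₂ => ?_
      simp only [Cmd.wp, Expr.Safe, Expr.eval, Cond.Safe, Cond.Holds, hv₂, q1, q2, q5, hsafe,
        Store.tick_var, Store.tick_arr, mul_eq_one, hPio, hXi, q4,
        Expr.cost, Cond.cost, hcost]
      have := hfM i hi o ho
      refine ⟨⟨⟨⟨trivial, this⟩, trivial, by omega⟩, trivial⟩, fun hh => ⟨trivial, trivial,
        by omega, h1, ⟨?_, ?_⟩, by simp⟩, fun hh => ⟨⟨hI₂.1, ?_⟩, by simp⟩⟩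
      · intro t ht
        simp only [Store.aset_arr, if_true, Function.update_of_ne (show t ≠ o by omega)]
        exact hI₂.1 t ht
      · simp only [Store.aset_arr, if_true, Function.update_self, true_iff]
        exact ⟨i, hh.2, by omega, hh.1⟩
      · rw [hI₂.2]
        constructor
        · rintro ⟨i', a, b, c⟩; exact ⟨i', a, by omega, c⟩
        · rintro ⟨i', a, b, c⟩
          rcases Nat.lt_succ_iff_lt_or_eq.1 b with b | rfl
          · exact ⟨i', a, b, c⟩
          · exact absurd ⟨c, a⟩ hh
    · intro σ₃ _ _ ⟨⟨g1, g2⟩, ht⟩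
      refine ⟨fun t ht' => ?_, by simp at ht; omega⟩
      rcases Nat.lt_succ_iff_lt_or_eq.1 ht' with h | rfl
      · exact g1 t h
      · rw [g2]
        exact ⟨fun ⟨i, a, b, c⟩ => ⟨i, a, c⟩, fun ⟨i, a, c⟩ => ⟨i, a, hX.2 i a, c⟩⟩
  · intro σ₁ _ hF₁ ⟨g1, g2⟩
    have hN₁ : σ₁.var .N = N := by
      rw [hF₁.var .N (by simp [Cmd.count, Cmd.setsVar, hne2.symm, hne3.symm]), hN]
    refine (Run.countConst (fun o σ' => ∀ t < o, σ'.arr .X t = 1 ↔ ∃ i ∈ S, P i t)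
      15 hN₁ hne2 rfl rfl (fun _ _ _ _ h => h) (fun _ _ _ h => h) ?_ ?_).conseq ?_
    · intro t ht; omega
    · intro o ho σ₂ hF₂ hv₂ _ hI₂
      have hY : σ₂.arr .Y = σ₁.arr .Y := hF₂.arr .Y rfl
      refine Run.intro fun hb₂ => ?_
      simp only [Cmd.wp, Expr.Safe, Expr.eval, hv₂, hY]
      refine ⟨⟨trivial, by omega⟩, trivial, by omega, hY ▸ hb₂.2 _ _, fun t ht => ?_, by simp⟩
      simp only [Store.aset_arr, if_true, Function.update_apply]
      split_ifs with h
      · subst h; exact g1 t ho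
      · exact hI₂ t (by omega)
    · intro σ₂ _ _ ⟨k1, k2⟩
      refine ⟨⟨k1, ?_⟩, ?_⟩
      · rintro o ⟨i, hi, ho⟩; exact hPN i hi o ho
      · have e : N * (N * 50 + 70) = N * (N * 43 + 20 + 7) + N * (15 + 7) + N * (N * 7 + 21) := by
          ring
        omega

end RegexMatch

/-! ### Reading the compressed string -/

namespace RegexMatch

open WordRAM

variable {A : ℕ} {E : Env} {R : RegularExpression (Fin A)} {n : ℕ} {str : ℕ → List (Fin A)}

theorem getD_lt (E : Env) (k : ℕ) : E.input.getD k 0 < E.U := by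
  have := E.one_lt
  rw [List.getD_eq_getElem?_getD]
  cases h : E.input[k]? with
  | none => simp; omega
  | some v => exact E.input_lt v (List.mem_of_getElem? h)

theorem getElem?_pairs (Z : List (ℕ × Fin A)) (i : ℕ) (hi : i < Z.length) :
    (Z.flatMap fun z => [z.1, (z.2 : ℕ)])[2 * i]? = some Z[i].1 ∧
    (Z.flatMap fun z => [z.1, (z.2 : ℕ)])[2 * i + 1]? = some (Z[i].2 : ℕ) := by
  induction Z generalizing i with
  | nil => simp at hi
  | cons z Z ih =>
    cases i with
    | zero => simp
    | succ i =>
      have := ih i (by simpa using hi)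
      simpa [List.flatMap_cons, mul_add] using this

theorem length_pairs (Z : List (ℕ × Fin A)) :
    (Z.flatMap fun z => [z.1, (z.2 : ℕ)]).length = 2 * Z.length := by
  induction Z with
  | nil => rfl
  | cons z Z ih => simp only [List.flatMap_cons, List.length_append, ih]; simp; omega

theorem getD_input_words (Z : ZLString A) (τ k : ℕ) (hk : k < Z.words.length) :
    (matchInput Z R τ).getD (5 + k) 0 = Z.words[k] := by
  rw [matchInput, List.append_assoc, List.getD_eq_getElem?_getD,
    List.getElem?_append_right (by simp), List.getElem?_append_left (by simpa using hk)]
  simp [hk]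

theorem getD_input_written (Z : ZLString A) (τ k : ℕ) (hk : k < R.written.length) :
    (matchInput Z R τ).getD (5 + Z.words.length + k) 0 = R.written[k] := by
  rw [matchInput, List.append_assoc, List.getD_eq_getElem?_getD,
    List.getElem?_append_right (by simp; omega), List.getElem?_append_right (by simp; omega)]
  simp only [List.length_cons, List.length_nil]
  rw [show 5 + Z.words.length + k - (0 + 1 + 1 + 1 + 1 + 1) - Z.words.length = k by omega]
  simp [hk]

/-- Read the pairs of a ZL78 compressed string into the arrays of the trie. -/
def readZL78 : Cmd :=
  .ro ::= .lit 5 +ₑ .lit 2 *ₑ Var.n ;;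
  .count .i .n
    (.aset .par (Var.i +ₑ .lit 1) (.inp (.lit 5 +ₑ .lit 2 *ₑ Var.i)) ;;
      .aset .chr (Var.i +ₑ .lit 1) (.lit 7 +ₑ .inp (.lit 6 +ₑ .lit 2 *ₑ Var.i)))

theorem readZL78_spec {σ : Store} (hn : σ.var .n = n) (hM : n < E.M)
    (hlen : 5 + 2 * n < E.input.length) (hro : 5 + 2 * n < E.U)
    (hchr : ∀ i < n, 7 + E.input.getD (6 + 2 * i) 0 < E.U) :
    Run E readZL78 σ fun σ' => (σ'.var .ro = 5 + 2 * n ∧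
      ∀ i < n, σ'.arr .par (i + 1) = E.input.getD (5 + 2 * i) 0 ∧
        σ'.arr .chr (i + 1) = 7 + E.input.getD (6 + 2 * i) 0) ∧
      σ'.time ≤ σ.time + (n * 40 + 20) := by
  refine Run.intro fun hb => ?_
  simp only [readZL78, Cmd.wp, Cmd.wp_count, Expr.Safe, Expr.eval, hn]
  refine ⟨by simp, hro, ?_⟩
  refine (Run.countConst (fun k σ' => ∀ i < k, σ'.arr .par (i + 1) = E.input.getD (5 + 2 * i) 0 ∧
    σ'.arr .chr (i + 1) = 7 + E.input.getD (6 + 2 * i) 0) 30 (H := n) (by simpa using hn)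
    (by decide) rfl rfl (fun _ _ _ _ h => h) (fun _ _ _ h => h) ?_ ?_).conseq
    fun σ' _ hF h => ⟨⟨?_, h.1⟩, ?_⟩
  · intro i hi; omega
  · intro k hk σ' hF hv _ hI
    refine Run.intro fun hb' => ?_
    simp only [Cmd.wp, Expr.Safe, Expr.eval, hv, Store.aset_var]
    refine ⟨by simp; omega, by simp, by omega, getD_lt E _, by simp; omega, by simp, by omega,
      hchr k hk, fun i hi => ?_, by simp⟩
    simp only [Store.aset_arr, if_true, reduceCtorEq, if_false, Function.update_apply]
    by_cases h : i = k
    · simp [h]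
    · have := hI i (by omega)
      simpa [h] using this
  · rw [hF.var .ro rfl]; simp
  · have := h.2
    simp at this
    omega

/-- Read the codes of a ZLW compressed string into the arrays of the trie; node `i + 1` stands for
the phrase number `i`. -/
def readZLW : Cmd :=
  .ro ::= .lit 5 +ₑ Var.n ;;
  .count .i .n
    (.x ::= .inp (.lit 5 +ₑ Var.i) ;;
      .ite (.lt Var.x Var.sg)
        (.aset .par (Var.i +ₑ .lit 1) (.lit 0) ;;
          .aset .fst (Var.i +ₑ .lit 1) Var.x ;;
          .aset .chr (Var.i +ₑ .lit 1) (.lit 7 +ₑ Var.x))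
        (.x ::= Var.x -ₑ Var.sg ;;
          .aset .par (Var.i +ₑ .lit 1) (Var.x +ₑ .lit 1) ;;
          .aset .fst (Var.i +ₑ .lit 1) (.arr .fst (Var.x +ₑ .lit 1)) ;;
          .aset .chr (Var.i +ₑ .lit 1) (.lit 7 +ₑ .arr .fst (Var.x +ₑ .lit 2))))

theorem readZLW_spec {σ : Store} (hn : σ.var .n = n) (hsg : σ.var .sg = A) (hM : n < E.M)
    (hlen : 5 + n < E.input.length) (hro : 5 + n < E.U) (hAU : 7 + A < E.U)
    (href : ∀ i < n, ¬ E.input.getD (5 + i) 0 < A → E.input.getD (5 + i) 0 - A < i) :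
    Run E readZLW σ fun σ' => (σ'.var .ro = 5 + n ∧
      ∀ i < n, (E.input.getD (5 + i) 0 < A → σ'.arr .par (i + 1) = 0 ∧
          σ'.arr .fst (i + 1) = E.input.getD (5 + i) 0 ∧
          σ'.arr .chr (i + 1) = 7 + E.input.getD (5 + i) 0) ∧
        (¬ E.input.getD (5 + i) 0 < A →
          σ'.arr .par (i + 1) = E.input.getD (5 + i) 0 - A + 1 ∧
          σ'.arr .fst (i + 1) = σ'.arr .fst (E.input.getD (5 + i) 0 - A + 1) ∧
          σ'.arr .chr (i + 1) = 7 + σ'.arr .fst (E.input.getD (5 + i) 0 - A + 2))) ∧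
      σ'.time ≤ σ.time + (n * 100 + 20) := by
  refine Run.intro fun hb => ?_
  have hMU := E.mem_le
  simp only [readZLW, Cmd.wp, Cmd.wp_count, Expr.Safe, Expr.eval, hn]
  refine ⟨by simp, hro, ?_⟩
  refine (Run.countConst (fun k σ' => (∀ i < k, σ'.arr .fst (i + 1) < A) ∧
      ∀ i < k, (E.input.getD (5 + i) 0 < A → σ'.arr .par (i + 1) = 0 ∧
          σ'.arr .fst (i + 1) = E.input.getD (5 + i) 0 ∧
          σ'.arr .chr (i + 1) = 7 + E.input.getD (5 + i) 0) ∧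
        (¬ E.input.getD (5 + i) 0 < A →
          σ'.arr .par (i + 1) = E.input.getD (5 + i) 0 - A + 1 ∧
          σ'.arr .fst (i + 1) = σ'.arr .fst (E.input.getD (5 + i) 0 - A + 1) ∧
          σ'.arr .chr (i + 1) = 7 + σ'.arr .fst (E.input.getD (5 + i) 0 - A + 2)))
    90 (H := n) (by simpa using hn)
    (by decide) rfl rfl (fun _ _ _ _ h => h) (fun _ _ _ h => h) ?_ ?_).conseq
    fun σ' _ hF h => ⟨⟨?_, h.1.2⟩, ?_⟩
  · exact ⟨fun i hi => by omega, fun i hi => by omega⟩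
  · intro k hk σ' hF hv _ ⟨hI1, hI2⟩
    have hsg' : σ'.var .sg = A := by rw [hF.var .sg rfl]; simpa using hsg
    refine Run.intro fun hb' => ?_
    simp only [Cmd.wp, Expr.Safe, Expr.eval, Cond.Safe, Cond.Holds, hv, Store.aset_var,
      Store.tick_var, Store.set_var, if_true, reduceCtorEq, if_false, hsg', Store.tick_arr,
      Store.set_arr, Store.aset_arr]
    have hx := getD_lt E (5 + k)
    have hr := href k hk
    have old : ∀ i < k, ¬ E.input.getD (5 + i) 0 < A →
        E.input.getD (5 + i) 0 - A + 1 ≠ k + 1 ∧ E.input.getD (5 + i) 0 - A + 2 ≠ k + 1 := by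
      intro i hi h
      have := href i (by omega) h
      omega
    generalize hxe : E.input.getD (5 + k) 0 = x at *
    refine ⟨by simp; omega, hx, by simp, fun hh => ?_, fun hh => ?_⟩
    · refine ⟨by simp, by simp, by omega, by omega, by simp, by simp, by omega, hx,
        by simp, by simp, by omega, by omega, ⟨fun i hi => ?_, fun i hi => ?_⟩, by simp⟩
      · simp only [Function.update_apply]
        split_ifs with h
        · exact hh
        · exact hI1 i (by omega)
      · by_cases h : i = k
        · subst h
          rw [hxe]
          simp [hh]
        · have h2 := hI2 i (by omega)
          have h3 := old i (by omega)
          simp only [Function.update_apply, Nat.add_right_cancel_iff, h, if_false]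
          refine ⟨h2.1, fun h4 => ?_⟩
          rw [if_neg (by have := (h3 h4).1; omega), if_neg (by have := (h3 h4).2; omega)]
          exact h2.2 h4
    · have hr := hr hh
      have hf1 := hI1 (x - A) hr
      have hf2 : (if x - A + 2 = k + 1 then σ'.arr .fst (x - A + 1) else
          σ'.arr .fst (x - A + 2)) < A := by
        split_ifs with h
        · exact hf1
        · exact hI1 (x - A + 1) (by omega)
      refine ⟨by simp, by omega, by simp, by simp, by omega, by omega, by simp; omega, by simp,
        by omega, by omega, ⟨trivial, ⟨trivial, trivial⟩, by omega⟩, by simp, by omega, ?_,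
        ⟨fun i hi => ?_, fun i hi => ?_⟩, by simp⟩
      · simp only [Function.update_apply]; omega
      · simp only [Function.update_apply]
        split_ifs with h
        · exact hf1
        · exact hI1 i (by omega)
      · by_cases h : i = k
        · subst h
          rw [hxe]
          have e : x - A ≠ i := by omega
          simp [hh, Function.update_apply, e]
        · have h2 := hI2 i (by omega)
          have h3 := old i (by omega)
          simp only [Function.update_apply, Nat.add_right_cancel_iff, h, if_false]
          refine ⟨h2.1, fun h4 => ?_⟩
          rw [if_neg (by have := (h3 h4).1; omega), if_neg (by have := (h3 h4).2; omega)]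
          exact h2.2 h4
  · rw [hF.var .ro rfl]; simp
  · have := h.2
    simp at this
    omega

/-- Compute the depths of the nodes of the trie. -/
def depths : Cmd :=
  .count .i .n (.aset .dep (Var.i +ₑ .lit 1)
    (.arr .dep (.arr .par (Var.i +ₑ .lit 1)) +ₑ .lit 1))

theorem depths_spec {σ : Store} (hn : σ.var .n = n) (hT : IsTrie A n (σ.arr .par) (σ.arr .chr) str)
    (h0 : σ.arr .dep 0 = 0) (hM : n < E.M) :
    Run E depths σ fun σ' => Trie n str σ' ∧ σ'.time ≤ σ.time + (n * 40 + 5) := by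
  have hMU := E.mem_le
  refine (Run.countConst (fun k σ' => ∀ v ≤ k, σ'.arr .dep v = (str v).length) 33 (H := n) hn
    (by decide) rfl rfl (fun _ _ _ _ h => h) (fun _ _ _ h => h) ?_ ?_).conseq
    fun σ' _ hF h => ⟨⟨?_, h.1, ?_⟩, h.2⟩
  · intro v hv
    obtain rfl : v = 0 := by omega
    rw [h0, hT.str_zero]; rfl
  · intro k hk σ' hF hv _ hI
    have hpar : σ'.arr .par = σ.arr .par := hF.arr .par rfl
    have h1 := hT.par_le k hk
    have h2 := hT.length_str (v := k + 1) (by omega) (by omega)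
    have h3 := hT.length_str_le (v := k + 1) (by omega)
    have h4 := hI _ h1
    refine Run.intro fun hb' => ?_
    simp only [Cmd.wp, Expr.Safe, Expr.eval, hv, hpar, h4]
    refine ⟨⟨⟨⟨⟨trivial, trivial⟩, by omega⟩, by omega⟩, trivial⟩, by simp, by omega, by omega,
      fun v hv => ?_, by simp⟩
    simp only [Store.aset_arr, if_true, Function.update_apply]
    split_ifs with h
    · rw [h, h2]
    · exact hI v (by omega)
  · rw [hF.arr .par rfl, hF.arr .chr rfl]; exact hT
  · rw [hF.var .n rfl, hn]

end RegexMatch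

/-! ### Building the position automaton -/

namespace RegexMatch

open WordRAM

variable {A : ℕ} {E : Env} {R : RegularExpression (Fin A)} {n : ℕ} {str : ℕ → List (Fin A)}

/-- Run the parser on the expression in the input. -/
def parse : Cmd :=
  .sp ::= .lit 0 ;; .r ::= .lit 0 ;;
  .count .i .m
    (.x ::= .inp (Var.ro +ₑ Var.i) ;;
      .ite (.eq Var.x (.lit 0))
        (.aset .stk Var.sp Var.i ;; .aset .kind Var.i (.lit 0) ;; .sp ::= Var.sp +ₑ .lit 1)
      (.ite (.eq Var.x (.lit 1))
        (.sp ::= Var.sp -ₑ .lit 1 ;; .aset .kind Var.i (.lit 0) ;; .r ::= .arr .stk Var.sp)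
      (.ite (.lt Var.x (.lit 5))
        (.aset .kind Var.i (.lit 0) ;; .aset .kind Var.r Var.x ;;
          .aset .sec Var.r (Var.i +ₑ .lit 2))
        (.aset .kind Var.i Var.x))))

/-- The tables of a parsed expression are in the store, with bounds that keep the array accesses of
the following sweeps in range. -/
structure Tables (R : RegularExpression (Fin A)) (K S : ℕ → ℕ) : Prop where
  parsed : Parsed K S R 0
  sec_le : ∀ k, S k ≤ R.written.length + 1
  lt_sec : ∀ k, K k = 2 ∨ K k = 3 → k < S k

theorem parse_spec {σ : Store} {o : ℕ} (hm : σ.var .m = R.written.length) (hro : σ.var .ro = o)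
    (hM : R.written.length + 1 < E.M) (hlen : o + R.written.length ≤ E.input.length)
    (hin : ∀ i (hi : i < R.written.length), E.input.getD (o + i) 0 = R.written[i])
    (h1 : σ.arr .stk = fun _ => 0) (h2 : σ.arr .kind = fun _ => 0) (h3 : σ.arr .sec = fun _ => 0) :
    Run E parse σ fun σ' => Tables R (σ'.arr .kind) (σ'.arr .sec) ∧
      σ'.time ≤ σ.time + (R.written.length * 100 + 20) := by
  have hMU := E.mem_le
  have h0U := E.one_lt
  obtain ⟨P, hP⟩ : ∃ P : ℕ → Parser, P = fun i =>
    Parser.run (R.written.take i) 0 ⟨0, 0, fun _ => 0, fun _ => 0, fun _ => 0⟩ := ⟨_, rfl⟩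
  have hB : ∀ i ≤ R.written.length, (P i).Bounds i := by
    intro i hi
    have h0 : Parser.Bounds ⟨0, 0, fun _ => 0, fun _ => 0, fun _ => 0⟩ 0 :=
      ⟨le_rfl, le_rfl, fun _ => le_rfl, fun _ => by simp, fun _ h => by simp at h⟩
    have := h0.run (R.written.take i)
    rw [List.length_take, Nat.min_eq_left hi, zero_add] at this
    rw [hP]; exact this
  have hS : ∀ i (hi : i < R.written.length), P (i + 1) = (P i).step R.written[i] i := by
    intro i hi
    rw [hP]
    simp only [List.take_succ_eq_append_getElem hi, Parser.run_append, Parser.run,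
      List.length_take, Nat.min_eq_left hi.le, zero_add]
  refine Run.intro fun hb => ?_
  simp only [parse, Cmd.wp, Cmd.wp_count, Expr.Safe, Expr.eval]
  refine ⟨trivial, by omega, trivial, by omega, ?_⟩
  refine (Run.countConst (fun i σ' => σ'.var .sp = (P i).sp ∧ σ'.var .r = (P i).r ∧
    σ'.arr .stk = (P i).stk ∧ σ'.arr .kind = (P i).kind ∧ σ'.arr .sec = (P i).sec) 90
    (H := R.written.length) (by simpa using hm) (by decide) rfl rfl
    (fun _ _ _ _ h => by simpa using h) (fun _ _ _ h => h) ?_ ?_).conseq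
    fun σ' _ hF ⟨h, ht⟩ => ⟨?_, ?_⟩
  · simp [hP, Parser.run, h1, h2, h3]
  · rintro i hi σ' hF hv _ ⟨g1, g2, g3, g4, g5⟩
    obtain ⟨b1, b2, b3, b4, b5⟩ := hB i hi.le
    have hx := getD_lt E (o + i)
    have hro' : σ'.var .ro = o := by rw [hF.var .ro rfl]; simpa using hro
    have hin' := hin i hi
    have hSi := hS i hi
    rw [← hin'] at hSi
    have b3' := b3 ((P i).sp - 1)
    refine Run.intro fun hb' => ?_
    simp only [Cmd.wp, Expr.Safe, Expr.eval, Cond.Safe, Cond.Holds, hv, Store.aset_var,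
      Store.tick_var, Store.set_var, if_true, reduceCtorEq, if_false, hro', Store.tick_arr,
      Store.set_arr, Store.aset_arr, g1, g2, g3, g4, g5, hSi, Parser.step]
    clear hin' hSi
    generalize E.input.getD (o + i) 0 = x at *
    refine ⟨⟨⟨trivial, trivial⟩, by omega⟩, hx, ⟨trivial, trivial⟩, fun c => ?_, fun c =>
      ⟨⟨trivial, trivial⟩, fun c1 => ?_,
        fun c1 => ⟨⟨trivial, trivial⟩, fun c2 => ?_, fun c2 => ?_⟩⟩⟩
    · simp only [if_pos c]
      exact ⟨trivial, trivial, by omega, by omega, trivial, trivial, by omega, by omega,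
        ⟨trivial, trivial⟩, by omega, ⟨trivial, trivial, trivial, trivial, trivial⟩, by simp⟩
    · simp only [if_neg c, if_pos c1]
      exact ⟨⟨trivial, trivial⟩, by omega, trivial, trivial, by omega, by omega,
        ⟨trivial, by omega⟩, by omega, ⟨trivial, trivial, trivial, trivial, trivial⟩, by simp⟩
    · simp only [if_neg c, if_neg c1, if_pos c2]
      exact ⟨trivial, trivial, by omega, by omega, trivial, trivial, by omega, by omega,
        ⟨trivial, trivial⟩, trivial, by omega, by omega,
        ⟨trivial, trivial, trivial, trivial, trivial⟩, by simp⟩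
    · simp only [if_neg c, if_neg c1, if_neg c2]
      exact ⟨trivial, trivial, by omega, hx, ⟨trivial, trivial, trivial, trivial, trivial⟩,
        by simp⟩
  · have hw : P R.written.length = Parser.run R.written 0
        ⟨0, 0, fun _ => 0, fun _ => 0, fun _ => 0⟩ := by
      rw [hP]; simp
    obtain ⟨b1, b2, b3, b4, b5⟩ := hB _ le_rfl
    rw [h.2.2.2.1, h.2.2.2.2]
    exact ⟨by rw [hw]; exact (Parser.run_written R 0 _).2.2.2, b4, b5⟩
  · simp at ht
    omega

/-- Compute the nullability table from right to left. -/
def nullable : Cmd :=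
  .count .i .m
    (.k ::= Var.m -ₑ .lit 1 -ₑ Var.i ;;
      .x ::= .arr .kind Var.k ;;
      .y ::= .arr .nul (Var.k +ₑ .lit 1) ;;
      .ite (.eq Var.x (.lit 2))
        (.ite (.eq Var.y (.lit 1)) (.aset .nul Var.k (.arr .nul (.arr .sec Var.k)))
          (.aset .nul Var.k (.lit 0)))
      (.ite (.eq Var.x (.lit 3))
        (.ite (.eq Var.y (.lit 1)) (.aset .nul Var.k (.lit 1))
          (.aset .nul Var.k (.arr .nul (.arr .sec Var.k))))
      (.ite (.eq Var.x (.lit 4)) (.aset .nul Var.k (.lit 1))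
      (.ite (.eq Var.x (.lit 6)) (.aset .nul Var.k (.lit 1)) (.aset .nul Var.k (.lit 0))))))

theorem nulVal_congr {K S f g : ℕ → ℕ} {p : ℕ} (hlt : K p = 2 ∨ K p = 3 → p < S p)
    (h : ∀ x, p < x → f x = g x) : nulVal K S f p = nulVal K S g p := by
  simp only [nulVal, h (p + 1) (by omega)]
  split_ifs <;> first | rfl | exact h _ (hlt (by omega))

theorem nullable_spec {σ : Store} (hm : σ.var .m = R.written.length)
    (hT : Tables R (σ.arr .kind) (σ.arr .sec)) (hM : R.written.length + 1 < E.M) :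
    Run E nullable σ fun σ' => (∀ x < R.written.length,
      σ'.arr .nul x = nulVal (σ.arr .kind) (σ.arr .sec) (σ'.arr .nul) x) ∧
      σ'.time ≤ σ.time + (R.written.length * 100 + 20) := by
  have hMU := E.mem_le
  have h0U := E.one_lt
  refine (Run.countConst (fun i σ' => ∀ x < R.written.length, R.written.length - i ≤ x →
    σ'.arr .nul x = nulVal (σ.arr .kind) (σ.arr .sec) (σ'.arr .nul) x) 90
    (H := R.written.length) hm (by decide) rfl rfl
    (fun _ _ _ _ h => h) (fun _ _ _ h => h) ?_ ?_).conseq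
    fun σ' _ hF ⟨h, ht⟩ => ⟨fun x hx => h x hx (by omega), by omega⟩
  · intro x hx; omega
  · rintro i hi σ' hF hv hm' hI
    have e1 : σ'.arr .kind = σ.arr .kind := hF.arr .kind rfl
    have e2 : σ'.arr .sec = σ.arr .sec := hF.arr .sec rfl
    obtain ⟨p, hp⟩ : ∃ p, p = R.written.length - 1 - i := ⟨_, rfl⟩
    have hs := hT.sec_le p
    refine Run.intro fun hb' => ?_
    have hlt := hb'.2 .kind p
    rw [e1] at hlt
    simp only [Cmd.wp, Expr.Safe, Expr.eval, Cond.Safe, Cond.Holds, hv,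
      Store.tick_var, Store.set_var, if_true, reduceCtorEq, if_false, Store.tick_arr,
      Store.set_arr, hm', e1, e2, ← hp]
    have key : ∀ σ'' : Store, σ''.arr .nul = Function.update (σ'.arr .nul) p
        (nulVal (σ.arr .kind) (σ.arr .sec) (σ'.arr .nul) p) →
        ∀ x < R.written.length, R.written.length - (i + 1) ≤ x →
        σ''.arr .nul x = nulVal (σ.arr .kind) (σ.arr .sec) (σ''.arr .nul) x := by
      intro σ'' h x hx hx'
      rw [h]
      by_cases hxp : x = p
      · rw [hxp, Function.update_self]
        refine nulVal_congr (hT.lt_sec p) fun y hy => ?_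
        rw [Function.update_of_ne (by omega)]
      · rw [Function.update_of_ne hxp, hI x hx (by omega)]
        refine nulVal_congr (hT.lt_sec x) fun y hy => ?_
        rw [Function.update_of_ne (by omega)]
    refine ⟨by simp, by omega, by simp; omega, hlt, by simp; omega, hb'.2 _ _, by simp,
      fun c1 => ⟨by simp, fun c2 => ?_, fun c2 => ?_⟩, fun c1 => ⟨by simp, fun c2 =>
        ⟨by simp, fun c3 => ?_, fun c3 => ?_⟩, fun c2 => ⟨by simp, fun c3 => ?_, fun c3 =>
        ⟨by simp, fun c4 => ?_, fun c4 => ?_⟩⟩⟩⟩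
    · exact ⟨by simp; omega, by simp, by omega, hb'.2 _ _, key _ (by simp [nulVal, c1, c2]),
        by simp⟩
    · exact ⟨by simp, by simp, by omega, by omega, key _ (by simp [nulVal, c1, c2]), by simp⟩
    · exact ⟨by simp, by simp, by omega, by omega, key _ (by simp [nulVal, c2, c3]), by simp⟩
    · exact ⟨by simp; omega, by simp, by omega, hb'.2 _ _, key _ (by simp [nulVal, c2, c3]),
        by simp⟩
    · exact ⟨by simp, by simp, by omega, by omega, key _ (by simp [nulVal, c3]), by simp⟩
    · exact ⟨by simp, by simp, by omega, by omega, key _ (by simp [nulVal, c4]), by simp⟩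
    · exact ⟨by simp, by simp, by omega, by omega, key _ (by simp [nulVal, c1, c2, c3, c4]),
        by simp⟩

/-- Append an edge to the list in `fsrc` and `fdst`. -/
def emit (s d : Expr) : Cmd :=
  .block (.aset .fsrc Var.ec s ;; .aset .fdst Var.ec d ;; .ec ::= Var.ec +ₑ .lit 1)

/-- The tables are in the store, and the edges `L` have been listed so far; the current position is
`p`. -/
structure Emitting (p : ℕ) (K S Nl : ℕ → ℕ) (L : List (ℕ × ℕ)) (σ : Store) : Prop where
  k : σ.var .k = p
  kind : σ.arr .kind = K
  sec : σ.arr .sec = S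
  nul : σ.arr .nul = Nl
  ec : σ.var .ec = L.length
  edges : EdgeArr .fsrc .fdst L σ

variable {p m : ℕ} {K S Nl : ℕ → ℕ} {L : List (ℕ × ℕ)}

theorem emit_spec {σ : Store} (h : Emitting p K S Nl L σ) {s d : Expr}
    (hs : s.Safe E σ) (hd : ∀ f k, d.Safe E (σ.aset .fsrc L.length f k))
    {a b : ℕ} (ha : s.eval E σ = a)
    (hb : ∀ f k, d.eval E (σ.aset .fsrc L.length f k) = b) (haU : a < E.U) (hbU : b < E.U)
    (hL : L.length < E.M) (hcs : s.cost ≤ 20) (hcd : d.cost ≤ 20) :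
    Run E (emit s d) σ fun σ' => Emitting p K S Nl (L ++ [(a, b)]) σ' ∧
      σ'.time ≤ σ.time + 60 := by
  have hMU := E.mem_le
  refine Run.block (Run.intro fun _ => ?_)
  simp only [Cmd.wp, Expr.Safe, Expr.eval, h.ec, ha, hs, hd, hb, Store.aset_var]
  refine ⟨trivial, trivial, hL, haU, trivial, trivial, hL, hbU, ⟨trivial, trivial⟩, by omega,
    ⟨by simp [h.k], by simp [h.kind], by simp [h.sec], by simp [h.nul], by simp,
      fun k hk => ?_⟩, by simp; omega⟩
  simp only [Store.set_arr, Store.aset_arr, if_true, reduceCtorEq, if_false]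
  simp only [List.length_append, List.length_cons, List.length_nil] at hk
  by_cases hkL : k = L.length
  · subst hkL; simp
  · have h1 : k < L.length := by omega
    rw [Function.update_of_ne hkL, Function.update_of_ne hkL, List.getElem_append_left h1]
    exact h.edges k h1

/-- List the edges `finAt`. -/
def finBody : Cmd :=
  .ite (.eq (.arr .kind Var.k) (.lit 2))
    (emit (.lit 2 *ₑ .arr .sec Var.k) (.lit 2 *ₑ Var.k) ;;
      .ite (.eq (.arr .nul (.arr .sec Var.k)) (.lit 1))
        (emit (.lit 2 *ₑ (Var.k +ₑ .lit 1)) (.lit 2 *ₑ Var.k)) .skip)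
  (.ite (.eq (.arr .kind Var.k) (.lit 3))
    (emit (.lit 2 *ₑ (Var.k +ₑ .lit 1)) (.lit 2 *ₑ Var.k) ;;
      emit (.lit 2 *ₑ .arr .sec Var.k) (.lit 2 *ₑ Var.k))
  (.ite (.eq (.arr .kind Var.k) (.lit 4))
    (emit (.lit 2 *ₑ (Var.k +ₑ .lit 1)) (.lit 2 *ₑ Var.k)) .skip))

/-- List the edges `inAt`. -/
def inBody : Cmd :=
  .ite (.eq (.arr .kind Var.k) (.lit 2))
    (emit (.lit 2 *ₑ Var.k +ₑ .lit 1) (.lit 2 *ₑ (Var.k +ₑ .lit 1) +ₑ .lit 1) ;;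
      emit (.lit 2 *ₑ (Var.k +ₑ .lit 1)) (.lit 2 *ₑ .arr .sec Var.k +ₑ .lit 1) ;;
      .ite (.eq (.arr .nul (Var.k +ₑ .lit 1)) (.lit 1))
        (emit (.lit 2 *ₑ Var.k +ₑ .lit 1) (.lit 2 *ₑ .arr .sec Var.k +ₑ .lit 1)) .skip)
  (.ite (.eq (.arr .kind Var.k) (.lit 3))
    (emit (.lit 2 *ₑ Var.k +ₑ .lit 1) (.lit 2 *ₑ (Var.k +ₑ .lit 1) +ₑ .lit 1) ;;
      emit (.lit 2 *ₑ Var.k +ₑ .lit 1) (.lit 2 *ₑ .arr .sec Var.k +ₑ .lit 1))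
  (.ite (.eq (.arr .kind Var.k) (.lit 4))
    (emit (.lit 2 *ₑ Var.k +ₑ .lit 1) (.lit 2 *ₑ (Var.k +ₑ .lit 1) +ₑ .lit 1) ;;
      emit (.lit 2 *ₑ (Var.k +ₑ .lit 1)) (.lit 2 *ₑ (Var.k +ₑ .lit 1) +ₑ .lit 1)) .skip))

theorem Emitting.tick {σ : Store} (h : Emitting p K S Nl L σ) (k : ℕ) :
    Emitting p K S Nl L (σ.tick k) := ⟨h.k, h.kind, h.sec, h.nul, h.ec, h.edges⟩

theorem wp_emit (s d : Expr) (Q : Store → Prop) (σ : Store) :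
    (emit s d).wp E Q σ = Run E (emit s d) σ Q := rfl

theorem finBody_spec {σ : Store} (h : Emitting p K S Nl L σ) (hp : p < m) (hS : S p ≤ m + 1)
    (hM : 5 * m ≤ E.M) (hL : L.length + 2 ≤ E.M) :
    Run E finBody σ fun σ' => Emitting p K S Nl (L ++ finAt K S Nl p) σ' ∧
      σ'.time ≤ σ.time + 200 := by
  have hMU := E.mem_le
  refine Run.intro fun _ => ?_
  simp only [finBody, Cmd.wp, Expr.Safe, Expr.eval, Cond.Safe, Cond.Holds, Store.tick_var,
    Store.tick_arr, h.k, h.kind, wp_emit]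
  refine ⟨by simp; omega, fun c => ?_, fun c => ⟨by simp; omega, fun c1 => ?_, fun c1 =>
    ⟨by simp; omega, fun c2 => ?_, fun c2 => ?_⟩⟩⟩
  · refine Run.conseq (emit_spec (a := 2 * S p) (b := 2 * p) (h.tick _) (by simp [h.k]; omega)
      (by simp) (by simp [h.k, h.sec]) (by simp [h.k]) (by omega) (by omega) (by omega)
      (by simp) (by simp)) fun σ₁ _ _ h₁ => ?_
    simp only [h₁.1.k, h₁.1.nul, h₁.1.sec]
    refine ⟨by simp; omega, fun c1 => ?_, fun c1 => ⟨?_, ?_⟩⟩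
    · refine Run.conseq (emit_spec (a := 2 * (p + 1)) (b := 2 * p) (h₁.1.tick _) (by simp)
        (by simp) (by simp [h₁.1.k]) (by simp [h₁.1.k]) (by omega) (by omega)
        (by simp; omega) (by simp) (by simp)) fun σ₂ _ _ h₂ => ⟨?_, ?_⟩
      · simpa [finAt, c, c1] using h₂.1
      · have t1 := h₁.2
        have t2 := h₂.2
        simp at t1 t2
        omega
    · simpa [finAt, c, c1] using (h₁.1.tick _).tick _
    · have t1 := h₁.2
      simp at t1 ⊢
      omega
  · refine Run.conseq (emit_spec (a := 2 * (p + 1)) (b := 2 * p) ((h.tick _).tick _) (by simp)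
      (by simp) (by simp [h.k]) (by simp [h.k]) (by omega) (by omega) (by omega)
      (by simp) (by simp)) fun σ₁ _ _ h₁ => ?_
    refine Run.conseq (emit_spec (a := 2 * S p) (b := 2 * p) h₁.1 (by simp [h₁.1.k]; omega)
      (by simp) (by simp [h₁.1.k, h₁.1.sec]) (by simp [h₁.1.k]) (by omega) (by omega)
      (by simp; omega) (by simp) (by simp)) fun σ₂ _ _ h₂ => ⟨?_, ?_⟩
    · simpa [finAt, c1] using h₂.1
    · have t1 := h₁.2
      have t2 := h₂.2
      simp at t1 t2
      omega
  · refine Run.conseq (emit_spec (a := 2 * (p + 1)) (b := 2 * p) (((h.tick _).tick _).tick _)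
      (by simp) (by simp) (by simp [h.k]) (by simp [h.k]) (by omega) (by omega) (by omega)
      (by simp) (by simp)) fun σ₁ _ _ h₁ => ⟨?_, ?_⟩
    · simpa [finAt, c2] using h₁.1
    · have t1 := h₁.2
      simp at t1
      omega
  · refine ⟨?_, by simp⟩
    simpa [finAt, c, c1, c2] using (((h.tick _).tick _).tick _).tick _

theorem inBody_spec {σ : Store} (h : Emitting p K S Nl L σ) (hp : p < m) (hS : S p ≤ m + 1)
    (hM : 5 * m ≤ E.M) (hL : L.length + 3 ≤ E.M) :
    Run E inBody σ fun σ' => Emitting p K S Nl (L ++ inAt K S Nl p) σ' ∧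
      σ'.time ≤ σ.time + 250 := by
  have hMU := E.mem_le
  refine Run.intro fun _ => ?_
  simp only [inBody, Cmd.wp, Expr.Safe, Expr.eval, Cond.Safe, Cond.Holds, Store.tick_var,
    Store.tick_arr, h.k, h.kind, wp_emit]
  refine ⟨by simp; omega, fun c => ?_, fun c => ⟨by simp; omega, fun c1 => ?_, fun c1 =>
    ⟨by simp; omega, fun c2 => ?_, fun c2 => ?_⟩⟩⟩
  · refine Run.conseq (emit_spec (a := 2 * p + 1) (b := 2 * (p + 1) + 1) (h.tick _) (by simp)
      (by simp) (by simp [h.k]) (by simp [h.k]) (by omega) (by omega) (by omega)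
      (by simp) (by simp)) fun σ₁ _ _ h₁ => ?_
    refine Run.conseq (emit_spec (a := 2 * (p + 1)) (b := 2 * S p + 1) h₁.1 (by simp)
      (by simp [h₁.1.k]; omega) (by simp [h₁.1.k]) (by simp [h₁.1.k, h₁.1.sec]) (by omega)
      (by omega) (by simp; omega) (by simp) (by simp)) fun σ₂ _ _ h₂ => ?_
    simp only [h₂.1.k, h₂.1.nul]
    refine ⟨by simp; omega, fun c1 => ?_, fun c1 => ⟨?_, ?_⟩⟩
    · refine Run.conseq (emit_spec (a := 2 * p + 1) (b := 2 * S p + 1) (h₂.1.tick _) (by simp)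
        (by simp [h₂.1.k]; omega) (by simp [h₂.1.k]) (by simp [h₂.1.k, h₂.1.sec]) (by omega)
        (by omega) (by simp; omega) (by simp) (by simp)) fun σ₃ _ _ h₃ => ⟨?_, ?_⟩
      · simpa [inAt, c, c1] using h₃.1
      · have t1 := h₁.2
        have t2 := h₂.2
        have t3 := h₃.2
        simp at t1 t2 t3
        omega
    · simpa [inAt, c, c1] using (h₂.1.tick _).tick _
    · have t1 := h₁.2
      have t2 := h₂.2
      simp at t1 t2 ⊢
      omega
  · refine Run.conseq (emit_spec (a := 2 * p + 1) (b := 2 * (p + 1) + 1) ((h.tick _).tick _)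
      (by simp) (by simp) (by simp [h.k]) (by simp [h.k]) (by omega) (by omega) (by omega)
      (by simp) (by simp)) fun σ₁ _ _ h₁ => ?_
    refine Run.conseq (emit_spec (a := 2 * p + 1) (b := 2 * S p + 1) h₁.1 (by simp)
      (by simp [h₁.1.k]; omega) (by simp [h₁.1.k]) (by simp [h₁.1.k, h₁.1.sec]) (by omega)
      (by omega) (by simp; omega) (by simp) (by simp)) fun σ₂ _ _ h₂ => ⟨?_, ?_⟩
    · simpa [inAt, c1] using h₂.1
    · have t1 := h₁.2
      have t2 := h₂.2
      simp at t1 t2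
      omega
  · refine Run.conseq (emit_spec (a := 2 * p + 1) (b := 2 * (p + 1) + 1)
      (((h.tick _).tick _).tick _) (by simp) (by simp) (by simp [h.k]) (by simp [h.k])
      (by omega) (by omega) (by omega) (by simp) (by simp)) fun σ₁ _ _ h₁ => ?_
    refine Run.conseq (emit_spec (a := 2 * (p + 1)) (b := 2 * (p + 1) + 1) h₁.1 (by simp)
      (by simp) (by simp [h₁.1.k]) (by simp [h₁.1.k]) (by omega) (by omega)
      (by simp; omega) (by simp) (by simp)) fun σ₂ _ _ h₂ => ⟨?_, ?_⟩
    · simpa [inAt, c2] using h₂.1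
    · have t1 := h₁.2
      have t2 := h₂.2
      simp at t1 t2
      omega
  · refine ⟨?_, by simp⟩
    simpa [inAt, c, c1, c2] using (((h.tick _).tick _).tick _).tick _

/-- List all edges of the position automaton, and their reversals in the reverse order. -/
def listEdges : Cmd :=
  .ec ::= .lit 0 ;;
  .count .i .m (.k ::= Var.m -ₑ .lit 1 -ₑ Var.i ;; .block finBody) ;;
  .count .i .m (.k ::= Var.i ;; .block inBody) ;;
  .count .k .ec
    (.aset .bsrc Var.k (.arr .fdst (Var.ec -ₑ .lit 1 -ₑ Var.k)) ;;
      .aset .bdst Var.k (.arr .fsrc (Var.ec -ₑ .lit 1 -ₑ Var.k)))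

theorem length_finAt (p : ℕ) : (finAt K S Nl p).length ≤ 2 := by
  unfold finAt; split_ifs <;> simp

theorem length_inAt (p : ℕ) : (inAt K S Nl p).length ≤ 3 := by
  unfold inAt; split_ifs <;> simp

theorem length_flatMap_le {f : ℕ → List (ℕ × ℕ)} {c : ℕ} (hf : ∀ p, (f p).length ≤ c)
    (l : List ℕ) : (l.flatMap f).length ≤ c * l.length := by
  induction l with
  | nil => simp
  | cons x l ih =>
    simp only [List.flatMap_cons, List.length_append, List.length_cons, mul_add]
    have := hf x
    omega

theorem Emitting.move {σ : Store} (h : Emitting p K S Nl L σ) (k q : ℕ) :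
    Emitting q K S Nl L (σ.set .k q k) :=
  ⟨by simp, h.kind, h.sec, h.nul, by simpa using h.ec, h.edges⟩

theorem listEdges_spec {σ : Store} (hm : σ.var .m = R.written.length)
    (hN : σ.var .N = 2 * R.written.length)
    (hT : Tables R (σ.arr .kind) (σ.arr .sec)) (hM : 5 * R.written.length + 5 ≤ E.M)
    (hnul : ∀ x < R.written.length,
      σ.arr .nul x = nulVal (σ.arr .kind) (σ.arr .sec) (σ.arr .nul) x) :
    Run E listEdges σ fun σ' => Auto R σ' ∧
      σ'.time ≤ σ.time + (R.written.length * 1000 + 20) := by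
  have hMU := E.mem_le
  have h0U := E.one_lt
  obtain ⟨m, hmd⟩ : ∃ m, m = R.written.length := ⟨_, rfl⟩
  obtain ⟨K, hK⟩ : ∃ K, K = σ.arr .kind := ⟨_, rfl⟩
  obtain ⟨S, hS⟩ : ∃ S, S = σ.arr .sec := ⟨_, rfl⟩
  obtain ⟨Nl, hNl⟩ : ∃ Nl, Nl = σ.arr .nul := ⟨_, rfl⟩
  rw [← hK, ← hS] at hT hnul
  rw [← hNl] at hnul
  rw [← hmd] at hM hnul hm
  have hfin := hT.parsed.finE_eq (nul := Nl) (fun x _ hx => hnul x (by omega))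
  have hin := hT.parsed.inE_eq (nul := Nl) (fun x _ hx => hnul x (by omega))
  rw [← hmd] at hfin hin
  have hsec := hT.sec_le
  rw [← hmd] at hsec
  refine Run.intro fun hb => ?_
  simp only [listEdges, Cmd.wp, Cmd.wp_count, Expr.Safe, Expr.eval]
  refine ⟨trivial, by omega, ?_⟩
  refine Run.conseq (Run.countConst (fun i σ' => ∃ p, Emitting p K S Nl
    ((List.range' (m - i) i).reverse.flatMap (finAt K S Nl)) σ') 220 (H := m) (by simpa using hm)
    (by decide) rfl rfl (fun _ _ _ _ ⟨p, h⟩ => ⟨p, h.k, h.kind, h.sec, h.nul, h.ec, h.edges⟩)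
    (fun _ _ _ ⟨p, h⟩ => ⟨p, h.tick _⟩) ?_ ?_) fun σ₁ hb₁ hF₁ h₁ => ?_
  · exact ⟨_, rfl, hK.symm, hS.symm, hNl.symm, by simp, fun k hk => by simp at hk⟩
  · rintro i hi σ' hF hv hm' ⟨p, hI⟩
    have hl := length_flatMap_le (length_finAt (K := K) (S := S) (Nl := Nl))
      (List.range' (m - i) i).reverse
    simp only [List.length_reverse, List.length_range'] at hl
    refine Run.intro fun hb' => ?_
    simp only [Cmd.wp, Expr.Safe, Expr.eval, hv, hm']
    refine ⟨by simp, by omega, Run.block ?_⟩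
    refine Run.conseq (finBody_spec (m := m) (hI.move _ (m - 1 - i)) (by omega) (hsec _)
      (by omega) (by omega)) fun σ₂ _ _ h₂ => ⟨⟨m - 1 - i, ?_⟩, ?_⟩
    · have e : List.range' (m - (i + 1)) (i + 1) = (m - 1 - i) :: List.range' (m - i) i := by
        rw [List.range'_succ]; congr 1 <;> [omega; (congr 1; omega)]
      rw [e, List.reverse_cons, List.flatMap_append]
      simpa using h₂.1
    · have := h₂.2
      simp at this
      omega
  rw [Nat.sub_self, hfin] at h₁
  obtain ⟨⟨p₁, g₁⟩, t₁⟩ := h₁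
  have hm₁ : σ₁.var .m = m := by rw [hF₁.var .m rfl]; simpa using hm
  have hN₁ : σ₁.var .N = 2 * m := by rw [hF₁.var .N rfl, hmd]; simpa using hN
  have hfl : (finE R 0).length ≤ 2 * m := by
    rw [← hfin]
    simpa using length_flatMap_le (length_finAt (K := K) (S := S) (Nl := Nl))
      (List.range' 0 m).reverse
  refine Run.conseq (Run.countConst (fun i σ' => ∃ p, Emitting p K S Nl
    (finE R 0 ++ (List.range' 0 i).flatMap (inAt K S Nl)) σ') 270 (H := m) hm₁
    (by decide) rfl rfl (fun _ _ _ _ ⟨p, h⟩ => ⟨p, h.k, h.kind, h.sec, h.nul, h.ec, h.edges⟩)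
    (fun _ _ _ ⟨p, h⟩ => ⟨p, h.tick _⟩) ?_ ?_) fun σ₂ hb₂ hF₂ h₂ => ?_
  · exact ⟨_, by simpa using g₁⟩
  · rintro i hi σ' hF hv hm' ⟨p, hI⟩
    have hl := length_flatMap_le (length_inAt (K := K) (S := S) (Nl := Nl)) (List.range' 0 i)
    simp only [List.length_range'] at hl
    refine Run.intro fun hb' => ?_
    simp only [Cmd.wp, Expr.Safe, Expr.eval, hv]
    refine ⟨by simp, by omega, Run.block ?_⟩
    refine Run.conseq (inBody_spec (m := m) (hI.move _ i) (by omega) (hsec _)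
      (by omega) (by rw [List.length_append]; omega)) fun σ₂ _ _ h₂ => ⟨⟨i, ?_⟩, ?_⟩
    · rw [List.range'_concat, List.flatMap_append, ← List.append_assoc]
      simpa using h₂.1
    · have := h₂.2
      simp at this
      omega
  rw [hin] at h₂
  obtain ⟨⟨p₂, g₂⟩, t₂⟩ := h₂
  have hm₂ : σ₂.var .m = m := by rw [hF₂.var .m rfl, hm₁]
  have hN₂ : σ₂.var .N = 2 * m := by rw [hF₂.var .N rfl, hN₁]
  have hil : (inE R 0).length ≤ 3 * m := by
    rw [← hin]
    simpa using length_flatMap_le (length_inAt (K := K) (S := S) (Nl := Nl)) (List.range' 0 m)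
  have hel : (edges R).length ≤ 5 * m := by rw [edges, List.length_append]; omega
  change Emitting p₂ K S Nl (edges R) σ₂ at g₂
  refine Run.conseq (Run.countConst (fun i σ' => ∀ k < i, ∀ h : k < (edges R).length,
    σ'.arr .bsrc k = (edges R)[(edges R).length - 1 - k].2 ∧
    σ'.arr .bdst k = (edges R)[(edges R).length - 1 - k].1) 40 (H := (edges R).length) g₂.ec
    (by decide) rfl rfl (fun _ _ _ _ h => h) (fun _ _ _ h => h) ?_ ?_) fun σ₃ hb₃ hF₃ h₃ => ?_
  · intro k hk; omega
  · rintro i hi σ' hF hv hec hI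
    have f1 : σ'.arr .fsrc = σ₂.arr .fsrc := hF.arr _ rfl
    have f2 : σ'.arr .fdst = σ₂.arr .fdst := hF.arr _ rfl
    have he := g₂.edges ((edges R).length - 1 - i) (by omega)
    refine Run.intro fun hb' => ?_
    simp only [Cmd.wp, Expr.Safe, Expr.eval, hv, hec, Store.aset_var, Store.aset_arr,
      reduceCtorEq, if_false, f1, f2, if_true]
    refine ⟨by simp; omega, by simp, by omega, f2 ▸ hb'.2 _ _, by simp; omega, by simp, by omega,
      f1 ▸ hb'.2 _ _, fun k hk hk' => ?_, by simp⟩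
    by_cases h : k = i
    · subst h; simp [he]
    · have := hI k (by omega) hk'
      simpa [Function.update_apply, h] using this
  · have hbw : EdgeArr .bsrc .bdst ((edges R).map Prod.swap).reverse σ₃ := by
      intro k hk
      simp at hk
      simpa using h₃.1 k hk hk
    refine ⟨⟨?_, ?_, ?_, ?_, hbw, ?_, ?_⟩, ?_⟩
    · rw [hF₃.var .m rfl, hm₂, hmd]
    · rw [hF₃.var .N rfl, hN₂, hmd]
    · rw [hF₃.var .ec rfl, g₂.ec]
    · unfold EdgeArr
      rw [hF₃.arr .fsrc rfl, hF₃.arr .fdst rfl]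
      exact g₂.edges
    · intro x hx a
      rw [hF₃.arr .kind rfl, g₂.kind, hT.parsed.mem_letters_iff]
      constructor
      · intro h; exact ⟨by omega, by omega, h⟩
      · intro h; exact h.2.2
    · rw [← hmd]; exact hel
    · have := h₃.2
      rw [← hmd]
      simp at t₁
      omega

end RegexMatch

/-! ### Sampling the trie -/

namespace RegexMatch

open WordRAM

variable {A : ℕ} {E : Env} {R : RegularExpression (Fin A)} {n τ r : ℕ} {str : ℕ → List (Fin A)}

/-- The number of nodes among `1, …, i` whose depth has residue `r` modulo `τ`. -/
def sampled (str : ℕ → List (Fin A)) (τ r i : ℕ) : ℕ :=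
  ((Finset.range i).filter fun j => (str (j + 1)).length % τ = r).card

theorem sampled_zero : sampled str τ r 0 = 0 := rfl

theorem sampled_succ (i : ℕ) : sampled str τ r (i + 1) =
    sampled str τ r i + if (str (i + 1)).length % τ = r then 1 else 0 := by
  rw [sampled, Finset.range_add_one, Finset.filter_insert]
  split_ifs
  · rw [Finset.card_insert_of_notMem (by simp)]; rfl
  · rfl

theorem sampled_mono {i j : ℕ} (h : i ≤ j) : sampled str τ r i ≤ sampled str τ r j :=
  Finset.card_le_card (Finset.filter_subset_filter _ (Finset.range_subset_range.2 h))

theorem sampled_le (i : ℕ) : sampled str τ r i ≤ i :=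
  (Finset.card_filter_le _ _).trans (by simp)

/-- Some residue is rare: the residue classes partition the nodes. -/
theorem exists_sampled_le (hτ : 0 < τ) : ∃ r < τ, sampled str τ r n * τ ≤ n := by
  by_contra! h
  have h1 : ∑ r ∈ Finset.range τ, sampled str τ r n = n := by
    have := Finset.card_eq_sum_card_fiberwise (s := Finset.range n) (t := Finset.range τ)
      (f := fun j => (str (j + 1)).length % τ)
      (fun j _ => by simpa using Nat.mod_lt _ hτ)
    simpa [sampled] using this.symm
  have h2 : ∑ r ∈ Finset.range τ, (n + 1) ≤ ∑ r ∈ Finset.range τ, sampled str τ r n * τ :=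
    Finset.sum_le_sum fun r hr => h r (by simpa using hr)
  rw [← Finset.sum_mul, h1] at h2
  simp only [Finset.sum_const, Finset.card_range, smul_eq_mul] at h2
  have : τ * (n + 1) = n * τ + τ := by ring
  omega

/-- Find a rare residue. -/
def chooseResidue : Cmd :=
  .res ::= .lit 0 ;;
  .count .i .tau
    (.cnt ::= .lit 0 ;;
      .count .j .n
        (.x ::= .arr .dep (Var.j +ₑ .lit 1) ;;
          .ite (.eq (Var.x -ₑ Var.x /ₑ Var.tau *ₑ Var.tau) Var.i)
            (.cnt ::= Var.cnt +ₑ .lit 1) .skip) ;;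
      .ite (.lt (Var.cnt *ₑ Var.tau) (Var.n +ₑ .lit 1)) (.res ::= Var.i) .skip)

theorem chooseResidue_spec {σ : Store} (hT : Trie n str σ) (hτ : σ.var .tau = τ) (hτ0 : 0 < τ)
    (hM : n < E.M) :
    Run E chooseResidue σ fun σ' => (σ'.var .res < τ ∧ sampled str τ (σ'.var .res) n * τ ≤ n) ∧
      σ'.time ≤ σ.time + (τ * (n * 50 + 50) + 20) := by
  have hMU := E.mem_le
  refine Run.intro fun hb => ?_
  simp only [chooseResidue, Cmd.wp, Cmd.wp_count, Expr.Safe, Expr.eval]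
  refine ⟨trivial, by omega, ?_⟩
  refine Run.conseq (Run.countConst (fun i σ' => (∃ r < i, sampled str τ r n * τ ≤ n) →
    σ'.var .res < τ ∧ sampled str τ (σ'.var .res) n * τ ≤ n) (n * 50 + 40) (H := τ)
    (by simpa using hτ) (by decide) rfl rfl (fun _ _ _ _ h => h) (fun _ _ _ h => h) ?_ ?_)
    fun σ' _ _ h => ⟨h.1 (exists_sampled_le hτ0), ?_⟩
  · rintro ⟨r, hr, -⟩; omega
  · intro i hi σ₁ hF₁ hv₁ hτ₁ hI
    have hT₁ : Trie n str σ₁ := (hT.frame (c := .res ::= .lit 0) (σ' := σ.set .res 0 2)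
      ⟨fun v hv => by simp [Cmd.setsVar] at hv; simp [hv], fun _ _ => rfl, fun _ => rfl⟩ rfl).frame
        hF₁ rfl
    refine Run.intro fun hb₁ => ?_
    simp only [Cmd.wp, Cmd.wp_count, Expr.Safe, Expr.eval]
    refine ⟨trivial, by omega, ?_⟩
    refine Run.conseq (Run.countConst (fun j σ' => σ'.var .cnt = sampled str τ i j) 40 (H := n)
      (by simpa using hT₁.n) (by decide) rfl rfl (fun _ _ _ _ h => by simpa using h)
      (fun _ _ _ h => h) ?_ ?_) fun σ₂ hb₂ hF₂ h₂ => ?_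
    · simp [sampled_zero]
    · intro j hj σ₃ hF₃ hv₃ _ hI₃
      have e1 : σ₃.var .tau = τ := by rw [hF₃.var .tau rfl]; simpa using hτ₁
      have e2 : σ₃.var .i = i := by rw [hF₃.var .i rfl]; simpa using hv₁
      have e3 : σ₃.arr .dep (j + 1) = (str (j + 1)).length := by
        rw [hF₃.arr .dep rfl]; simpa using hT₁.dep (j + 1) (by omega)
      have hl := hT.isTrie.length_str_le (v := j + 1) (by omega)
      have hs := sampled_le (str := str) (τ := τ) (r := i) j
      refine Run.intro fun hb₃ => ?_
      simp only [Cmd.wp, Expr.Safe, Expr.eval, Cond.Safe, Cond.Holds, hv₃, e1, e2, e3,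
        Store.tick_var, Store.set_var, if_true, reduceCtorEq, if_false, hI₃,
        ← Nat.mod_eq_sub_div_mul]
      refine ⟨by simp; omega, by omega, by simp; omega, fun c => ?_, fun c => ?_⟩
      · refine ⟨by simp, by omega, ?_, by simp⟩
        simp [sampled_succ, c]
      · refine ⟨?_, by simp⟩
        simp [sampled_succ, c]
    · obtain ⟨h₂, t₂⟩ := h₂
      have e1 : σ₂.var .tau = τ := by rw [hF₂.var .tau rfl]; simpa using hτ₁
      have e2 : σ₂.var .i = i := by rw [hF₂.var .i rfl]; simpa using hv₁
      have e3 : σ₂.var .n = n := by rw [hF₂.var .n rfl]; simpa using hT₁.n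
      have e4 : σ₂.var .res = σ₁.var .res := by rw [hF₂.var .res rfl]; simp
      have hiU := hb₂.1 .i
      rw [e2] at hiU
      simp only [Cond.Safe, Cond.Holds, Expr.Safe, Expr.eval, h₂, e1, e2, e3, Expr.cost, Cond.cost,
        Store.tick_var]
      simp at t₂
      refine ⟨by simp, fun c => ⟨trivial, hiU, fun _ => ?_, ?_⟩, fun c => ⟨?_, ?_⟩⟩
      · simp only [Store.set_var, if_true]; omega
      · simp; omega
      · rintro ⟨r, hr, hrn⟩
        rw [e4]
        rcases Nat.lt_succ_iff_lt_or_eq.1 hr with h | rfl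
        · exact hI ⟨r, h, hrn⟩
        · omega
      · simp; omega
  · have := h.2
    simp at this
    have e : τ * (n * 50 + 50) = τ * (n * 50 + 40 + 7) + τ * 3 := by ring
    omega

/-- The nodes of the sample up to node `i` are marked in `sel`, and the array `rel` holds the
transition relations of their words: `sel v = k + 2` means that the relation of `v` is in block `k`.
The root is marked by `1`, other nodes by `0`. -/
structure Blocks (R : RegularExpression (Fin A)) (str : ℕ → List (Fin A)) (τ r i : ℕ)
    (sel rel : ℕ → ℕ) : Prop where
  root : sel 0 = 1
  sel : ∀ j < i, sel (j + 1) =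
    if (str (j + 1)).length % τ = r then sampled str τ r j + 2 else 0
  rel : ∀ j < i, (str (j + 1)).length % τ = r → ∀ s < 2 * R.written.length,
    ∀ t < 2 * R.written.length, rel ((sampled str τ r j * (2 * R.written.length) + s) *
      (2 * R.written.length) + t) = 1 ↔ Rel R (str (j + 1)) s t

theorem Blocks.of_marked {i u : ℕ} {sel rel : ℕ → ℕ} (h : Blocks R str τ r i sel rel) (hu : u ≤ i)
    (h0 : sel u ≠ 0) : (u = 0 ∧ sel u = 1) ∨ ∃ k, sel u = k + 2 ∧ k < sampled str τ r i ∧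
      ∀ s < 2 * R.written.length, ∀ t < 2 * R.written.length,
        rel ((k * (2 * R.written.length) + s) * (2 * R.written.length) + t) = 1 ↔
          Rel R (str u) s t := by
  rcases Nat.eq_zero_or_pos u with rfl | hu0
  · exact .inl ⟨rfl, h.root⟩
  · obtain ⟨j, rfl⟩ := Nat.exists_eq_add_one_of_ne_zero hu0.ne'
    have h1 := h.sel j (by omega)
    by_cases hr : (str (j + 1)).length % τ = r
    · rw [if_pos hr] at h1
      refine .inr ⟨_, h1, ?_, h.rel j (by omega) hr⟩
      have := sampled_mono (str := str) (τ := τ) (r := r) (show j + 1 ≤ i by omega)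
      rw [sampled_succ, if_pos hr] at this
      omega
    · rw [if_neg hr] at h1; exact absurd h1 h0

theorem block_lt {N c M k s t : ℕ} (hM : c * (N * N) ≤ M) (hk : k < c) (hs : s < N) (ht : t < N) :
    (k * N + s) * N + t < M := by
  have h1 : (k * N + s) * N + t < (k * N + s + 1) * N := by rw [add_mul _ 1]; omega
  have h2 : (k * N + s + 1) * N ≤ ((k + 1) * N) * N :=
    Nat.mul_le_mul_right _ (by rw [add_mul]; omega)
  have h3 : ((k + 1) * N) * N ≤ c * (N * N) := by
    rw [mul_assoc]; exact Nat.mul_le_mul_right _ hk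
  omega

theorem mul_add_inj {N a b t t' : ℕ} (ht : t < N) (ht' : t' < N) (h : a * N + t = b * N + t') :
    a = b ∧ t = t' := by
  have key : ∀ a t, t < N → (a * N + t) / N = a := fun a t ht => by
    rw [mul_comm, Nat.mul_add_div (by omega), Nat.div_eq_of_lt ht, add_zero]
  have e : a = b := by rw [← key a t ht, h, key b t' ht']
  subst e
  exact ⟨rfl, by omega⟩

/-- Put into `X` the row `s` of the relation of the marked node `up`. -/
def loadRow : Cmd :=
  .ite (.eq (.arr .sel Var.up) (.lit 1))
    (.count .t .N (.aset .X Var.t (.lit 0)) ;; .aset .X Var.s (.lit 1))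
    (.blk ::= .arr .sel Var.up -ₑ .lit 2 ;; .count .t .N (.aset .X Var.t (.arr .rel relIx)))

theorem rel_lt_left {u : List (Fin A)} {i j : ℕ} (hj : j < 2 * R.written.length)
    (h : Rel R u i j) : i < 2 * R.written.length := by
  cases u with
  | nil => cases h; exact hj
  | cons a u =>
    obtain ⟨k, ⟨l, hl, hk⟩, -⟩ := h
    exact path_lt_left (lett_lt hk).1 hl

theorem loadRow_spec {σ : Store} {i u s : ℕ} (hB : Blocks R str τ r i (σ.arr .sel) (σ.arr .rel))
    (hN : σ.var .N = 2 * R.written.length) (hu : u ≤ i) (hi : i ≤ n) (hup : σ.var .up = u)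
    (hun : u < E.M) (h0 : σ.arr .sel u ≠ 0) (hs : σ.var .s = s) (hsN : s < 2 * R.written.length)
    (hM : sampled str τ r n * (2 * R.written.length * (2 * R.written.length)) ≤ E.M)
    (hNM : 2 * R.written.length ≤ E.M) (hstr : str 0 = []) :
    Run E (.block loadRow) σ fun σ' =>
      Vec .X (2 * R.written.length) {t | Rel R (str u) s t} σ' ∧
      σ'.time ≤ σ.time + (R.written.length * 80 + 40) := by
  have h1 := E.one_lt
  refine Run.block (Run.intro fun hb => ?_)
  simp only [loadRow, Cmd.wp, Cmd.wp_count, Expr.Safe, Expr.eval, Cond.Safe, Cond.Holds,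
    Store.tick_var, Store.tick_arr, hup]
  refine ⟨by simp; omega, fun c => ?_, fun c => ?_⟩
  · obtain ⟨rfl, -⟩ : u = 0 ∧ σ.arr .sel u = 1 := by
      rcases hB.of_marked hu h0 with h | ⟨k, h, -⟩
      · exact h
      · omega
    refine Run.conseq (Run.countConst (fun k σ' => ∀ t < k, σ'.arr .X t = 0) 20
      (H := 2 * R.written.length) (by simpa using hN) (by decide) rfl rfl (fun _ _ _ _ h => h)
      (fun _ _ _ h => h) (by simp) ?_) fun σ₁ hb₁ hF₁ h₁ => ?_
    · intro k hk σ₁ hF₁ hv₁ _ hI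
      refine Run.intro fun hb₁ => ?_
      simp only [Cmd.wp, Expr.Safe, Expr.eval, hv₁]
      refine ⟨trivial, trivial, by omega, by omega, fun t ht => ?_, by simp⟩
      simp only [Store.aset_arr, if_true, Function.update_apply]
      split_ifs with h
      · rfl
      · exact hI t (by omega)
    · have e1 : σ₁.var .s = s := by rw [hF₁.var .s rfl]; simpa using hs
      simp only [e1]
      refine ⟨trivial, trivial, by omega, h1, ⟨fun t ht => ?_, fun t ht => ?_⟩, ?_⟩
      · simp only [Store.aset_arr, if_true, Function.update_apply, Set.mem_ofPred_eq, hstr, Rel]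
        have := h₁.1 t ht
        split_ifs with h
        · simp [h]
        · simp [this, Ne.symm h]
      · exact rel_lt hsN ht
      · have := h₁.2
        simp at this ⊢
        omega
  · obtain ⟨b, hb1, hb2, hb3⟩ : ∃ k, σ.arr .sel u = k + 2 ∧ k < sampled str τ r i ∧
      ∀ s < 2 * R.written.length, ∀ t < 2 * R.written.length,
        σ.arr .rel ((k * (2 * R.written.length) + s) * (2 * R.written.length) + t) = 1 ↔
          Rel R (str u) s t := by
      rcases hB.of_marked hu h0 with h | h
      · exact absurd h.2 c
      · exact h
    have hb4 := hb.2 .sel u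
    have hbn := hb2.trans_le (sampled_mono hi)
    refine ⟨by simp; omega, by omega, ?_⟩
    refine Run.conseq (Run.countConst (fun k σ' => ∀ t < k, σ'.arr .X t = 1 ↔ Rel R (str u) s t) 30
      (H := 2 * R.written.length) (by simpa using hN) (by decide) rfl rfl (fun _ _ _ _ h => h)
      (fun _ _ _ h => h) (by simp) ?_) fun σ₁ hb₁ hF₁ h₁ => ?_
    · intro k hk σ₁ hF₁ hv₁ hN₁ hI
      have e1 : σ₁.var .s = s := by rw [hF₁.var .s rfl]; simpa using hs
      have e2 : σ₁.var .blk = b := by rw [hF₁.var .blk rfl]; simp [hb1]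
      have e3 : σ₁.arr .rel = σ.arr .rel := by rw [hF₁.arr .rel rfl]; simp
      refine Run.intro fun hb₁ => ?_
      simp only [Cmd.wp, relIx, Expr.Safe, Expr.eval, hv₁, e1, e2, e3, hN₁]
      refine ⟨by simpa using block_lt hM hbn hsN hk, by simp, by omega, e3 ▸ hb₁.2 _ _,
        fun t ht => ?_, by simp⟩
      simp only [Store.aset_arr, if_true, Function.update_apply]
      split_ifs with h
      · rw [h]; exact hb3 s hsN k hk
      · exact hI t (by omega)
    · refine ⟨⟨h₁.1, fun t ht => rel_lt hsN ht⟩, ?_⟩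
      have := h₁.2
      simp at this
      omega

/-- Compute the transition relation of the word of node `nd` into block `cnt`, row by row. -/
def fillBlock : Cmd :=
  .count .s .N
    (.up ::= Var.nd ;; upwalk ;; .block loadRow ;; walk ;; .blk ::= Var.cnt ;;
      .count .t .N (.aset .rel relIx (.arr .X Var.t)))

theorem wp_walk (Q : Store → Prop) (σ : Store) : walk.wp E Q σ = Run E walk σ Q := rfl

theorem wp_upwalk (Q : Store → Prop) (σ : Store) : upwalk.wp E Q σ = Run E upwalk σ Q := rfl

theorem Blocks.marked {i : ℕ} {sel rel : ℕ → ℕ} (h : Blocks R str τ r i sel rel) :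
    ∀ u ≤ i, u ≠ 0 → (str u).length % τ = r → sel u ≠ 0 := by
  intro u hu h0 hr
  obtain ⟨j, rfl⟩ := Nat.exists_eq_add_one_of_ne_zero h0
  rw [h.sel j (by omega), if_pos hr]
  omega

theorem fillBlock_spec {σ : Store} {i : ℕ} (hT : Trie n str σ) (hA : Auto R σ)
    (hB : Blocks R str τ r i (σ.arr .sel) (σ.arr .rel)) (hi : i < n) (hr : r < τ)
    (hnd : σ.var .nd = i + 1) (hcnt : σ.var .cnt = sampled str τ r i)
    (hsel : σ.arr .sel (i + 1) = 0) (hres : (str (i + 1)).length % τ = r)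
    (hM : sampled str τ r n * (2 * R.written.length * (2 * R.written.length)) ≤ E.M)
    (hmM : 5 * R.written.length ≤ E.M) (hnM : n < E.M) :
    Run E fillBlock σ fun σ' => (Blocks R str τ r i (σ.arr .sel) (σ'.arr .rel) ∧
      ∀ s < 2 * R.written.length, ∀ t < 2 * R.written.length,
        σ'.arr .rel ((sampled str τ r i * (2 * R.written.length) + s) *
          (2 * R.written.length) + t) = 1 ↔ Rel R (str (i + 1)) s t) ∧
      σ'.time ≤ σ.time +
        (2 * R.written.length * (τ * (R.written.length * 330 + 40) + R.written.length * 200 + 200)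
          + 20) := by
  have hMU := E.mem_le
  have h1U := E.one_lt
  have hc : sampled str τ r i < sampled str τ r n := by
    have := sampled_mono (str := str) (τ := τ) (r := r) (show i + 1 ≤ n by omega)
    rw [sampled_succ, if_pos hres] at this
    omega
  have hcn := sampled_le (str := str) (τ := τ) (r := r) n
  refine Run.conseq (Run.countConst (fun s' σ' => Blocks R str τ r i (σ.arr .sel) (σ'.arr .rel) ∧
      ∀ s < s', ∀ t < 2 * R.written.length,
        σ'.arr .rel ((sampled str τ r i * (2 * R.written.length) + s) *
          (2 * R.written.length) + t) = 1 ↔ Rel R (str (i + 1)) s t)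
      (τ * (R.written.length * 330 + 40) + R.written.length * 200 + 190) hA.N (by decide) rfl rfl
      (fun _ _ _ _ h => h) (fun _ _ _ h => h) ⟨hB, by simp⟩ ?_) fun σ' _ _ h => ⟨h.1, ?_⟩
  · rintro s hs σ₁ hF₁ hv₁ hN₁ ⟨hI, hI'⟩
    have hsel₁ : σ₁.arr .sel = σ.arr .sel := hF₁.arr .sel rfl
    have hnd₁ : σ₁.var .nd = i + 1 := by rw [hF₁.var .nd rfl, hnd]
    have hcnt₁ : σ₁.var .cnt = sampled str τ r i := by rw [hF₁.var .cnt rfl, hcnt]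
    have hT₁ := hT.frame hF₁ rfl
    have hA₁ := hA.frame hF₁ rfl
    refine Run.intro fun hb₁ => ?_
    simp only [Cmd.wp, Cmd.wp_count, Expr.Safe, Expr.eval, hnd₁, wp_walk, wp_upwalk]
    refine ⟨trivial, by omega, ?_⟩
    refine Run.conseq (upwalk_spec (v := i + 1) (τ := τ) (r := r) (n := n) (str := str)
      ⟨hT₁.isTrie, hT₁.dep, by simpa using hT₁.n⟩ (by omega) (by simp) hr ?_ ?_ hnM)
      fun σ₂ hb₂ hF₂ ⟨⟨u, w, g1, g2, g3, g4, g5, g6, g7⟩, t₂⟩ => ?_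
    · simp only [Store.set_arr, hsel₁, hB.root]; omega
    · intro u hu hu0 hur
      simp only [Store.set_arr, hsel₁]
      exact hB.marked u (by omega) hu0 hur
    simp only [Store.set_arr, hsel₁] at g3
    have hT₂ : Trie n str σ₂ := by
      refine Trie.frame (σ := σ₁.set .up (i + 1) 2) ?_ hF₂ rfl
      exact ⟨hT₁.isTrie, hT₁.dep, by simpa using hT₁.n⟩
    have hA₂ : Auto R σ₂ := by
      refine Auto.frame (σ := σ₁.set .up (i + 1) 2) ?_ hF₂ rfl
      exact hA₁.agree ⟨by simp, by simp⟩
    have hu : u ≤ i := by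
      rcases Nat.lt_or_eq_of_le g2 with h | h
      · omega
      · rw [h] at g3; exact absurd hsel g3
    have hsel₂ : σ₂.arr .sel = σ.arr .sel := by rw [hF₂.arr .sel rfl]; simpa using hsel₁
    have hrel₂ : σ₂.arr .rel = σ₁.arr .rel := by rw [hF₂.arr .rel rfl]; simp
    have hs₂ : σ₂.var .s = s := by rw [hF₂.var .s rfl]; simpa using hv₁
    have hcnt₂ : σ₂.var .cnt = sampled str τ r i := by rw [hF₂.var .cnt rfl]; simpa using hcnt₁
    refine Run.conseq (loadRow_spec (n := n) (i := i) (u := u) (s := s) (str := str) (τ := τ)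
      (r := r) (R := R) (by rw [hsel₂, hrel₂]; exact hI) hA₂.N hu hi.le g1 (by omega)
      (by rw [hsel₂]; exact g3) hs₂ hs hM
      (by omega) hT.isTrie.str_zero) fun σ₃ hb₃ hF₃ ⟨hX₃, t₃⟩ => ?_
    have hwl : w.length ≤ n := by
      have := hT.isTrie.length_str_le (v := i + 1) (by omega)
      rw [g4, List.length_append] at this
      omega
    refine Run.conseq (walk_spec (w := w) (hA₂.frame hF₃ rfl) (by rw [hF₃.var .sp rfl, g6])
      (by rw [hF₃.arr .stk rfl]; exact g7) (by omega) hmM hX₃)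
      fun σ₄ hb₄ hF₄ ⟨hX₄, t₄⟩ => ?_
    have hX₄' : Vec .X (2 * R.written.length) {t | Rel R (str (i + 1)) s t} σ₄ := by
      convert hX₄ using 1
      ext t
      simp only [Set.mem_ofPred_eq, g4, rel_append]
    have hrel₄ : σ₄.arr .rel = σ₁.arr .rel := by rw [hF₄.arr .rel rfl, hF₃.arr .rel rfl, hrel₂]
    have hs₄ : σ₄.var .s = s := by rw [hF₄.var .s rfl, hF₃.var .s rfl, hs₂]
    have hcnt₄ : σ₄.var .cnt = sampled str τ r i := by
      rw [hF₄.var .cnt rfl, hF₃.var .cnt rfl, hcnt₂]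
    have hN₄ : σ₄.var .N = 2 * R.written.length := by
      rw [hF₄.var .N rfl, hF₃.var .N rfl, hA₂.N]
    simp only [hcnt₄]
    refine ⟨trivial, by omega, ?_⟩
    refine Run.conseq (Run.countConst (fun t' σ' => Blocks R str τ r i (σ.arr .sel) (σ'.arr .rel) ∧
      (∀ s' < s, ∀ t < 2 * R.written.length,
        σ'.arr .rel ((sampled str τ r i * (2 * R.written.length) + s') *
          (2 * R.written.length) + t) = 1 ↔ Rel R (str (i + 1)) s' t) ∧
      ∀ t < t', σ'.arr .rel ((sampled str τ r i * (2 * R.written.length) + s) *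
          (2 * R.written.length) + t) = 1 ↔ Rel R (str (i + 1)) s t)
      30 (H := 2 * R.written.length) (by simpa using hN₄) (by decide) rfl rfl
      (fun _ _ _ _ h => h) (fun _ _ _ h => h) ?_ ?_) fun σ₅ hb₅ hF₅ ⟨⟨h5, h6, h7⟩, t₅⟩ =>
        ⟨⟨h5, fun s' hs' => ?_⟩, ?_⟩
    · simp only [Store.set_arr, hrel₄]
      exact ⟨hI, hI', by simp⟩
    · rintro t ht σ₅ hF₅ hv₅ hN₅ ⟨h5, h6, h7⟩
      have e1 : σ₅.var .s = s := by rw [hF₅.var .s rfl]; simpa using hs₄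
      have e2 : σ₅.var .blk = sampled str τ r i := by rw [hF₅.var .blk rfl]; simp
      have e3 : σ₅.arr .X = σ₄.arr .X := by rw [hF₅.arr .X rfl]; simp
      have hlt := block_lt hM hc hs ht
      refine Run.intro fun hb₅ => ?_
      simp only [Cmd.wp, relIx, Expr.Safe, Expr.eval, hv₅, e1, e2, e3, hN₅]
      have upd : ∀ k s' t', s' < 2 * R.written.length → t' < 2 * R.written.length →
          ¬ (k = sampled str τ r i ∧ s' = s ∧ t' = t) →
          (k * (2 * R.written.length) + s') * (2 * R.written.length) + t' ≠
            (sampled str τ r i * (2 * R.written.length) + s) * (2 * R.written.length) + t := by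
        intro k s' t' hs' ht' hne h
        obtain ⟨ha, hb⟩ := mul_add_inj ht' ht h
        obtain ⟨ha, hc⟩ := mul_add_inj hs' hs ha
        exact hne ⟨ha, hc, hb⟩
      refine ⟨by simp; omega, by simp, hlt, e3 ▸ hb₅.2 _ _,
        ⟨⟨h5.root, h5.sel, fun j hj hjr s' hs' t' ht' => ?_⟩, fun s' hs' t' ht' => ?_,
          fun t' ht' => ?_⟩, by simp⟩
      · simp only [Store.aset_arr, if_true]
        rw [Function.update_of_ne (upd _ _ _ hs' ht' ?_)]
        · exact h5.rel j hj hjr s' hs' t' ht'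
        · rintro ⟨h, -⟩
          have := sampled_mono (str := str) (τ := τ) (r := r) (show j + 1 ≤ i by omega)
          rw [sampled_succ, if_pos hjr] at this
          omega
      · simp only [Store.aset_arr, if_true]
        rw [Function.update_of_ne (upd _ _ _ (by omega) ht' (by omega))]
        exact h6 s' hs' t' ht'
      · simp only [Store.aset_arr, if_true]
        by_cases h : t' = t
        · rw [h, Function.update_self]; exact hX₄'.1 t ht
        · rw [Function.update_of_ne (upd _ _ _ hs (by omega) (by omega))]
          exact h7 t' (by omega)
    · rcases Nat.lt_succ_iff_lt_or_eq.1 hs' with h | rfl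
      · exact h6 s' h
      · exact h7
    · have : w.length * (R.written.length * 330) ≤ τ * (R.written.length * 330) :=
        Nat.mul_le_mul_right _ g5
      simp at t₂ t₅
      rw [mul_add]
      omega
  · have e : ∀ a N x : ℕ, a ≤ σ.time + (N * (x + 190 + 7) + 5) →
        a ≤ σ.time + (N * (x + 200) + 20) := fun a N x h =>
      h.trans (Nat.add_le_add_left (add_le_add (Nat.mul_le_mul_left _ (by omega)) (by omega)) _)
    exact e _ _ _ h.2

end RegexMatch

/-! ### The table of matching ancestors -/

namespace RegexMatch

open WordRAM

variable {A : ℕ} {E : Env} {R : RegularExpression (Fin A)} {n τ r : ℕ} {str : ℕ → List (Fin A)}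

/-- Compute the transition relations of the words of all nodes in the sample. -/
def buildBlocks : Cmd :=
  .aset .sel (.lit 0) (.lit 1) ;; .cnt ::= .lit 0 ;;
  .count .i .n
    (.nd ::= Var.i +ₑ .lit 1 ;; .aset .sel Var.nd (.lit 0) ;; .x ::= .arr .dep Var.nd ;;
      .ite (.eq (Var.x -ₑ Var.x /ₑ Var.tau *ₑ Var.tau) Var.res)
        (fillBlock ;; .aset .sel Var.nd (Var.cnt +ₑ .lit 2) ;; .cnt ::= Var.cnt +ₑ .lit 1) .skip)

theorem wp_fillBlock (Q : Store → Prop) (σ : Store) :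
    fillBlock.wp E Q σ = Run E fillBlock σ Q := rfl

theorem Blocks.update {i : ℕ} {sel rel : ℕ → ℕ} (h : Blocks R str τ r i sel rel) (x : ℕ) :
    Blocks R str τ r i (Function.update sel (i + 1) x) rel :=
  ⟨by rw [Function.update_of_ne (by omega)]; exact h.root,
    fun j hj => by rw [Function.update_of_ne (by omega)]; exact h.sel j hj, h.rel⟩

theorem sum_sampled (a b n : ℕ) : ∑ i ∈ Finset.range n,
    (a + if (str (i + 1)).length % τ = r then b else 0) = n * a + sampled str τ r n * b := by
  induction n with
  | zero => simp [sampled_zero]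
  | succ n ih =>
    rw [Finset.sum_range_succ, ih, sampled_succ]
    split_ifs <;> ring

theorem buildBlocks_spec {σ : Store} (hT : Trie n str σ) (hA : Auto R σ) (hτ : σ.var .tau = τ)
    (hr : r < τ) (hres : σ.var .res = r)
    (hM : sampled str τ r n * (2 * R.written.length * (2 * R.written.length)) ≤ E.M)
    (hmM : 5 * R.written.length ≤ E.M) (hnM : n < E.M) :
    Run E buildBlocks σ fun σ' => Blocks R str τ r n (σ'.arr .sel) (σ'.arr .rel) ∧
      σ'.time ≤ σ.time + (n * 80 + sampled str τ r n *
        (2 * R.written.length * (τ * (R.written.length * 330 + 40) + R.written.length * 200 + 200)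
          + 50) + 40) := by
  have hMU := E.mem_le
  have h1U := E.one_lt
  refine Run.intro fun hb => ?_
  simp only [buildBlocks, Cmd.wp, Cmd.wp_count, Expr.Safe, Expr.eval]
  refine ⟨trivial, trivial, by omega, by omega, trivial, by omega, ?_⟩
  generalize hY : 2 * R.written.length * (τ * (R.written.length * 330 + 40) +
    R.written.length * 200 + 200) = Y
  refine Run.conseq (Run.count (fun i σ' => Blocks R str τ r i (σ'.arr .sel) (σ'.arr .rel) ∧
      σ'.var .cnt = sampled str τ r i)
    (fun i => 60 + if (str (i + 1)).length % τ = r then Y + 50 else 0)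
    (H := n) (by simpa using hT.n) (by decide) rfl rfl (fun _ _ _ _ h => by simpa using h)
    (fun _ _ _ h => h) ?_ ?_) fun σ' _ _ h => ⟨h.1.1, ?_⟩
  · exact ⟨⟨by simp, by simp, by simp⟩, by simp [sampled_zero]⟩
  · rintro i hi σ₁ hF₁ hv₁ - ⟨hB, hcnt⟩
    have hT₁ : Trie n str σ₁ := by
      refine Trie.frame (σ := (σ.aset .sel 0 1 7).set .cnt 0 2) ?_ hF₁ rfl
      exact ⟨by simpa using hT.isTrie, by simpa using hT.dep, by simpa using hT.n⟩
    have hA₁ : Auto R σ₁ := by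
      refine Auto.frame (σ := (σ.aset .sel 0 1 7).set .cnt 0 2) ?_ hF₁ rfl
      exact hA.agree ⟨by simp, by simp⟩
    have e1 : σ₁.var .tau = τ := by rw [hF₁.var .tau rfl]; simpa using hτ
    have e2 : σ₁.var .res = r := by rw [hF₁.var .res rfl]; simpa using hres
    have e3 : σ₁.arr .dep (i + 1) = (str (i + 1)).length := hT₁.dep _ (by omega)
    have hl := hT.isTrie.length_str_le (v := i + 1) (by omega)
    have hs := sampled_le (str := str) (τ := τ) (r := r) i
    refine Run.intro fun hb₁ => ?_
    simp only [Cmd.wp, wp_fillBlock, Expr.Safe, Expr.eval, Cond.Safe, Cond.Holds, hv₁, e1, e2, e3,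
      Store.tick_var, Store.set_var, if_true, reduceCtorEq, if_false, Store.aset_var, Store.set_arr,
      Store.aset_arr, ← Nat.mod_eq_sub_div_mul]
    refine ⟨by simp, by omega, by simp, by simp, by omega, by omega, by simp; omega, by omega,
      by simp; omega, fun c => ?_, fun c => ?_⟩
    · refine Run.conseq (fillBlock_spec (i := i) (R := R) (n := n) (str := str) (r := r) (τ := τ)
        ⟨by simpa using hT₁.isTrie, by simpa using hT₁.dep, by simpa using hT₁.n⟩
        (hA₁.agree ⟨by simp, by simp⟩) (by simpa using hB.update 0) hi hr (by simp)
        (by simpa using hcnt) (by simp) c hM hmM hnM) fun σ₂ hb₂ hF₂ ⟨⟨hB₂, hrel⟩, t₂⟩ => ?_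
      rw [hY] at t₂
      have f1 : σ₂.var .nd = i + 1 := by rw [hF₂.var .nd rfl]; simp
      have f2 : σ₂.var .cnt = sampled str τ r i := by rw [hF₂.var .cnt rfl]; simpa using hcnt
      have f3 : σ₂.arr .sel = Function.update (σ₁.arr .sel) (i + 1) 0 := by
        rw [hF₂.arr .sel rfl]; simp
      simp only [f1, f2, f3]
      refine ⟨by simp, by simp, by omega, by omega, by simp, by omega, ⟨?_, ?_⟩, ?_⟩
      · simp only [Function.update_idem]
        simp only [Store.set_arr, Store.aset_arr, Store.tick_arr, if_true] at hB₂
        have hB₃ := hB₂.update (sampled str τ r i + 2)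
        rw [Function.update_idem] at hB₃
        refine ⟨hB₃.root, fun j hj => ?_, fun j hj hjr => ?_⟩
        · rcases Nat.lt_succ_iff_lt_or_eq.1 hj with h | rfl
          · exact hB₃.sel j h
          · rw [Function.update_self, if_pos c]
        · rcases Nat.lt_succ_iff_lt_or_eq.1 hj with h | rfl
          · exact hB₃.rel j h hjr
          · exact hrel
      · simp [sampled_succ, c]
      · rw [if_pos c]
        simp at t₂ ⊢
        omega
    · refine ⟨⟨?_, ?_⟩, ?_⟩
      · simp only [Store.tick_arr, Store.set_arr, Store.aset_arr, if_true, reduceCtorEq, if_false]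
        have hB₃ := hB.update 0
        refine ⟨hB₃.root, fun j hj => ?_, fun j hj hjr => ?_⟩
        · rcases Nat.lt_succ_iff_lt_or_eq.1 hj with h | rfl
          · exact hB₃.sel j h
          · rw [Function.update_self, if_neg c]
        · rcases Nat.lt_succ_iff_lt_or_eq.1 hj with h | rfl
          · exact hB₃.rel j h hjr
          · exact absurd hjr c
      · simp [sampled_succ, c, hcnt]
      · rw [if_neg c]; simp
  · have := h.2
    rw [sum_sampled] at this
    simp at this
    omega

/-- Put the singleton set of `k` into `X`. -/
def single (k : ℕ) : Cmd :=
  .block (.count .s .N (.aset .X Var.s (.lit 0)) ;; .aset .X (.lit k) (.lit 1))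

theorem wp_single (k : ℕ) (Q : Store → Prop) (σ : Store) :
    (single k).wp E Q σ = Run E (single k) σ Q := rfl

theorem single_spec {σ : Store} {N k : ℕ} (hN : σ.var .N = N) (hk : k < N) (hM : N ≤ E.M) :
    Run E (single k) σ fun σ' => Vec .X N {k} σ' ∧ σ'.time ≤ σ.time + (N * 20 + 20) := by
  have h1U := E.one_lt
  refine Run.block (Run.seq ?_)
  refine (Run.countConst (fun k σ' => ∀ t < k, σ'.arr .X t = 0) 12 hN (by decide) rfl rfl
    (fun _ _ _ _ h => h) (fun _ _ _ h => h) (by simp) ?_).conseq fun σ₁ hb₁ hF₁ h₁ => ?_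
  · intro k hk σ₁ hF₁ hv₁ _ hI
    refine Run.intro fun hb₁ => ?_
    simp only [Cmd.wp, Expr.Safe, Expr.eval, hv₁]
    refine ⟨trivial, trivial, by omega, by omega, fun t ht => ?_, by simp⟩
    simp only [Store.aset_arr, if_true, Function.update_apply]
    split_ifs with h
    · rfl
    · exact hI t (by omega)
  · refine Run.intro fun hb₁ => ?_
    simp only [Cmd.wp, Expr.Safe, Expr.eval]
    refine ⟨trivial, trivial, by omega, h1U, ⟨fun t ht => ?_, fun t ht => ?_⟩, ?_⟩
    · simp only [Store.aset_arr, if_true, Function.update_apply, Set.mem_singleton_iff]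
      have := h₁.1 t ht
      split_ifs with h
      · simp [h]
      · simp [this, h]
    · rw [Set.mem_singleton_iff.1 ht]; exact hk
    · have := h₁.2
      simp at this ⊢
      omega

/-- Let the set in `X` read the word of the marked node `up`: forwards for `out = t` and `inn = s`,
backwards for `out = s` and `inn = t`. -/
def jump (out inn : Var) : Cmd :=
  .block (.ite (.eq (.arr .sel Var.up) (.lit 1)) .skip
    (.blk ::= .arr .sel Var.up -ₑ .lit 2 ;; image out inn))

theorem wp_jump (out inn : Var) (Q : Store → Prop) (σ : Store) :
    (jump out inn).wp E Q σ = Run E (jump out inn) σ Q := rfl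

theorem jump_spec_forward {σ : Store} {u : ℕ} {S : Set ℕ}
    (hB : Blocks R str τ r n (σ.arr .sel) (σ.arr .rel)) (hN : σ.var .N = 2 * R.written.length)
    (hup : σ.var .up = u) (hu : u ≤ n) (h0 : σ.arr .sel u ≠ 0) (hstr : str 0 = [])
    (hM : sampled str τ r n * (2 * R.written.length * (2 * R.written.length)) ≤ E.M)
    (hmM : 5 * R.written.length ≤ E.M) (hnM : n < E.M) (hX : Vec .X (2 * R.written.length) S σ) :
    Run E (jump .t .s) σ fun σ' =>
    Vec .X (2 * R.written.length) {j | ∃ i ∈ S, Rel R (str u) i j} σ' ∧ σ'.time ≤ σ.time +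
      (2 * R.written.length * (2 * R.written.length * 50 + 70) + 50) := by
  refine Run.block (Run.intro fun hb => ?_)
  simp only [Cmd.wp, Expr.Safe, Expr.eval, Cond.Safe, Cond.Holds, hup, Store.tick_var,
    Store.tick_arr]
  refine ⟨by simp; omega, fun c => ⟨?_, by simp⟩, fun c => ?_⟩
  · rcases hB.of_marked hu h0 with h | ⟨k, h, -⟩
    · have e : {j | ∃ i ∈ S, Rel R (str u) i j} = S := by simp [h.1, hstr, Rel]
      rw [e]; exact hX
    · omega
  · obtain ⟨b, hb1, hb2, hb3⟩ := (hB.of_marked hu h0).resolve_left fun h => c h.2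
    refine ⟨by simp; omega, by have := hb.2 .sel u; omega, ?_⟩
    have h := image_spec (out := .t) (inn := .s) (.inl ⟨rfl, rfl⟩)
      (σ := (σ.tick ((Cond.eq (Expr.arr Arr.sel Var.up) (.lit 1)).cost + 1)).set .blk
        (σ.arr .sel u - 2) ((Expr.arr Arr.sel Var.up -ₑ .lit 2).cost + 1))
      (N := 2 * R.written.length) (b := b)
      (f := fun i o => (b * (2 * R.written.length) + i) * (2 * R.written.length) + o)
      (P := fun i o => Rel R (str u) i o) (E := E) (S := S) (by simpa using hN) (by simp [hb1])
      (by omega) (fun σ' h1 h2 => by simp [relIx, h1, h2])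
      (fun i hi o ho => block_lt hM hb2 hi ho) (fun i hi o ho => hb3 i hi o ho) hX
      (fun i hi o ho => rel_lt (hX.2 i hi) ho)
    refine Run.conseq h fun σ₁ _ _ h₁ => ⟨h₁.1, ?_⟩
    have := h₁.2
    simp at this
    omega

theorem jump_spec_backward {σ : Store} {u : ℕ} {S : Set ℕ}
    (hB : Blocks R str τ r n (σ.arr .sel) (σ.arr .rel)) (hN : σ.var .N = 2 * R.written.length)
    (hup : σ.var .up = u) (hu : u ≤ n) (h0 : σ.arr .sel u ≠ 0) (hstr : str 0 = [])
    (hM : sampled str τ r n * (2 * R.written.length * (2 * R.written.length)) ≤ E.M)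
    (hmM : 5 * R.written.length ≤ E.M) (hnM : n < E.M) (hX : Vec .X (2 * R.written.length) S σ) :
    Run E (jump .s .t) σ fun σ' =>
    Vec .X (2 * R.written.length) {i | ∃ j ∈ S, Rel R (str u) i j} σ' ∧ σ'.time ≤ σ.time +
      (2 * R.written.length * (2 * R.written.length * 50 + 70) + 50) := by
  refine Run.block (Run.intro fun hb => ?_)
  simp only [Cmd.wp, Expr.Safe, Expr.eval, Cond.Safe, Cond.Holds, hup, Store.tick_var,
    Store.tick_arr]
  refine ⟨by simp; omega, fun c => ⟨?_, by simp⟩, fun c => ?_⟩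
  · rcases hB.of_marked hu h0 with h | ⟨k, h, -⟩
    · have e : {i | ∃ j ∈ S, Rel R (str u) i j} = S := by simp [h.1, hstr, Rel]
      rw [e]; exact hX
    · omega
  · obtain ⟨b, hb1, hb2, hb3⟩ := (hB.of_marked hu h0).resolve_left fun h => c h.2
    refine ⟨by simp; omega, by have := hb.2 .sel u; omega, ?_⟩
    have h := image_spec (out := .s) (inn := .t) (.inr ⟨rfl, rfl⟩)
      (σ := (σ.tick ((Cond.eq (Expr.arr Arr.sel Var.up) (.lit 1)).cost + 1)).set .blk
        (σ.arr .sel u - 2) ((Expr.arr Arr.sel Var.up -ₑ .lit 2).cost + 1))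
      (N := 2 * R.written.length) (b := b)
      (f := fun i o => (b * (2 * R.written.length) + o) * (2 * R.written.length) + i)
      (P := fun i o => Rel R (str u) o i) (E := E) (S := S) (by simpa using hN) (by simp [hb1])
      (by omega) (fun σ' h1 h2 => by simp [relIx, h1, h2])
      (fun i hi o ho => block_lt hM hb2 ho hi) (fun i hi o ho => hb3 o ho i hi) hX
      (fun i hi o ho => rel_lt_left (hX.2 i hi) ho)
    refine Run.conseq h fun σ₁ _ _ h₁ => ⟨h₁.1, ?_⟩
    have := h₁.2
    simp at this
    omega

/-- Compute, for every node and every slot, the nearest ancestor-or-self whose word leads from the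
slot to acceptance. The slots that accept at the node itself are found by running the automaton
backwards from slot `0`; for the others the entry of the parent is copied. -/
def matchTable : Cmd :=
  .count .s .N (.aset .mt Var.s (.lit 0)) ;;
  .count .i .n
    (.nd ::= Var.i +ₑ .lit 1 ;; single 0 ;; .block (relax .bsrc .bdst) ;;
      .up ::= Var.nd ;; upwalk ;; .block walkB ;; jump .s .t ;;
      .count .s .N
        (.ite (.eq (.arr .X Var.s) (.lit 1)) (.aset .mt (Var.nd *ₑ Var.N +ₑ Var.s) Var.nd)
          (.aset .mt (Var.nd *ₑ Var.N +ₑ Var.s)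
            (.arr .mt (.arr .par Var.nd *ₑ Var.N +ₑ Var.s)))))

/-- The array `mt` holds the nearest matching ancestors of the nodes up to `i`. -/
def TableOK (R : RegularExpression (Fin A)) (str : ℕ → List (Fin A)) (par : ℕ → ℕ) (i : ℕ)
    (mt : ℕ → ℕ) : Prop :=
  ∀ v ≤ i, ∀ s < 2 * R.written.length,
    mt (v * (2 * R.written.length) + s) = firstAnc par (fun u => s ∈ Acc R (str u)) v

theorem IsTrie.firstAnc_of_pos {par chr : ℕ → ℕ} (h : IsTrie A n par chr str) {P : ℕ → Prop}
    {v : ℕ} (h0 : v ≠ 0) (hv : v ≤ n) (hP : P v) : firstAnc par P v = v := by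
  rw [firstAnc, dif_pos (h.par_lt h0 hv), if_pos hP]

theorem IsTrie.firstAnc_of_neg {par chr : ℕ → ℕ} (h : IsTrie A n par chr str) {P : ℕ → Prop}
    {v : ℕ} (h0 : v ≠ 0) (hv : v ≤ n) (hP : ¬ P v) : firstAnc par P v = firstAnc par P (par v) := by
  rw [firstAnc, dif_pos (h.par_lt h0 hv), if_neg hP]

theorem matchTable_spec {σ : Store} (hT : Trie n str σ) (hA : Auto R σ) (hr : r < τ)
    (hB : Blocks R str τ r n (σ.arr .sel) (σ.arr .rel))
    (hM : sampled str τ r n * (2 * R.written.length * (2 * R.written.length)) ≤ E.M)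
    (hmM : 5 * R.written.length ≤ E.M) (hnM : n < E.M)
    (hmt : (n + 1) * (2 * R.written.length) ≤ E.M) :
    Run E matchTable σ fun σ' => TableOK R str (σ.arr .par) n (σ'.arr .mt) ∧
      σ'.time ≤ σ.time + (n * (R.written.length * (R.written.length * 200 + 600) +
        τ * (R.written.length * 330 + 40) + 300) + R.written.length * 40 + 20) := by
  have hMU := E.mem_le
  have h1U := E.one_lt
  have hp := length_pos R
  have ix : ∀ v ≤ n, ∀ s < 2 * R.written.length, v * (2 * R.written.length) + s < E.M := by
    intro v hv s hs
    have : v * (2 * R.written.length) ≤ n * (2 * R.written.length) := Nat.mul_le_mul_right _ hv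
    rw [add_mul] at hmt
    omega
  refine Run.intro fun hb => ?_
  simp only [matchTable, Cmd.wp, Cmd.wp_count]
  refine Run.conseq (Run.countConst (fun k σ' => ∀ s < k, σ'.arr .mt s = 0) 12 hA.N (by decide)
    rfl rfl (fun _ _ _ _ h => h) (fun _ _ _ h => h) (by simp) ?_) fun σ₁ hb₁ hF₁ ⟨hz, t₁⟩ => ?_
  · intro k hk σ₁ hF₁ hv₁ _ hI
    refine Run.intro fun hb₁ => ?_
    simp only [Cmd.wp, Expr.Safe, Expr.eval, hv₁]
    refine ⟨trivial, trivial, by omega, by omega, fun t ht => ?_, by simp⟩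
    simp only [Store.aset_arr, if_true, Function.update_apply]
    split_ifs with h
    · rfl
    · exact hI t (by omega)
  have hT₁ := hT.frame hF₁ rfl
  have hA₁ := hA.frame hF₁ rfl
  have hsel₁ : σ₁.arr .sel = σ.arr .sel := hF₁.arr .sel rfl
  have hrel₁ : σ₁.arr .rel = σ.arr .rel := hF₁.arr .rel rfl
  have hpar₁ : σ₁.arr .par = σ.arr .par := hF₁.arr .par rfl
  refine Run.conseq (Run.countConst (fun i σ' => TableOK R str (σ.arr .par) i (σ'.arr .mt))
    (R.written.length * (R.written.length * 200 + 600) +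
        τ * (R.written.length * 330 + 40) + 290) hT₁.n (by decide)
    rfl rfl (fun _ _ _ _ h => h) (fun _ _ _ h => h) ?_ ?_) fun σ₂ hb₂ hF₂ ⟨h₂, t₂⟩ => ⟨h₂, ?_⟩
  · intro v hv s hs
    obtain rfl : v = 0 := by omega
    rw [firstAnc_zero, zero_mul, zero_add, hz s hs]
  · rintro i hi σ₂ hF₂ hv₂ - hI
    have hT₂ := hT₁.frame hF₂ rfl
    have hA₂ := hA₁.frame hF₂ rfl
    have hsel₂ : σ₂.arr .sel = σ.arr .sel := by rw [hF₂.arr .sel rfl, hsel₁]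
    have hrel₂ : σ₂.arr .rel = σ.arr .rel := by rw [hF₂.arr .rel rfl, hrel₁]
    have hpar₂ : σ₂.arr .par = σ.arr .par := by rw [hF₂.arr .par rfl, hpar₁]
    refine Run.intro fun hb₂ => ?_
    simp only [Cmd.wp, wp_single, wp_upwalk, wp_jump, Expr.Safe, Expr.eval, hv₂]
    refine ⟨by simp, by omega, ?_⟩
    refine Run.conseq (single_spec (k := 0) (N := 2 * R.written.length) (by simpa using hA₂.N)
      (by omega) (by omega)) fun σ₃ hb₃ hF₃ ⟨hX₃, t₃⟩ => ?_
    have hA₃ : Auto R σ₃ := Auto.frame (hA₂.agree ⟨by simp, by simp⟩) hF₃ rfl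
    refine Run.block (Run.conseq (relaxB_spec hA₃ hmM hX₃) fun σ₄ hb₄ hF₄ ⟨hX₄, t₄⟩ => ?_)
    have hA₄ : Auto R σ₄ := hA₃.frame hF₄ rfl
    have hT₄ : Trie n str σ₄ := by
      refine Trie.frame (Trie.frame (σ := σ₂.set .nd (i + 1) 4) ?_ hF₃ rfl) hF₄ rfl
      exact ⟨hT₂.isTrie, hT₂.dep, by simpa using hT₂.n⟩
    have hnd₄ : σ₄.var .nd = i + 1 := by rw [hF₄.var .nd rfl, hF₃.var .nd rfl]; simp
    have hsel₄ : σ₄.arr .sel = σ.arr .sel := by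
      rw [hF₄.arr .sel rfl, hF₃.arr .sel rfl]; simpa using hsel₂
    have hrel₄ : σ₄.arr .rel = σ.arr .rel := by
      rw [hF₄.arr .rel rfl, hF₃.arr .rel rfl]; simpa using hrel₂
    have hmt₄ : σ₄.arr .mt = σ₂.arr .mt := by rw [hF₄.arr .mt rfl, hF₃.arr .mt rfl]; simp
    have hpar₄ : σ₄.arr .par = σ.arr .par := by
      rw [hF₄.arr .par rfl, hF₃.arr .par rfl]; simpa using hpar₂
    simp only [hnd₄]
    refine ⟨trivial, by omega, ?_⟩
    refine Run.conseq (upwalk_spec (v := i + 1) (τ := τ) (r := r) (n := n) (str := str)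
      ⟨hT₄.isTrie, hT₄.dep, by simpa using hT₄.n⟩ (by omega) (by simp) hr ?_ ?_ hnM)
      fun σ₅ hb₅ hF₅ ⟨⟨u, w, g1, g2, g3, g4, g5, g6, g7⟩, t₅⟩ => ?_
    · simp only [Store.set_arr, hsel₄, hB.root]; omega
    · intro u hu hu0 hur
      simp only [Store.set_arr, hsel₄]
      exact hB.marked u (by omega) hu0 hur
    simp only [Store.set_arr, hsel₄] at g3
    have hA₅ : Auto R σ₅ := Auto.frame (hA₄.agree ⟨by simp, by simp⟩) hF₅ rfl
    have hwl : w.length ≤ n := by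
      have := hT.isTrie.length_str_le (v := i + 1) (by omega)
      rw [g4, List.length_append] at this
      omega
    refine Run.block (Run.conseq (walkB_spec (w := w) (S := {i | ∃ j ∈ ({0} : Set ℕ),
        Path (edges R) i j}) hA₅ g6 g7 (by omega) hmM ?_) fun σ₆ hb₆ hF₆ ⟨hX₆, t₆⟩ => ?_)
    · have e : σ₅.arr .X = σ₄.arr .X := by rw [hF₅.arr .X rfl]; simp
      simpa only [Vec, e] using hX₄
    have hsel₆ : σ₆.arr .sel = σ.arr .sel := by
      rw [hF₆.arr .sel rfl, hF₅.arr .sel rfl]; simpa using hsel₄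
    have hrel₆ : σ₆.arr .rel = σ.arr .rel := by
      rw [hF₆.arr .rel rfl, hF₅.arr .rel rfl]; simpa using hrel₄
    refine Run.conseq (jump_spec_backward (u := u) (R := R) (str := str) (τ := τ) (r := r) (n := n)
      (by rw [hsel₆, hrel₆]; exact hB) (by rw [hF₆.var .N rfl, hA₅.N])
      (by rw [hF₆.var .up rfl, g1]) (by omega) (by rw [hsel₆]; exact g3) hT.isTrie.str_zero hM hmM
      hnM hX₆) fun σ₇ hb₇ hF₇ ⟨hX₇, t₇⟩ => ?_
    have hX : ∀ s < 2 * R.written.length, σ₇.arr .X s = 1 ↔ s ∈ Acc R (str (i + 1)) := by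
      intro s hs
      rw [hX₇.1 s hs, g4, mem_acc_append]
      simp only [Set.mem_ofPred_eq, Acc, Set.mem_singleton_iff, exists_eq_left]
      grind
    have hnd₇ : σ₇.var .nd = i + 1 := by
      rw [hF₇.var .nd rfl, hF₆.var .nd rfl, hF₅.var .nd rfl]; simpa using hnd₄
    have hN₇ : σ₇.var .N = 2 * R.written.length := by
      rw [hF₇.var .N rfl, hF₆.var .N rfl, hA₅.N]
    have hmt₇ : σ₇.arr .mt = σ₂.arr .mt := by
      rw [hF₇.arr .mt rfl, hF₆.arr .mt rfl, hF₅.arr .mt rfl]; simpa using hmt₄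
    have hpar₇ : σ₇.arr .par = σ.arr .par := by
      rw [hF₇.arr .par rfl, hF₆.arr .par rfl, hF₅.arr .par rfl]; simpa using hpar₄
    refine Run.conseq (Run.countConst (fun s' σ' => TableOK R str (σ.arr .par) i (σ'.arr .mt) ∧
      ∀ s < s', σ'.arr .mt ((i + 1) * (2 * R.written.length) + s) =
        firstAnc (σ.arr .par) (fun u => s ∈ Acc R (str u)) (i + 1)) 50
      hN₇ (by decide) rfl rfl (fun _ _ _ _ h => h) (fun _ _ _ h => h)
      ⟨by rw [hmt₇]; exact hI, by simp⟩
      ?_) fun σ₈ hb₈ hF₈ ⟨⟨h₈, h₈'⟩, t₈⟩ => ⟨?_, ?_⟩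
    · rintro s hs σ₈ hF₈ hv₈ hN₈ ⟨h8, h8'⟩
      have e1 : σ₈.arr .X = σ₇.arr .X := hF₈.arr .X rfl
      have e2 : σ₈.arr .par = σ.arr .par := by rw [hF₈.arr .par rfl, hpar₇]
      have e3 : σ₈.var .nd = i + 1 := by rw [hF₈.var .nd rfl, hnd₇]
      have hpl := hT.isTrie.par_le i hi
      have ix1 := ix (i + 1) (by omega) s hs
      have ix2 := ix (σ.arr .par (i + 1)) (by omega) s hs
      have hXs := hX s hs
      have old : ∀ x (f : ℕ → ℕ), TableOK R str (σ.arr .par) i f → TableOK R str (σ.arr .par) i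
          (Function.update f ((i + 1) * (2 * R.written.length) + s) x) := by
        intro x f h v hv s' hs'
        rw [Function.update_of_ne, h v hv s' hs']
        intro he
        have := (mul_add_inj hs' hs he).1
        omega
      have new : ∀ (f : ℕ → ℕ) (x : ℕ), (∀ s' < s, f ((i + 1) * (2 * R.written.length) + s') =
          firstAnc (σ.arr .par) (fun u => s' ∈ Acc R (str u)) (i + 1)) →
          x = firstAnc (σ.arr .par) (fun u => s ∈ Acc R (str u)) (i + 1) → ∀ s' < s + 1,
          Function.update f ((i + 1) * (2 * R.written.length) + s) x
            ((i + 1) * (2 * R.written.length) + s') =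
          firstAnc (σ.arr .par) (fun u => s' ∈ Acc R (str u)) (i + 1) := by
        intro f x hf hx s' hs'
        by_cases h : s' = s
        · rw [h, Function.update_self, hx]
        · rw [Function.update_of_ne (by omega), hf s' (by omega)]
      refine Run.intro fun hb₈ => ?_
      simp only [Cmd.wp, Expr.Safe, Expr.eval, Cond.Safe, Cond.Holds, hv₈, hN₈, e1, e2, e3,
        Store.tick_var, Store.tick_arr, hXs]
      refine ⟨by simp; omega, fun c => ?_, fun c => ?_⟩
      · refine ⟨by simp, by simp, ix1, by omega, ⟨?_, ?_⟩, by simp⟩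
        · simp only [Store.aset_arr, if_true, Store.tick_arr]; exact old _ _ h8
        · simp only [Store.aset_arr, if_true, Store.tick_arr]
          exact new _ _ h8' (hT.isTrie.firstAnc_of_pos (P := fun u => s ∈ Acc R (str u))
            (v := i + 1) (by omega) (by omega) c).symm
      · refine ⟨by simp; omega, by simp, ix1, hb₈.2 _ _, ⟨?_, ?_⟩, by simp⟩
        · simp only [Store.aset_arr, if_true, Store.tick_arr]; exact old _ _ h8
        · simp only [Store.aset_arr, if_true, Store.tick_arr]
          refine new _ _ h8' ?_
          rw [hT.isTrie.firstAnc_of_neg (P := fun u => s ∈ Acc R (str u)) (v := i + 1) (by omega)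
            (by omega) c, h8 _ hpl s hs]
    · intro v hv s hs
      rcases Nat.lt_succ_iff_lt_or_eq.1 (Nat.lt_succ_of_le hv) with h | rfl
      · exact h₈ v (by omega) s hs
      · exact h₈' s hs
    · have e1 : w.length * (R.written.length * 330) ≤ τ * (R.written.length * 330) :=
        Nat.mul_le_mul_right _ g5
      have e2 : 2 * R.written.length * (2 * R.written.length * 50 + 70) =
        R.written.length * (R.written.length * 200) + R.written.length * 140 := by ring
      simp only [mul_add]
      simp at t₃ t₅
      rw [e2] at t₇
      omega
  · have e : ∀ a b n x : ℕ, a ≤ b + (n * (x + 290 + 7) + 5) →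
        a ≤ b + (n * (x + 300) + 5) := fun a b n x h =>
      h.trans (Nat.add_le_add_left (Nat.add_le_add_right (Nat.mul_le_mul_left _ (by omega)) _) _)
    have := e _ _ _ _ t₂
    omega

end RegexMatch

/-! ### Reporting the matches -/

namespace RegexMatch

open WordRAM

variable {A : ℕ} {E : Env} {R : RegularExpression (Fin A)} {n τ r : ℕ} {str : ℕ → List (Fin A)}
  {par : ℕ → ℕ}

/-- Find the nearest ancestor-or-self of `up` whose word leads to acceptance from a slot in `X`.
Nodes have larger numbers than their ancestors, so it is the largest of the entries of `mt` for
the slots in `X`. -/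
def nearest : Cmd :=
  .block (.best ::= .lit 0 ;;
    .count .s .N
      (.ite (.eq (.arr .X Var.s) (.lit 1))
        (.x ::= .arr .mt (Var.up *ₑ Var.N +ₑ Var.s) ;;
          .ite (.lt Var.best Var.x) (.best ::= Var.x) .skip) .skip))

theorem wp_nearest (Q : Store → Prop) (σ : Store) :
    nearest.wp E Q σ = Run E nearest σ Q := rfl

theorem nearest_spec {σ : Store} {S : Set ℕ} {v : ℕ} (hN : σ.var .N = 2 * R.written.length)
    (hmt : TableOK R str par n (σ.arr .mt)) (hv : v ≤ n) (hup : σ.var .up = v)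
    (hX : Vec .X (2 * R.written.length) S σ)
    (hM : (n + 1) * (2 * R.written.length) ≤ E.M) :
    Run E nearest σ fun σ' => σ'.var .best = firstAnc par (fun u => ∃ s ∈ S, s ∈ Acc R (str u)) v ∧
      σ'.time ≤ σ.time + (R.written.length * 120 + 10) := by
  have h1U := E.one_lt
  refine Run.block (Run.intro fun hb => ?_)
  simp only [Cmd.wp, Cmd.wp_count, Expr.Safe, Expr.eval]
  refine ⟨trivial, by omega, ?_⟩
  refine Run.conseq (Run.countConst (fun k σ' => σ'.var .best =
      firstAnc par (fun u => ∃ s < k, s ∈ S ∧ s ∈ Acc R (str u)) v) 50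
    (H := 2 * R.written.length) (by simpa using hN) (by decide) rfl rfl
    (fun _ _ _ _ h => by simpa using h) (fun _ _ _ h => h) ?_ ?_)
    fun σ₁ hb₁ hF₁ ⟨h₁, t₁⟩ => ⟨?_, ?_⟩
  · rw [firstAnc_false]
    · simp
    · simp
  · intro k hk σ₁ hF₁ hv₁ hN₁ hI
    have e1 : σ₁.arr .X = σ.arr .X := by rw [hF₁.arr .X rfl]; simp
    have e2 : σ₁.arr .mt = σ.arr .mt := by rw [hF₁.arr .mt rfl]; simp
    have e3 : σ₁.var .up = v := by rw [hF₁.var .up rfl]; simpa using hup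
    have hXk := hX.1 k hk
    have hmk := hmt v hv k hk
    have hix : v * (2 * R.written.length) + k < E.M := by
      have : v * (2 * R.written.length) ≤ n * (2 * R.written.length) := Nat.mul_le_mul_right _ hv
      rw [add_mul] at hM
      omega
    refine Run.intro fun hb₁ => ?_
    have hmU := hb₁.2 .mt (v * (2 * R.written.length) + k)
    rw [e2] at hmU
    simp only [Cmd.wp, Expr.Safe, Expr.eval, Cond.Safe, Cond.Holds, hv₁, hN₁, e1, e2, e3,
      Store.tick_var, Store.tick_arr, Store.set_var, if_true, reduceCtorEq, if_false, hXk, hI]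
    refine ⟨by simp; omega, fun c => ⟨by simp; omega, hmU, by simp, ?_⟩, fun c => ⟨?_, by simp⟩⟩
    · have e : firstAnc par (fun u => ∃ s < k + 1, s ∈ S ∧ s ∈ Acc R (str u)) v =
          max (firstAnc par (fun u => ∃ s < k, s ∈ S ∧ s ∈ Acc R (str u)) v)
            (σ.arr .mt (v * (2 * R.written.length) + k)) := by
        rw [hmk, ← firstAnc_or]
        congr 1
        ext u
        constructor
        · rintro ⟨s, hs, h⟩
          rcases Nat.lt_succ_iff_lt_or_eq.1 hs with h' | rfl
          · exact .inl ⟨s, h', h⟩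
          · exact .inr h.2
        · rintro (⟨s, hs, h⟩ | h)
          · exact ⟨s, by omega, h⟩
          · exact ⟨k, by omega, c, h⟩
      rw [e]
      refine ⟨fun c1 => ⟨trivial, hmU, ?_, by simp⟩, fun c1 => ⟨?_, by simp⟩⟩
      · omega
      · omega
    · congr 1
      ext u
      constructor
      · rintro ⟨s, hs, h⟩; exact ⟨s, by omega, h⟩
      · rintro ⟨s, hs, h⟩
        rcases Nat.lt_succ_iff_lt_or_eq.1 hs with h' | rfl
        · exact ⟨s, h', h⟩
        · exact absurd h.1 c
  · rw [h₁]
    congr 1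
    ext u
    constructor
    · rintro ⟨s, hs, h⟩; exact ⟨s, h⟩
    · rintro ⟨s, h⟩; exact ⟨s, hX.2 s h.1, h⟩
  · simp at t₁
    omega

/-- Write the matches that end in the phrase number `i + 1`, the longest first. -/
def reportPhrase : Cmd :=
  .up ::= Var.i +ₑ .lit 1 ;; .go ::= .lit 1 ;;
  .loop (.eq Var.go (.lit 1))
    (nearest ;;
      .ite (.eq Var.best (.lit 0)) (.go ::= .lit 0)
        (.out (Var.off +ₑ .arr .dep Var.best) ;; .up ::= .arr .par Var.best))

theorem reportPhrase_spec {σ : Store} {i : ℕ} (hT : Trie n str σ)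
    (hN : σ.var .N = 2 * R.written.length)
    (hmt : TableOK R str (σ.arr .par) n (σ.arr .mt)) (hi : i < n) (hvi : σ.var .i = i)
    (hoff : σ.var .off = (text str i).length)
    (hX : Vec .X (2 * R.written.length) (slots R str i) σ)
    (hM : (n + 1) * (2 * R.written.length) ≤ E.M) (hnM : n < E.M) :
    Run E (.block reportPhrase) σ fun σ' => σ'.out = σ.out ++ report R (σ.arr .par) str i ∧
      σ'.time ≤ σ.time + (((report R (σ.arr .par) str i).length + 1) *
        (R.written.length * 120 + 60) + 20) := by
  classical
  have hMU := E.mem_le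
  have h1U := E.one_lt
  -- `L v` lists the matches that end at `v` or above; `L (i + 1)` is reported.
  obtain ⟨L, hL⟩ : ∃ L : ℕ → List ℕ, L = fun v => ((ancs (σ.arr .par) v).filter
    (Hit R str i)).map fun v => (text str i).length + (str v).length := ⟨_, rfl⟩
  have hrep : report R (σ.arr .par) str i = L (i + 1) := by rw [hL, report]
  have hLs : ∀ v, L v = if firstAnc (σ.arr .par) (Hit R str i) v = 0 then [] else
      ((text str i).length + (str (firstAnc (σ.arr .par) (Hit R str i) v)).length) ::
        L (σ.arr .par (firstAnc (σ.arr .par) (Hit R str i) v)) := by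
    intro v
    rw [hL]
    simp only
    rw [filter_ancs]
    split_ifs <;> rfl
  rw [hrep]
  refine Run.block (Run.intro fun hb => ?_)
  simp only [reportPhrase, Cmd.wp, Expr.Safe, Expr.eval, hvi]
  refine ⟨by simp, by omega, trivial, h1U, ?_⟩
  refine Run.loop (fun k σ' => ∃ out v, σ'.out = σ.out ++ out ∧ σ'.var .up = v ∧ v ≤ i + 1 ∧
    ((σ'.var .go = 1 ∧ v + 1 ≤ k ∧ out ++ L v = L (i + 1) ∧
      σ'.time ≤ σ.time + (out.length * (R.written.length * 120 + 60) + 12)) ∨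
    (σ'.var .go = 0 ∧ out = L (i + 1) ∧
      σ'.time ≤ σ.time + ((out.length + 1) * (R.written.length * 120 + 60) + 12))))
    (i + 2) ?_ ?_ ?_ ?_
  · exact ⟨[], i + 1, by simp, by simp, le_rfl, .inl ⟨by simp, le_rfl, by simp, by simp⟩⟩
  · rintro k σ' -
    simp
  · rintro k σ₁ hF₁ hb₁ ⟨out, v, g1, g2, g3, g4⟩ hh
    simp only [Cond.Holds, Expr.eval] at hh
    obtain ⟨-, hk, h3, h4⟩ := g4.resolve_right fun h => by have := h.1; omega
    have f1 : σ₁.arr .par = σ.arr .par := by rw [hF₁.arr .par rfl]; simp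
    have f2 : σ₁.arr .dep = σ.arr .dep := by rw [hF₁.arr .dep rfl]; simp
    have f3 : σ₁.var .off = (text str i).length := by rw [hF₁.var .off rfl]; simpa using hoff
    have f4 : σ₁.arr .mt = σ.arr .mt := by rw [hF₁.arr .mt rfl]; simp
    have f5 : σ₁.var .N = 2 * R.written.length := by rw [hF₁.var .N rfl]; simpa using hN
    have f6 : σ₁.arr .X = σ.arr .X := by rw [hF₁.arr .X rfl]; simp
    obtain ⟨u, hu⟩ : ∃ u, u = firstAnc (σ.arr .par) (Hit R str i) v := ⟨_, rfl⟩
    have huv : u ≤ v := hu ▸ firstAnc_le _ _ _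
    have hLv := hLs v
    rw [← hu] at hLv
    refine ⟨k - 1, by omega, Run.seq ?_⟩
    refine Run.conseq (nearest_spec (R := R) (str := str) (par := σ.arr .par) (n := n) (v := v)
      (S := slots R str i) (by simpa using f5) (by simpa [f4] using hmt) (by omega)
      (by simpa using g2)
      (by simpa only [Vec, Store.tick_arr, f6] using hX) hM)
      fun σ₂ hb₂ hF₂ ⟨h₂, t₂⟩ => Run.of_wp ?_
    change σ₂.var .best = firstAnc (σ.arr .par) (Hit R str i) v at h₂
    rw [← hu] at h₂
    have k1 : σ₂.arr .par = σ.arr .par := by rw [hF₂.arr .par rfl]; simpa using f1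
    have k2 : σ₂.arr .dep = σ.arr .dep := by rw [hF₂.arr .dep rfl]; simpa using f2
    have k3 : σ₂.var .off = (text str i).length := by rw [hF₂.var .off rfl]; simpa using f3
    have k4 : σ₂.out = σ.out ++ out := by rw [hF₂.out rfl]; simpa using g1
    have k5 : σ₂.var .go = 1 := by rw [hF₂.var .go rfl]; simpa using hh
    have k6 : σ₂.var .up = v := by rw [hF₂.var .up rfl]; simpa using g2
    simp only [Cmd.wp, Expr.Safe, Expr.eval, Cond.Safe, Cond.Holds, h₂, k1, k2, k3,
      Store.tick_var, Store.tick_arr, Store.push_var, Store.push_arr]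
    simp at t₂
    refine ⟨by simp, fun c => ⟨trivial, by omega, ⟨out, v, by simpa using k4, by simpa using k6, g3,
      .inr ⟨by simp, ?_, ?_⟩⟩, by simp⟩, fun c => ⟨by simp; omega, by simp; omega,
      by rw [← k1]; exact hb₂.2 _ _, ⟨out ++ [(text str i).length + (str u).length], σ.arr .par u,
        ?_, by simp, ?_, .inl ⟨by simpa using k5, ?_, ?_, ?_⟩⟩, by simp⟩⟩
    · rw [← h3, hLv, if_pos c, List.append_nil]
    · simp [add_mul]
      omega
    · simp [k4, hT.dep u (by omega)]
    · have := hT.isTrie.par_lt c (by omega); omega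
    · have := hT.isTrie.par_lt c (by omega); omega
    · rw [← h3, hLv, if_neg c]; simp
    · simp [add_mul]
      omega
  · rintro k σ₁ hF₁ hb₁ ⟨out, v, g1, g2, g3, g4⟩ hh
    simp only [Cond.Holds, Expr.eval] at hh
    obtain ⟨-, h3, h4⟩ := g4.resolve_left fun h => hh h.1
    rw [← h3]
    exact ⟨by simpa using g1, by simp; omega⟩

theorem length_flatMap_range (f : ℕ → List ℕ) (n : ℕ) :
    ((List.range n).flatMap f).length = ∑ i ∈ Finset.range n, (f i).length := by
  induction n with
  | zero => rfl
  | succ n ih => simp [List.range_succ, Finset.sum_range_succ, ih]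

/-- Run the automaton through the phrases, and report the matches on the way. The set in `X`
contains the slots that are reached before phrase `i + 1`; it is updated by a jump along the
relation of the nearest sampled ancestor of the node and at most `tau` single steps. -/
def reportAll : Cmd :=
  single 1 ;; .off ::= .lit 0 ;;
  .count .i .n
    (.block reportPhrase ;; .up ::= Var.i +ₑ .lit 1 ;; upwalk ;; jump .t .s ;; walk ;;
      .off ::= Var.off +ₑ .arr .dep (Var.i +ₑ .lit 1))

theorem reportAll_spec {σ : Store} (hT : Trie n str σ) (hA : Auto R σ) (hr : r < τ)
    (hB : Blocks R str τ r n (σ.arr .sel) (σ.arr .rel))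
    (htab : TableOK R str (σ.arr .par) n (σ.arr .mt))
    (hM : sampled str τ r n * (2 * R.written.length * (2 * R.written.length)) ≤ E.M)
    (hmM : 5 * R.written.length ≤ E.M) (hnM : n < E.M)
    (hmt : (n + 1) * (2 * R.written.length) ≤ E.M) (htext : (text str n).length < E.U) :
    Run E reportAll σ fun σ' =>
      σ'.out = σ.out ++ (List.range n).flatMap (report R (σ.arr .par) str) ∧
      σ'.time ≤ σ.time + (((List.range n).flatMap (report R (σ.arr .par) str)).length *
        (R.written.length * 120 + 60) + n * (R.written.length * (R.written.length * 200 + 300) +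
        τ * (R.written.length * 330 + 40) + 300) + R.written.length * 40 + 50) := by
  have hMU := E.mem_le
  have h1U := E.one_lt
  have hp := length_pos R
  refine Run.intro fun hb => ?_
  simp only [reportAll, Cmd.wp, Cmd.wp_count, wp_single]
  refine Run.conseq (single_spec (k := 1) hA.N (by omega) (by omega))
    fun σ₁ hb₁ hF₁ ⟨hX₁, t₁⟩ => ?_
  simp only [Expr.Safe, Expr.eval]
  refine ⟨trivial, by omega, ?_⟩
  have hT₁ := hT.frame hF₁ rfl
  have hA₁ := hA.frame hF₁ rfl
  have hsel₁ : σ₁.arr .sel = σ.arr .sel := hF₁.arr .sel rfl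
  have hrel₁ : σ₁.arr .rel = σ.arr .rel := hF₁.arr .rel rfl
  have hpar₁ : σ₁.arr .par = σ.arr .par := hF₁.arr .par rfl
  have hmt₁ : σ₁.arr .mt = σ.arr .mt := hF₁.arr .mt rfl
  refine Run.conseq (Run.count (fun i σ' => Vec .X (2 * R.written.length) (slots R str i) σ' ∧
      σ'.var .off = (text str i).length ∧
      σ'.out = σ.out ++ (List.range i).flatMap (report R (σ.arr .par) str))
    (fun i => (report R (σ.arr .par) str i).length * (R.written.length * 120 + 60) +
      (R.written.length * (R.written.length * 200 + 300) + τ * (R.written.length * 330 + 40) + 290))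
    (by simpa using hT₁.n) (by decide) rfl rfl (fun _ _ _ _ h => by simpa [Vec] using h)
    (fun _ _ _ h => h) ?_ ?_) fun σ₂ hb₂ hF₂ ⟨h₂, t₂⟩ => ⟨h₂.2.2, ?_⟩
  · refine ⟨?_, by simp [text], by simpa using hF₁.out rfl⟩
    have e : slots R str 0 = {1} := by ext s; simp [slots, text, Rel, eq_comm]
    rw [e]; exact hX₁
  · rintro i hi σ₂ hF₂ hv₂ - ⟨hX₂, hoff₂, hout₂⟩
    have hT₂ : Trie n str σ₂ := by
      refine Trie.frame (σ := σ₁.set .off 0 2) ?_ hF₂ rfl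
      exact ⟨hT₁.isTrie, hT₁.dep, by simpa using hT₁.n⟩
    have hA₂ : Auto R σ₂ := Auto.frame (hA₁.agree ⟨by simp, by simp⟩) hF₂ rfl
    have hsel₂ : σ₂.arr .sel = σ.arr .sel := by rw [hF₂.arr .sel rfl]; simpa using hsel₁
    have hrel₂ : σ₂.arr .rel = σ.arr .rel := by rw [hF₂.arr .rel rfl]; simpa using hrel₁
    have hpar₂ : σ₂.arr .par = σ.arr .par := by rw [hF₂.arr .par rfl]; simpa using hpar₁
    have hmt₂ : σ₂.arr .mt = σ.arr .mt := by rw [hF₂.arr .mt rfl]; simpa using hmt₁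
    refine Run.seq (Run.conseq (reportPhrase_spec hT₂ hA₂.N (by rw [hpar₂, hmt₂]; exact htab) hi
      hv₂ hoff₂
      hX₂ hmt hnM) fun σ₃ hb₃ hF₃ ⟨h₃, t₃⟩ => Run.of_wp ?_)
    rw [hpar₂] at h₃ t₃
    have hi₃ : σ₃.var .i = i := by rw [hF₃.var .i rfl, hv₂]
    have hT₃ : Trie n str σ₃ := hT₂.frame hF₃ rfl
    have hA₃ : Auto R σ₃ := hA₂.frame hF₃ rfl
    have hsel₃ : σ₃.arr .sel = σ.arr .sel := by rw [hF₃.arr .sel rfl, hsel₂]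
    have hrel₃ : σ₃.arr .rel = σ.arr .rel := by rw [hF₃.arr .rel rfl, hrel₂]
    have hX₃ : σ₃.arr .X = σ₂.arr .X := by rw [hF₃.arr .X rfl]
    simp only [Cmd.wp, wp_upwalk, wp_jump, wp_walk, Expr.Safe, Expr.eval, hi₃]
    refine ⟨by simp, by omega, ?_⟩
    refine Run.conseq (upwalk_spec (v := i + 1) (τ := τ) (r := r) (n := n) (str := str)
      ⟨hT₃.isTrie, hT₃.dep, by simpa using hT₃.n⟩ (by omega) (by simp) hr ?_ ?_ hnM)
      fun σ₅ hb₅ hF₅ ⟨⟨u, w, g1, g2, g3, g4, g5, g6, g7⟩, t₅⟩ => ?_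
    · simp only [Store.set_arr, hsel₃, hB.root]; omega
    · intro u hu hu0 hur
      simp only [Store.set_arr, hsel₃]
      exact hB.marked u (by omega) hu0 hur
    simp only [Store.set_arr, hsel₃] at g3
    have hT₅ : Trie n str σ₅ := by
      refine Trie.frame (σ := σ₃.set .up (i + 1) 4) ?_ hF₅ rfl
      exact ⟨hT₃.isTrie, hT₃.dep, by simpa using hT₃.n⟩
    have hA₅ : Auto R σ₅ := Auto.frame (hA₃.agree ⟨by simp, by simp⟩) hF₅ rfl
    have hwl : w.length ≤ n := by
      have := hT.isTrie.length_str_le (v := i + 1) (by omega)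
      rw [g4, List.length_append] at this
      omega
    have hsel₅ : σ₅.arr .sel = σ.arr .sel := by rw [hF₅.arr .sel rfl]; simpa using hsel₃
    have hrel₅ : σ₅.arr .rel = σ.arr .rel := by rw [hF₅.arr .rel rfl]; simpa using hrel₃
    have hX₅ : σ₅.arr .X = σ₂.arr .X := by rw [hF₅.arr .X rfl]; simpa using hX₃
    refine Run.conseq (jump_spec_forward (u := u) (R := R) (str := str) (τ := τ) (r := r) (n := n)
      (S := slots R str i) (by rw [hsel₅, hrel₅]; exact hB) hA₅.N g1 (by omega)
      (by rw [hsel₅]; exact g3) hT.isTrie.str_zero hM hmM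
      hnM (by simpa only [Vec, hX₅] using hX₂)) fun σ₆ hb₆ hF₆ ⟨hX₆, t₆⟩ => ?_
    have hA₆ : Auto R σ₆ := hA₅.frame hF₆ rfl
    refine Run.conseq (walk_spec (w := w) hA₆ (by rw [hF₆.var .sp rfl, g6])
      (by rw [hF₆.arr .stk rfl]; exact g7) (by omega) hmM hX₆)
      fun σ₇ hb₇ hF₇ ⟨hX₇, t₇⟩ => ?_
    have hi₇ : σ₇.var .i = i := by
      rw [hF₇.var .i rfl, hF₆.var .i rfl, hF₅.var .i rfl]; simpa using hi₃
    have hoff₇ : σ₇.var .off = (text str i).length := by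
      rw [hF₇.var .off rfl, hF₆.var .off rfl, hF₅.var .off rfl]
      simpa [hF₃.var .off rfl] using hoff₂
    have hdep₇ : σ₇.arr .dep (i + 1) = (str (i + 1)).length :=
      ((hT₅.frame hF₆ rfl).frame hF₇ rfl).dep _ (by omega)
    have hout₇ : σ₇.out = σ₃.out := by
      rw [hF₇.out rfl, hF₆.out rfl, hF₅.out rfl]; simp
    have htx := length_text_mono str (show i + 1 ≤ n by omega)
    rw [length_text_succ] at htx
    simp only [hi₇, hoff₇, hdep₇]
    refine ⟨by simp; omega, by omega, ⟨?_, by simp [length_text_succ], ?_⟩, ?_⟩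
    · have e : slots R str (i + 1) = {j | ∃ i' ∈ {j | ∃ i' ∈ slots R str i, Rel R (str u) i' j},
          Rel R w i' j} := by
        ext s
        simp only [slots, text_succ, g4, rel_append, Set.mem_ofPred_eq]
        grind
      rw [e]; simpa [Vec] using hX₇
    · simp [hout₇, h₃, hout₂, List.range_succ]
    · have e1 : w.length * (R.written.length * 330) ≤ τ * (R.written.length * 330) :=
        Nat.mul_le_mul_right _ g5
      have e2 : 2 * R.written.length * (2 * R.written.length * 50 + 70) =
        R.written.length * (R.written.length * 200) + R.written.length * 140 := by ring
      rw [e2] at t₆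
      simp at t₅ ⊢
      simp only [mul_add, add_mul, one_mul] at t₃ ⊢
      omega
  · rw [Finset.sum_add_distrib, ← Finset.sum_mul, ← length_flatMap_range] at t₂
    simp only [Finset.sum_const, Finset.card_range, smul_eq_mul] at t₂
    simp only [Store.set_time, Expr.cost] at t₂
    have key : ∀ a b L x : ℕ, a ≤ b + (L + n * (x + 290) + 7 * n + 5) →
        a ≤ b + (L + n * (x + 300) + 5) := by
      intro a b L x h
      rw [mul_add] at h ⊢
      omega
    have t₃ := key _ _ _ _ t₂
    omega

end RegexMatch

/-! ### The program -/

namespace RegexMatch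

open WordRAM

variable {A : ℕ} {E : Env} {R : RegularExpression (Fin A)} {n m τ : ℕ}

/-- Read the header of the input. -/
def header : Cmd :=
  .fmt ::= .inp (.lit 0) ;; .sg ::= .inp (.lit 1) ;; .n ::= .inp (.lit 2) ;;
  .m ::= .inp (.lit 3) ;; .tau ::= .inp (.lit 4) ;; .N ::= .lit 2 *ₑ Var.m

/-- Read the compressed string, in either format. -/
def readTrie : Cmd := .ite (.eq Var.fmt (.lit 0)) (.block readZL78) (.block readZLW)

theorem readTrie_spec {σ : Store} {Z : ZLString A} {Q : List (Fin A)} (hZ : Z.Represents Q)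
    (hin : E.input = matchInput Z R τ) (hn : Z.length = n) (hvn : σ.var .n = n)
    (hfmt : σ.var .fmt = Z.format) (hsg : σ.var .sg = A) (hM : n < E.M) (hA : 7 + A < E.U)
    (hnU : 5 + 2 * n < E.U) :
    Run E readTrie σ fun σ' => ((∃ str, IsTrie A n (σ'.arr .par) (σ'.arr .chr) str ∧
      text str n = Q) ∧ σ'.var .ro = 5 + Z.words.length) ∧
      σ'.time ≤ σ.time + (n * 100 + 30) := by
  have hp := length_pos R
  refine Run.intro fun hb => ?_
  simp only [readTrie, Cmd.wp, Cond.Safe, Cond.Holds, Expr.Safe, Expr.eval, hfmt]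
  cases Z with
  | zl78 Z =>
    replace hn : Z.length = n := hn
    have hw : (ZLString.zl78 Z).words.length = 2 * n := by
      rw [← hn]; exact length_pairs Z
    have hpar : ∀ (i : ℕ) (hi : i < Z.length), E.input.getD (5 + 2 * i) 0 = Z[i].1 := by
      intro i hi
      rw [hin, getD_input_words _ _ _ (by omega)]
      exact (List.getElem_eq_iff _).2 (getElem?_pairs Z i hi).1
    have hchr : ∀ (i : ℕ) (hi : i < Z.length), E.input.getD (6 + 2 * i) 0 = (Z[i].2 : ℕ) := by
      intro i hi
      rw [hin, show 6 + 2 * i = 5 + (2 * i + 1) by omega, getD_input_words _ _ _ (by omega)]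
      exact (List.getElem_eq_iff _).2 (getElem?_pairs Z i hi).2
    refine ⟨by simp, fun _ => ?_, fun h => absurd rfl h⟩
    refine Run.block (Run.conseq (readZL78_spec (n := n) (by simpa using hvn) hM ?_ hnU
      fun i hi => ?_) fun σ₁ _ _ ⟨⟨h1, h2⟩, t₁⟩ => ⟨⟨?_, ?_⟩, ?_⟩)
    · rw [hin]; simp [matchInput, hw]; omega
    · rw [hchr i (by omega)]
      have := Z[i].2.2
      omega
    · rw [← hn]
      refine isTrie_of_zl78 hZ (fun i hi => ?_) fun i hi => ?_
      · rw [(h2 i (by omega)).1, hpar i hi]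
      · rw [(h2 i (by omega)).2, hchr i hi]
    · rw [h1, hw]
    · simp at t₁; omega
  | zlw Z =>
    replace hn : Z.length = n := hn
    have hw : (ZLString.zlw Z).words.length = n := by
      rw [← hn]; simp [ZLString.words]
    have hwd : ∀ (i : ℕ) (hi : i < Z.length), E.input.getD (5 + i) 0 = Z[i].word := by
      intro i hi
      rw [hin, getD_input_words _ _ _ (by omega)]
      simp [ZLString.words]
    refine ⟨by simp, fun h => absurd h one_ne_zero, fun _ => ?_⟩
    refine Run.block (Run.conseq (readZLW_spec (n := n) (A := A) (by simpa using hvn)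
      (by simpa using hsg) hM ?_ (by omega) hA fun i hi => ?_)
      fun σ₁ _ _ ⟨⟨h1, h2⟩, t₁⟩ => ⟨⟨?_, ?_⟩, ?_⟩)
    · rw [hin]; simp [matchInput, hw]; omega
    · rw [hwd i (by omega)]
      obtain ⟨phrase, h1, -⟩ := hZ
      have := h1 i (by omega)
      cases hz : Z[i] with
      | char a => intro h; exact absurd a.2 h
      | entry j =>
        rw [hz] at this
        intro _
        simpa [ZLWCode.word] using this.1
    · rw [← hn]
      refine isTrie_of_zlw hZ (fst := σ₁.arr .fst) (fun i hi hlt => ?_) fun i hi hlt => ?_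
      · rw [← hwd i hi] at hlt ⊢
        exact (h2 i (by omega)).1 hlt
      · rw [← hwd i hi] at hlt ⊢
        exact (h2 i (by omega)).2 hlt
    · rw [h1, hw]
    · simp at t₁; omega

/-- The whole matching program. -/
def program : Cmd :=
  .block header ;; .block readTrie ;; depths ;; .block parse ;; nullable ;; .block listEdges ;;
  .block chooseResidue ;; .block buildBlocks ;; .block matchTable ;; .block reportAll

/-- What the numbers that the program computes with have to fit into. -/
structure Fits (E : Env) (A n m τ : ℕ) : Prop where
  n_lt : n < E.M
  m_le : 5 * m + 5 ≤ E.M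
  table : (n + 1) * (2 * m) ≤ E.M
  blocks : ∀ s, s * τ ≤ n → s * (2 * m * (2 * m)) ≤ E.M
  char : 7 + A < E.U
  header : 5 + 2 * n < E.U
  text : n * n < E.U

theorem IsTrie.length_text_le {par chr : ℕ → ℕ} {str : ℕ → List (Fin A)}
    (h : IsTrie A n par chr str) {i : ℕ} (hi : i ≤ n) : (text str i).length ≤ i * n := by
  induction i with
  | zero => simp [text]
  | succ i ih =>
    have h1 := h.length_str_le (v := i + 1) hi
    have h2 := ih (by omega)
    rw [length_text_succ, add_mul]
    omega

/-- The number of steps of the program on an input with the given parameters, of which `c` matches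
are reported and `s` nodes are in the sample. The summands stand for the preparation of trie and
automaton, the choice of the residue, the transition relations of the sample, the table of nearest
matching ancestors, and the final pass that reports. -/
def steps (n m τ c s : ℕ) : ℕ :=
  (n * 300 + m * 1300 + 300) + τ * (n * 50 + 50) +
    s * (2 * m * (τ * (m * 330 + 40) + m * 200 + 200) + 50) +
    n * (m * (m * 200 + 600) + τ * (m * 330 + 40) + 300) +
    (c * (m * 120 + 60) + n * (m * (m * 200 + 300) + τ * (m * 330 + 40) + 300))

theorem program_spec {Z : ZLString A} {Q : List (Fin A)} (hZ : Z.Represents Q)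
    (hin : E.input = matchInput Z R τ) (hn : Z.length = n) (hm : R.written.length = m)
    (hτ : 1 ≤ τ) (hE : Fits E A n m τ) :
    Run E program ⟨fun _ => 0, fun _ _ => 0, [], 0⟩ fun σ' => σ'.out.Nodup ∧
      (∀ j, j ∈ σ'.out ↔ j ∈ matchEnds R Q) ∧
      ∃ s, s * τ ≤ n ∧ σ'.time ≤ steps n m τ σ'.out.length s := by
  have hMU := E.mem_le
  have hp := length_pos R
  have hmM := hE.m_le
  refine Run.seq (Run.block (Run.intro fun hb => ?_))
  have i0 : E.input.getD 0 0 = Z.format := by rw [hin]; rfl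
  have i1 : E.input.getD 1 0 = A := by rw [hin]; rfl
  have i2 : E.input.getD 2 0 = n := by rw [hin, ← hn]; rfl
  have i3 : E.input.getD 3 0 = m := by rw [hin, ← hm]; rfl
  have i4 : E.input.getD 4 0 = τ := by rw [hin]; rfl
  have il : 4 < E.input.length := by rw [hin]; simp [matchInput]
  have u0 := getD_lt E 0
  have u1 := getD_lt E 1
  have u2 := getD_lt E 2
  have u3 := getD_lt E 3
  have u4 := getD_lt E 4
  rw [i0] at u0
  rw [i1] at u1
  rw [i2] at u2
  rw [i3] at u3
  rw [i4] at u4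
  simp only [header, Cmd.wp, Expr.Safe, Expr.eval, i0, i1, i2, i3, i4, Store.set_var, if_true,
    reduceCtorEq, if_false, Expr.cost]
  refine ⟨⟨trivial, by omega⟩, u0, ⟨trivial, by omega⟩, u1, ⟨trivial, by omega⟩, u2,
    ⟨trivial, by omega⟩, u3, ⟨trivial, by omega⟩, u4, ⟨trivial, trivial⟩, by omega, ?_⟩
  generalize hσ : ((((((Store.mk (fun _ => 0) (fun _ _ => 0) [] 0).set .fmt Z.format
    (1 + 1 + 1)).set .sg A (1 + 1 + 1)).set .n n (1 + 1 + 1)).set .m m (1 + 1 + 1)).set .tau τ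
      (1 + 1 + 1)).set .N (2 * m) (1 + 1 + 1 + 1) = σ
  have a1 : σ.var .fmt = Z.format := by rw [← hσ]; simp
  have a2 : σ.var .sg = A := by rw [← hσ]; simp
  have a3 : σ.var .n = n := by rw [← hσ]; simp
  have a4 : σ.var .m = m := by rw [← hσ]; simp
  have a5 : σ.var .tau = τ := by rw [← hσ]; simp
  have a6 : σ.var .N = 2 * m := by rw [← hσ]; simp
  have a7 : ∀ a, σ.arr a = fun _ => 0 := by rw [← hσ]; simp
  have a8 : σ.out = [] := by rw [← hσ]; simp
  have a9 : σ.time ≤ 30 := by rw [← hσ]; simp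
  clear hσ
  refine Run.seq (Run.block ((readTrie_spec hZ hin hn a3 a1 a2 hE.n_lt hE.char hE.header).conseq
    fun σ₁ _ hF₁ ⟨⟨⟨str, hstr, hQ⟩, hro⟩, t₁⟩ => ?_))
  refine Run.seq ((depths_spec (by rw [hF₁.var .n rfl, a3]) hstr
    (by rw [hF₁.arr .dep rfl, a7]) hE.n_lt).conseq fun σ₂ _ hF₂ ⟨hT₂, t₂⟩ => ?_)
  have m₂ : σ₂.var .m = R.written.length := by rw [hF₂.var .m rfl, hF₁.var .m rfl, a4, hm]
  refine Run.seq (Run.block ((parse_spec m₂ (by rw [hF₂.var .ro rfl, hro]) (by omega)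
    (by rw [hin]; simp [matchInput]; omega)
    (fun i hi => by rw [hin]; exact getD_input_written Z τ i hi)
    (by rw [hF₂.arr .stk rfl, hF₁.arr .stk rfl, a7])
    (by rw [hF₂.arr .kind rfl, hF₁.arr .kind rfl, a7])
    (by rw [hF₂.arr .sec rfl, hF₁.arr .sec rfl, a7])).conseq fun σ₃ _ hF₃ ⟨hT₃, t₃⟩ => ?_))
  have m₃ : σ₃.var .m = R.written.length := by rw [hF₃.var .m rfl, m₂]
  refine Run.seq ((nullable_spec m₃ hT₃ (by omega)).conseq fun σ₄ _ hF₄ ⟨hN₄, t₄⟩ => ?_)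
  have m₄ : σ₄.var .m = R.written.length := by rw [hF₄.var .m rfl, m₃]
  have N₄ : σ₄.var .N = 2 * R.written.length := by
    rw [hF₄.var .N rfl, hF₃.var .N rfl, hF₂.var .N rfl, hF₁.var .N rfl, a6, hm]
  have K₄ : σ₄.arr .kind = σ₃.arr .kind := hF₄.arr .kind rfl
  have S₄ : σ₄.arr .sec = σ₃.arr .sec := hF₄.arr .sec rfl
  refine Run.seq (Run.block ((listEdges_spec m₄ N₄ (by rw [K₄, S₄]; exact hT₃) (by omega)
    (by rw [K₄, S₄]; exact hN₄)).conseq fun σ₅ _ hF₅ ⟨hA₅, t₅⟩ => ?_))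
  have hT₅ : Trie n str σ₅ := ((hT₂.frame hF₃ rfl).frame hF₄ rfl).frame hF₅ rfl
  have τ₅ : σ₅.var .tau = τ := by
    rw [hF₅.var .tau rfl, hF₄.var .tau rfl, hF₃.var .tau rfl, hF₂.var .tau rfl, hF₁.var .tau rfl,
      a5]
  refine Run.seq (Run.block ((chooseResidue_spec hT₅ τ₅ hτ hE.n_lt).conseq
    fun σ₆ _ hF₆ ⟨⟨hr, hs⟩, t₆⟩ => ?_))
  obtain ⟨r, hrd⟩ : ∃ r, r = σ₆.var .res := ⟨_, rfl⟩
  rw [← hrd] at hr hs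
  have hblocks := hE.blocks _ hs
  rw [← hm] at hblocks
  have hT₆ : Trie n str σ₆ := hT₅.frame hF₆ rfl
  have hA₆ : Auto R σ₆ := hA₅.frame hF₆ rfl
  have τ₆ : σ₆.var .tau = τ := by rw [hF₆.var .tau rfl, τ₅]
  refine Run.seq (Run.block ((buildBlocks_spec hT₆ hA₆ τ₆ hr hrd.symm hblocks (by omega)
    hE.n_lt).conseq fun σ₇ _ hF₇ ⟨hB₇, t₇⟩ => ?_))
  have hT₇ : Trie n str σ₇ := hT₆.frame hF₇ rfl
  have hA₇ : Auto R σ₇ := hA₆.frame hF₇ rfl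
  have htable := hE.table
  rw [← hm] at htable
  refine Run.seq (Run.block ((matchTable_spec hT₇ hA₇ hr hB₇ hblocks (by omega) hE.n_lt
    htable).conseq fun σ₈ _ hF₈ ⟨h₈, t₈⟩ => ?_))
  have hT₈ : Trie n str σ₈ := hT₇.frame hF₈ rfl
  have hA₈ : Auto R σ₈ := hA₇.frame hF₈ rfl
  have par₈ : σ₈.arr .par = σ₇.arr .par := hF₈.arr .par rfl
  have htext := hT₈.isTrie.length_text_le le_rfl
  refine Run.block ((reportAll_spec hT₈ hA₈ hr
    (by rw [hF₈.arr .sel rfl, hF₈.arr .rel rfl]; exact hB₇) (by rw [par₈]; exact h₈) hblocks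
    (by omega) hE.n_lt htable (htext.trans_lt hE.text)).conseq fun σ₉ _ hF₉ ⟨h₉, t₉⟩ => ?_)
  have out₈ : σ₈.out = [] := by
    rw [hF₈.out rfl, hF₇.out rfl, hF₆.out rfl, hF₅.out rfl, hF₄.out rfl, hF₃.out rfl, hF₂.out rfl,
      hF₁.out rfl, a8]
  rw [out₈, List.nil_append] at h₉
  rw [← h₉] at t₉
  refine ⟨by rw [h₉]; exact hT₈.isTrie.nodup_reports,
    fun j => by rw [h₉, hT₈.isTrie.mem_reports_iff, hQ], _, hs, ?_⟩
  rw [hm] at t₃ t₄ t₅ t₇ t₈ t₉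
  rw [steps]
  omega

end RegexMatch

/-! ### The running time and the space -/

namespace RegexMatch

open WordRAM

variable {A : ℕ} {n m τ : ℕ}

theorem lt_of_mem_written {v : ℕ} : ∀ {R : RegularExpression (Fin A)}, v ∈ R.written → v < 7 + A
  | .zero, h => by simp [RegularExpression.written] at h; omega
  | .epsilon, h => by simp [RegularExpression.written] at h; omega
  | .char a, h => by simp [RegularExpression.written] at h; omega
  | .comp S T, h => by
    have h1 := @lt_of_mem_written v S
    have h2 := @lt_of_mem_written v T
    simp only [RegularExpression.written, List.mem_append, List.mem_cons, List.not_mem_nil,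
      or_false] at h
    grind
  | .plus S T, h => by
    have h1 := @lt_of_mem_written v S
    have h2 := @lt_of_mem_written v T
    simp only [RegularExpression.written, List.mem_append, List.mem_cons, List.not_mem_nil,
      or_false] at h
    grind
  | .star S, h => by
    have h1 := @lt_of_mem_written v S
    simp only [RegularExpression.written, List.mem_append, List.mem_cons, List.not_mem_nil,
      or_false] at h
    grind

theorem lt_of_mem_words {Z : ZLString A} {Q : List (Fin A)} (hZ : Z.Represents Q) {v : ℕ}
    (hv : v ∈ Z.words) : v < A + Z.length := by
  cases Z with
  | zl78 Z =>
    obtain ⟨phrase, -, h, -⟩ := hZ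
    simp only [ZLString.words, List.mem_flatMap, List.mem_cons, List.not_mem_nil, or_false] at hv
    obtain ⟨z, hz, hv⟩ := hv
    obtain ⟨i, hi, rfl⟩ := List.mem_iff_getElem.1 hz
    have h1 := (h i hi).1
    have h2 := Z[i].2.2
    simp only [ZLString.length]
    omega
  | zlw Z =>
    obtain ⟨phrase, h, -⟩ := hZ
    simp only [ZLString.words, List.mem_map] at hv
    obtain ⟨z, hz, rfl⟩ := hv
    obtain ⟨i, hi, rfl⟩ := List.mem_iff_getElem.1 hz
    have h1 := h i hi
    simp only [ZLString.length]
    cases hc : Z[i] with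
    | char a => simp only [ZLWCode.word]; omega
    | entry j =>
      rw [hc] at h1
      have := h1.1
      simp only [ZLWCode.word]
      omega

/-- The machine with arrays just large enough for the program. All numbers in variables and arrays
are below the tenth power of the sum `B` of the parameters, so that `B ^ 240` bounds their `24`th
powers. -/
def env (A n m τ w : ℕ) (input : List ℕ) (hn : 1 ≤ n) (hm : 1 ≤ m) (hτ : 1 ≤ τ)
    (hw : (A + n + m + τ) ^ 240 ≤ 2 ^ w) (hi : ∀ v ∈ input, v < 7 + (A + n + m + τ)) : Env where
  w := w
  M := 4 * (n / τ) * m ^ 2 + 20 * (n * m)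
  U := (A + n + m + τ) ^ 10
  input := input
  le_U := (by norm_num : 64 ≤ 3 ^ 10).trans (Nat.pow_le_pow_left (by omega) 10)
  mem_le := by
    obtain ⟨B, hB⟩ : ∃ B, B = A + n + m + τ := ⟨_, rfl⟩
    rw [← hB]
    have h1 : n / τ * m ^ 2 ≤ B * B ^ 2 :=
      Nat.mul_le_mul ((Nat.div_le_self _ _).trans (by omega)) (Nat.pow_le_pow_left (by omega) 2)
    have h2 : n * m * 1 ≤ B * B * B :=
      Nat.mul_le_mul (Nat.mul_le_mul (by omega) (by omega)) (by omega)
    have h3 : B ^ 3 * 3 ^ 7 ≤ B ^ 3 * B ^ 7 :=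
      Nat.mul_le_mul_left _ (Nat.pow_le_pow_left (by omega) 7)
    rw [← pow_add] at h3
    rw [← pow_succ'] at h1
    rw [← pow_two, ← pow_succ] at h2
    norm_num at h1 h2 h3
    rw [mul_assoc]
    omega
  pow_le := by rw [← pow_mul]; exact hw
  input_lt v hv := by
    refine (hi v hv).trans_le ?_
    obtain ⟨B, hB⟩ : ∃ B, B = A + n + m + τ := ⟨_, rfl⟩
    rw [← hB]
    have h3 : B * 3 ^ 9 ≤ B * B ^ 9 := Nat.mul_le_mul_left _ (Nat.pow_le_pow_left (by omega) 9)
    rw [← pow_succ'] at h3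
    norm_num at h3
    omega

theorem fits_env {w : ℕ} {input : List ℕ} (hn : 1 ≤ n) (hm : 1 ≤ m) (hτ : 1 ≤ τ)
    (hw : (A + n + m + τ) ^ 240 ≤ 2 ^ w) (hi : ∀ v ∈ input, v < 7 + (A + n + m + τ)) :
    Fits (env A n m τ w input hn hm hτ hw hi) A n m τ := by
  obtain ⟨B, hB⟩ : ∃ B, B = A + n + m + τ := ⟨_, rfl⟩
  have h1 : n * 1 ≤ n * m := Nat.mul_le_mul_left _ hm
  have h2 : 1 * m ≤ n * m := Nat.mul_le_mul_right _ hn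
  have h3 : B ^ 2 * 3 ^ 8 ≤ B ^ 2 * B ^ 8 :=
    Nat.mul_le_mul_left _ (Nat.pow_le_pow_left (by omega) 8)
  have h4 : n * n ≤ B * B := Nat.mul_le_mul (by omega) (by omega)
  have h5 : B * 3 ≤ B * B := Nat.mul_le_mul_left _ (by omega)
  rw [← pow_add] at h3
  norm_num at h3
  rw [pow_two] at h3
  constructor
  · simp only [env]; omega
  · simp only [env]; omega
  · simp only [env]
    have : (n + 1) * (2 * m) = 2 * (n * m) + 2 * m := by ring
    omega
  · intro s hs
    simp only [env]
    have : s ≤ n / τ := (Nat.le_div_iff_mul_le hτ).2 hs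
    calc s * (2 * m * (2 * m)) = 4 * s * m ^ 2 := by ring
      _ ≤ 4 * (n / τ) * m ^ 2 := by gcongr
      _ ≤ _ := Nat.le_add_right _ _
  all_goals
    simp only [env]
    rw [← hB]
    omega

theorem steps_le {c s : ℕ} (hn : 1 ≤ n) (hm : 1 ≤ m) (hτ : 1 ≤ τ) (hs : s * τ ≤ n) :
    steps n m τ c s ≤ 10000 * (n * m * (m + τ) + c * m) := by
  have hsn : s ≤ n := le_trans (Nat.le_mul_of_pos_right _ hτ) hs
  have hmm : m ≤ m * m := Nat.le_mul_of_pos_right _ hm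
  have h1 : n * m ≤ n * m * m := Nat.le_mul_of_pos_right _ hm
  have h2 : n ≤ n * m := Nat.le_mul_of_pos_right _ hm
  have h3 : m ≤ n * m := Nat.le_mul_of_pos_left _ hn
  have h4 : n * τ ≤ n * m * τ := Nat.mul_le_mul_right _ h2
  have h5 : τ ≤ n * τ := Nat.le_mul_of_pos_left _ hn
  have h6 : s * τ * (m * m) ≤ n * (m * m) := Nat.mul_le_mul_right _ hs
  have h7 : s * τ * m ≤ n * m := Nat.mul_le_mul_right _ hs
  have h8 : s * (m * m) ≤ n * (m * m) := Nat.mul_le_mul_right _ hsn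
  have h9 : s * m ≤ n * m := Nat.mul_le_mul_right _ hsn
  have h10 : c ≤ c * m := Nat.le_mul_of_pos_right _ hm
  rw [steps]
  linarith

end RegexMatch

open RegexMatch in
theorem theorem2 :
    ∃ (P : WordRAM.Prog) (c : ℕ),
      ∀ (σ : ℕ) (Z : ZLString σ) (Q : List (Fin σ)) (R : RegularExpression (Fin σ))
        (n m τ w : ℕ),
        Z.Represents Q → Z.length = n → 1 ≤ n → R.written.length = m → 1 ≤ τ →
        (σ + n + m + τ) ^ c ≤ 2 ^ w →
        ∃ (t s : ℕ) (out : List ℕ),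
          WordRAM.Computes P w (matchInput Z R τ) t s out ∧
          out.Nodup ∧ (∀ j, j ∈ out ↔ j ∈ matchEnds R Q) ∧
          (t : ℝ) ≤ c * ((n : ℝ) * m * (m + τ)
            + (matchEnds R Q).ncard * (m * Real.logb 2 (m + 1))) ∧
          (s : ℝ) ≤ c * ((n : ℝ) * m ^ 2 / τ + (n : ℝ) * m) := by
  refine ⟨program.code, 10000, fun A Z Q R n m τ w hZ hn h1 hm hτ hw => ?_⟩
  have hm1 : 1 ≤ m := hm ▸ length_pos R
  have hw' : (A + n + m + τ) ^ 240 ≤ 2 ^ w :=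
    (Nat.pow_le_pow_right (by omega) (by norm_num)).trans hw
  have hi : ∀ v ∈ matchInput Z R τ, v < 7 + (A + n + m + τ) := by
    intro v hv
    simp only [matchInput, List.mem_append, List.mem_cons, List.not_mem_nil, or_false] at hv
    have hf : Z.format < 2 := by cases Z <;> simp [ZLString.format]
    rcases hv with (hv | hv) | hv
    · omega
    · have := lt_of_mem_words hZ hv
      omega
    · have := lt_of_mem_written hv
      omega
  set E := env A n m τ w (matchInput Z R τ) h1 hm1 hτ hw' hi with hE
  have hU : 0 < E.U := lt_of_lt_of_le (by norm_num) E.le_U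
  obtain ⟨t, y, σ', hexec, hsim, -, -, ht, hnd, hmem, s, hs, hts⟩ :=
    program_spec hZ rfl hn hm hτ (fits_env h1 hm1 hτ hw' hi) rfl ⟨fun _ => hU, fun _ _ => hU⟩
      WordRAM.State.init ⟨fun _ => rfl, fun _ _ _ => rfl, rfl⟩
  refine ⟨t, 32 * E.M, σ'.out, ⟨y, hexec, hsim.out⟩, hnd, hmem, ?_, ?_⟩
  · have hcard : (matchEnds R Q).ncard = σ'.out.length := by
      rw [← List.toFinset_card_of_nodup hnd, ← Set.ncard_coe_finset]
      congr 1
      ext j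
      simp [hmem]
    have hle : t ≤ 10000 * (n * m * (m + τ) + σ'.out.length * m) := by
      have := steps_le (c := σ'.out.length) h1 hm1 hτ hs
      simp only at ht
      omega
    have hlog : 1 ≤ Real.logb 2 (m + 1) := by
      rw [Real.le_logb_iff_rpow_le one_lt_two (by positivity), Real.rpow_one]
      have : (1 : ℝ) ≤ m := by exact_mod_cast hm1
      linarith
    rw [hcard]
    calc (t : ℝ) ≤ (10000 * (n * m * (m + τ) + σ'.out.length * m) : ℕ) := by exact_mod_cast hle
      _ = 10000 * ((n : ℝ) * m * (m + τ) + σ'.out.length * (m * 1)) := by push_cast; ring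
      _ ≤ _ := by push_cast; gcongr
  · have hdiv : ((n / τ : ℕ) : ℝ) ≤ n / τ := Nat.cast_div_le
    calc ((32 * E.M : ℕ) : ℝ)
        = 128 * ((n / τ : ℕ) * (m : ℝ) ^ 2) + 640 * ((n : ℝ) * m) := by
          simp only [hE, env]; push_cast; ring
      _ ≤ 10000 * ((n : ℝ) / τ * m ^ 2) + 10000 * ((n : ℝ) * m) := by gcongr <;> norm_num
      _ = _ := by push_cast; ring
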